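/- Let $M$ be a compact smooth manifold without boundary, of dimension $m$ (neither orientability nor connectedness is assumed), and let $Z\subset M$ be a closed embedded submanifold of codimension one (possibly empty); such a pair $(M,Z)$ is called a compact b-manifold. Let $T_ZM\to M$ be the vector bundle whose sections are the vector fields on $M$ tangent to $Z$, let $\Omega^k_Z(M)=\Gamma(\wedge^kT_Z^*M)$ be the b-forms of degree $k$, with the differential $d$ that extends the de Rham differential on $M\setminus Z$ (given by the Koszul formula on vector fields tangent to $Z$), and let $H^{\mathrm{top}}_Z(M)=\Omega^m_Z(M)/d\Omega^{m-1}_Z(M)$ be the b-cohomology in top degree. A b-diffeomorphism of $(M,Z)$ is a diffeomorphism $\varphi$ of $M$ with $\varphi^{-1}(Z)=Z$. Then: (1) If $\mu,\mu'\in\Omega^{m}_Z(M)$ are nowhere vanishing sections of $\wedge^mT_Z^*M$ with $[\mu]=[\mu']\in H^{\mathrm{top}}_Z(M)$, then there exists a b-diffeomorphism $\varphi$ of $(M,Z)$ such that $\varphi^*(\mu')=\mu$. (2) Consequently, generic Nambu structures of top degree with singular locus $Z$, i.e. sections $w\in\Gamma(\wedge^mTM)$ that are transverse to the zero section and vanish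 exactly on $Z$, are classified by their b-cohomology class: each such $w$ has a unique inverse b-top-form $w^{-1}\in\Omega^m_Z(M)$ (the one with $\nu=\langle\nu,w\rangle\, w^{-1}$ for every $\nu\in\Omega^m(M)$), and if $w,w'$ are two such structures with $[w^{-1}]=[w'^{-1}]\in H^{\mathrm{top}}_Z(M)$, then there exists a b-diffeomorphism $\varphi$ of $(M,Z)$ with $\varphi_*(w)=w'$. -/

import Mathlib

open Set Filter Topology
open scoped Manifold ContDiff

noncomputable section
namespace BGeom

/-- Smooth real functions on the `m`-manifold `M` (without boundary). -/
abbrev SmoothFun (m : ℕ) (M : Type*) [TopologicalSpace M]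
    [ChartedSpace (EuclideanSpace ℝ (Fin m)) M] : Type _ :=
  C^∞⟮𝓡 m, M; 𝓘(ℝ, ℝ), ℝ⟯

/-- Smooth vector fields on `M`. -/
abbrev VField (m : ℕ) (M : Type*) [TopologicalSpace M]
    [ChartedSpace (EuclideanSpace ℝ (Fin m)) M] [IsManifold (𝓡 m) ∞ M] : Type _ :=
  Cₛ^∞⟮𝓡 m; EuclideanSpace ℝ (Fin m), (TangentSpace (𝓡 m) : M → Type _)⟯

/-- `(M, Z)` is a b-manifold: `Z` is a closed embedded submanifold of codimension one, that is, `Z`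
is closed and around each of its points there is a smooth chart of `M` in which `Z` is the vanishing
set of one of the coordinates. `Z` may be empty. -/
structure IsBManifold (m : ℕ) {M : Type*} [TopologicalSpace M]
    [ChartedSpace (EuclideanSpace ℝ (Fin m)) M] (Z : Set M) : Prop where
  isClosed : IsClosed Z
  slice : ∀ p ∈ Z, ∃ e ∈ IsManifold.maximalAtlas (𝓡 m) ∞ M, p ∈ e.source ∧
    ∃ i : Fin m, ∀ q ∈ e.source, q ∈ Z ↔ e q i = 0

section
variable {m : ℕ} {M : Type*} [TopologicalSpace M] [ChartedSpace (EuclideanSpace ℝ (Fin m)) M]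
  [IsManifold (𝓡 m) ∞ M]

theorem contMDiff_directional {f : M → ℝ} (hf : ContMDiff (𝓡 m) 𝓘(ℝ, ℝ) ∞ f)
    {V : Π x : M, TangentSpace (𝓡 m) x}
    (hV : ContMDiff (𝓡 m) (𝓡 m).tangent ∞ fun x ↦ (⟨x, V x⟩ : TangentBundle (𝓡 m) M)) :
    ContMDiff (𝓡 m) 𝓘(ℝ, ℝ) ∞ fun x ↦ mvfderiv (𝓡 m) f x (V x) :=
  (contMDiff_snd_tangentBundle_modelSpace ℝ 𝓘(ℝ, ℝ)).comp
    ((hf.contMDiff_tangentMap (m := ∞) (by simp)).comp hV)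

theorem fderiv_comp_extChartAt_symm {g : M → ℝ} (V : Π x : M, TangentSpace (𝓡 m) x)
    {x : M} {y : EuclideanSpace ℝ (Fin m)} (hy : y ∈ (extChartAt (𝓡 m) x).target)
    (hg : MDifferentiableAt (𝓡 m) 𝓘(ℝ, ℝ) g ((extChartAt (𝓡 m) x).symm y)) :
    fderiv ℝ (g ∘ (extChartAt (𝓡 m) x).symm) y
      (VectorField.mpullbackWithin 𝓘(ℝ, EuclideanSpace ℝ (Fin m)) (𝓡 m) (extChartAt (𝓡 m) x).symm V
        (range (𝓡 m)) y) = mvfderiv (𝓡 m) g ((extChartAt (𝓡 m) x).symm y)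
          (V ((extChartAt (𝓡 m) x).symm y)) := by
  have : IsManifold (𝓡 m) 1 M := .of_le (n := ∞) (by simp)
  have hinv := isInvertible_mfderivWithin_extChartAt_symm (I := 𝓡 m) hy
  have hd := (mdifferentiableOn_extChartAt_symm (I := 𝓡 m) (x := x)) y hy
  have ht : (extChartAt (𝓡 m) x).target ∈ 𝓝 y := extChartAt_target_mem_nhds' hy
  have hd' := hd.mdifferentiableAt ht
  have hr : range (𝓡 m) = univ := ModelWithCorners.range_eq_univ _
  rw [hr, mfderivWithin_univ] at hinv
  rw [hr, VectorField.mpullbackWithin_apply, mfderivWithin_univ]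
  have h1 : fderiv ℝ (g ∘ (extChartAt (𝓡 m) x).symm) y =
      (mvfderiv (𝓡 m) g ((extChartAt (𝓡 m) x).symm y)).comp
        (mfderiv 𝓘(ℝ, EuclideanSpace ℝ (Fin m)) (𝓡 m) (extChartAt (𝓡 m) x).symm y) := by
    rw [← mfderiv_eq_fderiv]
    exact mfderiv_comp y hg hd'
  rw [h1]
  exact congrArg _ (hinv.self_apply_inverse _)


theorem mvfderiv_mlieBracket {f : M → ℝ}
    (hf : ContMDiff (𝓡 m) 𝓘(ℝ, ℝ) ∞ f)
    {V W : Π x : M, TangentSpace (𝓡 m) x}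
    (hV : ContMDiff (𝓡 m) (𝓡 m).tangent ∞ fun x ↦ (⟨x, V x⟩ : TangentBundle (𝓡 m) M))
    (hW : ContMDiff (𝓡 m) (𝓡 m).tangent ∞ fun x ↦ (⟨x, W x⟩ : TangentBundle (𝓡 m) M)) (x : M) :
    mvfderiv (𝓡 m) f x (VectorField.mlieBracket (𝓡 m) V W x) =
      mvfderiv (𝓡 m) (fun y ↦ mvfderiv (𝓡 m) f y (W y)) x (V x) -
        mvfderiv (𝓡 m) (fun y ↦ mvfderiv (𝓡 m) f y (V y)) x (W x) := by
  have h2 : (2 : ℕ∞ω) ≤ ∞ := WithTop.coe_le_coe.2 (by simp : (2 : ℕ∞) ≤ ⊤)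
  have h3 : (3 : ℕ∞ω) ≤ ∞ := WithTop.coe_le_coe.2 (by simp : (3 : ℕ∞) ≤ ⊤)
  have : IsManifold (𝓡 m) 1 M := .of_le (n := ∞) (by simp)
  have : IsManifold (𝓡 m) 2 M := .of_le (n := ∞) h2
  have : IsManifold (𝓡 m) (minSmoothness ℝ 2) M := by simpa using ‹IsManifold (𝓡 m) 2 M›
  have : IsManifold (𝓡 m) (minSmoothness ℝ 3) M := by
    simpa using (IsManifold.of_le (n := ∞) h3 : IsManifold (𝓡 m) 3 M)
  have hr : range (𝓡 m) = univ := ModelWithCorners.range_eq_univ _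
  set E := EuclideanSpace ℝ (Fin m)
  set ψ := (extChartAt (𝓡 m) x).symm with hψ
  set p := extChartAt (𝓡 m) x x with hp
  have hpt : p ∈ (extChartAt (𝓡 m) x).target := mem_extChartAt_target x
  have hψp : ψ p = x := extChartAt_to_inv x
  have ht : (extChartAt (𝓡 m) x).target ∈ 𝓝 p := extChartAt_target_mem_nhds x
  let V' : E → E := VectorField.mpullbackWithin 𝓘(ℝ, E) (𝓡 m) ψ V univ
  let W' : E → E := VectorField.mpullbackWithin 𝓘(ℝ, E) (𝓡 m) ψ W univ
  let F : E → ℝ := f ∘ ψ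
  have hV' : DifferentiableAt ℝ V' p := by
    have := MDifferentiableWithinAt.differentiableWithinAt_mpullbackWithin_vectorField
      (I := 𝓡 m) (s := univ) (x := x) ((hV.mdifferentiable (by simp)) x).mdifferentiableWithinAt
    rw [preimage_univ, univ_inter, hr] at this
    exact differentiableWithinAt_univ.1 this
  have hW' : DifferentiableAt ℝ W' p := by
    have := MDifferentiableWithinAt.differentiableWithinAt_mpullbackWithin_vectorField
      (I := 𝓡 m) (s := univ) (x := x) ((hW.mdifferentiable (by simp)) x).mdifferentiableWithinAt
    rw [preimage_univ, univ_inter, hr] at this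
    exact differentiableWithinAt_univ.1 this
  have hF : ContDiffAt ℝ ∞ F p := by
    have h1 : ContMDiffOn 𝓘(ℝ, E) 𝓘(ℝ, ℝ) ∞ F (extChartAt (𝓡 m) x).target :=
      hf.comp_contMDiffOn (contMDiffOn_extChartAt_symm x)
    exact (h1.contMDiffAt ht).contDiffAt
  have hF' : DifferentiableAt ℝ (fderiv ℝ F) p :=
    (hF.fderiv_right (m := 1) (by simpa [one_add_one_eq_two] using h2)).differentiableAt (by simp)
  have hsymm : IsSymmSndFDerivAt ℝ F p :=
    hF.isSymmSndFDerivAt (by simpa using h2)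
  have key : ∀ {A : Π x : M, TangentSpace (𝓡 m) x},
      (fun z ↦ mvfderiv (𝓡 m) f z (A z)) ∘ ψ =ᶠ[𝓝 p] fun y ↦ fderiv ℝ F y
        (VectorField.mpullbackWithin 𝓘(ℝ, E) (𝓡 m) ψ A (range (𝓡 m)) y) := by
    intro A
    filter_upwards [ht] with y hy
    exact (fderiv_comp_extChartAt_symm A hy (hf.mdifferentiable (by simp) _)).symm
  have key2 : ∀ {g : M → ℝ}, ContMDiff (𝓡 m) 𝓘(ℝ, ℝ) ∞ g → ∀ A : Π x : M, TangentSpace (𝓡 m) x,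
      mvfderiv (𝓡 m) g x (A x) = fderiv ℝ (g ∘ ψ) p
        (VectorField.mpullbackWithin 𝓘(ℝ, E) (𝓡 m) ψ A (range (𝓡 m)) p) := by
    intro g hg A
    have := fderiv_comp_extChartAt_symm A hpt (hg.mdifferentiable (by simp) _)
    rw [← hψ, hψp] at this
    exact this.symm
  have hb : VectorField.mpullbackWithin 𝓘(ℝ, E) (𝓡 m) ψ (VectorField.mlieBracket (𝓡 m) V W)
      (range (𝓡 m)) p = VectorField.lieBracket ℝ V' W' p := by
    have h1 := VectorField.mpullbackWithin_mlieBracketWithin (I := 𝓘(ℝ, E)) (I' := 𝓡 m)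
      (f := ψ) (V := V) (W := W) (x₀ := p) (s := univ) (t := univ) (n := ∞)
      ((hV.mdifferentiable (by simp)) _).mdifferentiableWithinAt
      ((hW.mdifferentiable (by simp)) _).mdifferentiableWithinAt
      uniqueMDiffOn_univ ((contMDiffOn_extChartAt_symm x).contMDiffAt ht).contMDiffWithinAt
      (mem_univ _) (by simpa using h2) (by simp) (by simp)
    have h4 : ∀ A B : Π y : E, TangentSpace 𝓘(ℝ, E) y,
        VectorField.mlieBracketWithin 𝓘(ℝ, E) A B univ = VectorField.lieBracketWithin ℝ A B univ :=
      fun A B ↦ VectorField.mlieBracketWithin_eq_lieBracketWithin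
    rw [VectorField.mlieBracketWithin_univ, h4] at h1
    rw [hr, h1]
    exact congrFun (VectorField.lieBracketWithin_univ (𝕜 := ℝ) (V := V') (W := W')) p
  rw [key2 hf, hb, key2 (contMDiff_directional hf hW), key2 (contMDiff_directional hf hV),
    key.fderiv_eq, key.fderiv_eq]
  have hVe : VectorField.mpullbackWithin 𝓘(ℝ, E) (𝓡 m) ψ V (range (𝓡 m)) = V' := by rw [hr]
  have hWe : VectorField.mpullbackWithin 𝓘(ℝ, E) (𝓡 m) ψ W (range (𝓡 m)) = W' := by rw [hr]
  rw [hVe, hWe, fderiv_clm_apply hF' hW', fderiv_clm_apply hF' hV']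
  simp only [VectorField.lieBracket_eq, map_sub]
  have := hsymm (V' p) (W' p)
  simp [this]
  rfl

/-- The derivative `V f = df(V)` of a smooth function along a smooth vector field. -/
def VField.deriv (V : VField m M) (f : SmoothFun m M) : SmoothFun m M :=
  ⟨fun x ↦ mvfderiv (𝓡 m) f x (V x), contMDiff_directional f.contMDiff V.contMDiff⟩

/-- The Lie bracket of smooth vector fields. -/
def VField.bracket (V W : VField m M) : VField m M where
  toFun := VectorField.mlieBracket (𝓡 m) V W
  contMDiff_toFun := by
    have h3 : (3 : ℕ∞ω) ≤ ∞ := WithTop.coe_le_coe.2 (by simp : (3 : ℕ∞) ≤ ⊤)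
    have : IsManifold (𝓡 m) (minSmoothness ℝ 3) M := by
      simpa using (IsManifold.of_le (n := ∞) h3 : IsManifold (𝓡 m) 3 M)
    have : IsManifold (𝓡 m) (((⊤ : ℕ∞) : ℕ∞ω) + 1) M := by simpa
    exact ContDiff.mlieBracket_vectorField (m := ⊤) (n := ⊤) V.contMDiff W.contMDiff (by simp)

theorem VField.bracket_deriv (V W : VField m M) (f : SmoothFun m M) :
    (V.bracket W).deriv f = V.deriv (W.deriv f) - W.deriv (V.deriv f) := by
  ext x
  exact mvfderiv_mlieBracket f.contMDiff V.contMDiff W.contMDiff x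

instance : SMul (SmoothFun m M) (VField m M) :=
  ⟨fun f V ↦ ⟨fun x ↦ f x • V x, f.contMDiff.smul_section V.contMDiff⟩⟩

theorem smul_vField_apply (f : SmoothFun m M) (V : VField m M) (x : M) : (f • V) x = f x • V x :=
  rfl

/-- Smooth vector fields form a module over the ring of smooth functions. -/
instance : Module (SmoothFun m M) (VField m M) where
  one_smul V := by ext x; exact one_smul ℝ (V x)
  mul_smul f g V := by ext x; exact mul_smul (f x) (g x) (V x)
  smul_zero f := by ext x; exact smul_zero (f x)
  smul_add f V W := by ext x; exact smul_add (f x) (V x) (W x)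
  add_smul f g V := by ext x; exact add_smul (f x) (g x) (V x)
  zero_smul V := by ext x; exact zero_smul ℝ (V x)

/-- The tangent space `T_p Z ⊆ T_p M`: the vectors that annihilate all smooth functions vanishing on
`Z`. -/
def tangentTo (m : ℕ) {M : Type*} [TopologicalSpace M] [ChartedSpace (EuclideanSpace ℝ (Fin m)) M]
    (Z : Set M) (p : M) : Submodule ℝ (TangentSpace (𝓡 m) p) where
  carrier := {v | ∀ f : SmoothFun m M, (∀ q ∈ Z, f q = 0) → mvfderiv (𝓡 m) f p v = 0}
  add_mem' hv hw f hf := by rw [map_add, hv f hf, hw f hf, add_zero]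
  zero_mem' f _ := map_zero _
  smul_mem' c v hv f hf := by rw [map_smul, hv f hf, smul_zero]

/-- The module `Γ(T_Z M)` of b-vector fields: the smooth vector fields on `M` tangent to `Z`. -/
def bFields (m : ℕ) {M : Type*} [TopologicalSpace M] [ChartedSpace (EuclideanSpace ℝ (Fin m)) M]
    [IsManifold (𝓡 m) ∞ M] (Z : Set M) : Submodule (SmoothFun m M) (VField m M) where
  carrier := {V | ∀ p ∈ Z, V p ∈ tangentTo m Z p}
  add_mem' hV hW p hp := (tangentTo m Z p).add_mem (hV p hp) (hW p hp)
  zero_mem' p _ := (tangentTo m Z p).zero_mem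
  smul_mem' f _ hV p hp := (tangentTo m Z p).smul_mem (f p) (hV p hp)

variable {Z : Set M}

/-- The Lie bracket of two b-vector fields, which is again a b-vector field. -/
def bBracket (V W : bFields m Z) : bFields m Z :=
  ⟨V.1.bracket W.1, fun p hp f hf ↦ by
    have h := congrArg (fun g : SmoothFun m M ↦ g p) (VField.bracket_deriv V.1 W.1 f)
    have hV : V.1.deriv (W.1.deriv f) p = 0 := V.2 p hp _ fun q hq ↦ W.2 q hq f hf
    have hW : W.1.deriv (V.1.deriv f) p = 0 := W.2 p hp _ fun q hq ↦ V.2 q hq f hf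
    have h' : (V.1.bracket W.1).deriv f p =
      V.1.deriv (W.1.deriv f) p - W.1.deriv (V.1.deriv f) p := h
    rw [hV, hW, sub_zero] at h'
    exact h'⟩

/-- The b-forms of degree `k`, `Ω^k_Z(M) = Γ(⋀^k T_Z^* M)`. A smooth section of `⋀^k T_Z^* M` is the
same as a `C^∞(M)`-multilinear alternating map of `k` sections of `T_Z M` with values in `C^∞(M)`.
For `Z = ∅` these are the usual differential forms on `M`. -/
abbrev BForm (m : ℕ) {M : Type*} [TopologicalSpace M] [ChartedSpace (EuclideanSpace ℝ (Fin m)) M]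
    [IsManifold (𝓡 m) ∞ M] (Z : Set M) (k : ℕ) : Type _ :=
  bFields m Z [⋀^Fin k]→ₗ[SmoothFun m M] SmoothFun m M

/-- The value `(dη)(V_0, …, V_k)` of the differential of a b-form `η` of degree `k`, given by the
usual (Koszul) formula
`∑_i (-1)^i V_i(η(…, V̂_i, …)) + ∑_{i<j} (-1)^{i+j} η([V_i, V_j], …, V̂_i, …, V̂_j, …)`.
In the double sum `(i, j)` stands for the pair of indices `(i, j + 1)`, hence the minus sign. -/
def bDiff : {k : ℕ} → BForm m Z k → (Fin (k + 1) → bFields m Z) → SmoothFun m M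
  | 0, η, V => (V 0).1.deriv (η ![])
  | k + 1, η, V =>
      (∑ i : Fin (k + 2), (-1 : ℤ) ^ (i : ℕ) • (V i).1.deriv (η (i.removeNth V))) -
        ∑ i : Fin (k + 1), ∑ j ∈ Finset.Ici i, (-1 : ℤ) ^ (i + j : ℕ) •
          η (Matrix.vecCons (bBracket (V i.castSucc) (V j.succ))
            (j.removeNth (i.castSucc.removeNth V)))

theorem VField.deriv_add (V : VField m M) (f g : SmoothFun m M) :
    V.deriv (f + g) = V.deriv f + V.deriv g := by
  ext x
  have := mvfderiv_add (f.contMDiff.mdifferentiable (by simp) x)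
    (g.contMDiff.mdifferentiable (by simp) x)
  exact congrArg (fun L ↦ L (V x)) this

theorem VField.deriv_smul (V : VField m M) (c : ℝ) (f : SmoothFun m M) :
    V.deriv (c • f) = c • V.deriv f := by
  ext x
  have := mvfderiv_smul (I := 𝓡 m) (x := x) (a := fun _ ↦ c) mdifferentiableAt_const
    (f.contMDiff.mdifferentiable (by simp) x)
  have h2 := congrArg (fun L ↦ L (V x)) this
  rw [mvfderiv_const] at h2
  simpa using! h2

theorem bDiff_add {k : ℕ} (η η' : BForm m Z k) (V : Fin (k + 1) → bFields m Z) :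
    bDiff (η + η') V = bDiff η V + bDiff η' V := by
  cases k with
  | zero => exact VField.deriv_add _ _ _
  | succ k =>
    simp only [bDiff, AlternatingMap.add_apply, VField.deriv_add, smul_add, Finset.sum_add_distrib]
    abel

theorem bDiff_smul {k : ℕ} (c : ℝ) (η : BForm m Z k) (V : Fin (k + 1) → bFields m Z) :
    bDiff (c • η) V = c • bDiff η V := by
  cases k with
  | zero => exact VField.deriv_smul _ _ _
  | succ k =>
    simp only [bDiff, AlternatingMap.smul_apply, VField.deriv_smul, smul_sub, Finset.smul_sum,
      smul_comm c]

/-- The real subspace of exact b-forms of degree `k`, the image of `d : Ω^{k-1}_Z(M) → Ω^k_Z(M)`. -/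
def exactBForms (m : ℕ) {M : Type*} [TopologicalSpace M]
    [ChartedSpace (EuclideanSpace ℝ (Fin m)) M] [IsManifold (𝓡 m) ∞ M] (Z : Set M) :
    (k : ℕ) → Submodule ℝ (BForm m Z k)
  | 0 => ⊥
  | k + 1 =>
    { carrier := {α | ∃ η : BForm m Z k, ∀ V, α V = bDiff η V}
      add_mem' := by
        rintro α α' ⟨η, h⟩ ⟨η', h'⟩
        exact ⟨η + η', fun V ↦ by rw [AlternatingMap.add_apply, h, h', bDiff_add]⟩
      zero_mem' := ⟨0, fun V ↦ by
        have := bDiff_smul (0 : ℝ) (0 : BForm m Z k) V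
        rw [zero_smul, zero_smul] at this
        rw [this]; rfl⟩
      smul_mem' := by
        rintro c α ⟨η, h⟩
        exact ⟨c • η, fun V ↦ by rw [AlternatingMap.smul_apply, h, bDiff_smul]⟩ }

/-- The top-degree b-cohomology `H^top_Z(M)` of the `m`-manifold `M`. Since `T_Z M` has rank `m`,
every b-form of degree `m` is closed, so that this is `Ω^m_Z(M) / d Ω^{m-1}_Z(M)`. -/
abbrev TopCohomology (m : ℕ) {M : Type*} [TopologicalSpace M]
    [ChartedSpace (EuclideanSpace ℝ (Fin m)) M] [IsManifold (𝓡 m) ∞ M] (Z : Set M) : Type _ :=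
  BForm m Z m ⧸ exactBForms m Z m

/-- The cohomology class of a b-top-form. -/
def topClass (μ : BForm m Z m) : TopCohomology m Z := (exactBForms m Z m).mkQ μ

/-- The b-form `α` vanishes at no point of `M` as a section of `⋀^k T_Z^* M`. (The values at `p` of
the b-vector fields fill the fibre of `T_Z M` at `p`.) -/
def BForm.NowhereVanishing {k : ℕ} (α : BForm m Z k) : Prop :=
  ∀ p : M, ∃ V : Fin k → bFields m Z, α V p ≠ 0

theorem isInvertible_mfderiv_symm (φ : M ≃ₘ⟮𝓡 m, 𝓡 m⟯ M) (x : M) :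
    (mfderiv (𝓡 m) (𝓡 m) φ.symm x).IsInvertible :=
  ⟨φ.symm.mfderivToContinuousLinearEquiv (by simp) x, rfl⟩

/-- The push-forward `φ_* V` of a vector field by a diffeomorphism. -/
def VField.push (φ : M ≃ₘ⟮𝓡 m, 𝓡 m⟯ M) (V : VField m M) : VField m M where
  toFun := VectorField.mpullback (𝓡 m) (𝓡 m) φ.symm V
  contMDiff_toFun := by
    have : IsManifold (𝓡 m) (∞ + 1) M := by simpa
    exact ContMDiff.mpullback_vectorField (n := ∞) V.contMDiff φ.symm.contMDiff
      (isInvertible_mfderiv_symm φ) (by simp)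

theorem VField.push_deriv (φ : M ≃ₘ⟮𝓡 m, 𝓡 m⟯ M) (V : VField m M) (f : SmoothFun m M) (y : M) :
    (V.push φ).deriv f y = V.deriv (f.comp ⟨φ, φ.contMDiff⟩) (φ.symm y) := by
  let g : SmoothFun m M := f.comp ⟨φ, φ.contMDiff⟩
  have hg : (g : M → ℝ) ∘ φ.symm = f := by
    ext z
    exact congrArg f (φ.apply_symm_apply z)
  have h := mvfderiv_comp (I := 𝓡 m) (I' := 𝓡 m) y (g.contMDiff.mdifferentiable (by simp) _)
    (φ.symm.contMDiff.mdifferentiable (by simp) y)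
  rw [hg] at h
  change mvfderiv (𝓡 m) f y ((V.push φ) y) = mvfderiv (𝓡 m) g (φ.symm y) (V (φ.symm y))
  rw [h]
  exact congrArg _ ((isInvertible_mfderiv_symm φ y).self_apply_inverse _)

/-- The push-forward of b-vector fields by a diffeomorphism that preserves `Z`. -/
def bPush (φ : M ≃ₘ⟮𝓡 m, 𝓡 m⟯ M) (hφ : φ ⁻¹' Z = Z) (V : bFields m Z) : bFields m Z :=
  ⟨V.1.push φ, fun y hy f hf ↦ by
    have hy' : φ.symm y ∈ Z := by
      rw [← hφ]
      simpa using hy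
    refine (V.1.push_deriv φ f y).trans (V.2 _ hy' _ fun q hq ↦ hf _ ?_)
    rw [← hφ] at hq
    exact hq⟩

theorem bPush_add (φ : M ≃ₘ⟮𝓡 m, 𝓡 m⟯ M) (hφ : φ ⁻¹' Z = Z) (V W : bFields m Z) :
    bPush φ hφ (V + W) = bPush φ hφ V + bPush φ hφ W := by
  ext x
  exact VectorField.mpullback_add_apply

theorem bPush_smul (φ : M ≃ₘ⟮𝓡 m, 𝓡 m⟯ M) (hφ : φ ⁻¹' Z = Z) (f : SmoothFun m M)
    (V : bFields m Z) :
    bPush φ hφ (f • V) = f.comp ⟨φ.symm, φ.symm.contMDiff⟩ • bPush φ hφ V := by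
  ext x
  exact VectorField.mpullback_smul_apply (g := f)

/-- The pull-back `φ^* α` of a b-form by a diffeomorphism that preserves `Z`:
`(φ^* α)(V_1, …, V_k) = α(φ_* V_1, …, φ_* V_k) ∘ φ`. -/
def BForm.pull {k : ℕ} (φ : M ≃ₘ⟮𝓡 m, 𝓡 m⟯ M) (hφ : φ ⁻¹' Z = Z) (α : BForm m Z k) :
    BForm m Z k where
  toFun V := (α fun i ↦ bPush φ hφ (V i)).comp ⟨φ, φ.contMDiff⟩
  map_update_add' V i X Y := by
    have h (X : bFields m Z) : (fun j ↦ bPush φ hφ (Function.update V i X j)) =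
        Function.update (fun j ↦ bPush φ hφ (V j)) i (bPush φ hφ X) := by
      ext1 j
      by_cases hj : j = i
      · subst hj; simp
      · simp [hj]
    rw [h, h, h, bPush_add, α.map_update_add]
    rfl
  map_update_smul' V i f X := by
    have h (X : bFields m Z) : (fun j ↦ bPush φ hφ (Function.update V i X j)) =
        Function.update (fun j ↦ bPush φ hφ (V j)) i (bPush φ hφ X) := by
      ext1 j
      by_cases hj : j = i
      · subst hj; simp
      · simp [hj]
    rw [h, h, bPush_smul, α.map_update_smul]
    ext x
    change f (φ.symm (φ x)) * _ = f x * _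
    rw [φ.symm_apply_apply]
    rfl
  map_eq_zero_of_eq' V i j h hij := by
    rw [α.map_eq_zero_of_eq _ (congrArg (bPush φ hφ) h) hij]
    rfl

/-- A b-diffeomorphism of `(M, Z)`: a diffeomorphism `φ` of `M` with `φ⁻¹(Z) = Z`. (A diffeomorphism
is transverse to every submanifold.) -/
structure BDiffeo (m : ℕ) {M : Type*} [TopologicalSpace M]
    [ChartedSpace (EuclideanSpace ℝ (Fin m)) M] (Z : Set M) where
  toDiffeo : M ≃ₘ⟮𝓡 m, 𝓡 m⟯ M
  preimage_eq : toDiffeo ⁻¹' Z = Z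

/-- The pull-back of b-forms by a b-diffeomorphism. -/
def BDiffeo.pull {k : ℕ} (φ : BDiffeo m Z) (α : BForm m Z k) : BForm m Z k :=
  BForm.pull φ.toDiffeo φ.preimage_eq α

/-- The restriction of a differential form on `M` to b-vector fields, i.e. the inclusion
`Ω^k(M) → Ω^k_Z(M)`, evaluated on b-vector fields. -/
def restrictForm {k : ℕ} (ν : BForm m (∅ : Set M) k) (V : Fin k → bFields m Z) : SmoothFun m M :=
  ν fun i ↦ ⟨(V i).1, fun _ h ↦ h.elim⟩

/-- Multi-vector fields of top degree, `Γ(⋀^m TM)`, as the `C^∞(M)`-dual of `Ω^m(M)`; `w ν` is the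
function `⟨ν, w⟩`. -/
abbrev TopMultivector (m : ℕ) (M : Type*) [TopologicalSpace M]
    [ChartedSpace (EuclideanSpace ℝ (Fin m)) M] [IsManifold (𝓡 m) ∞ M] : Type _ :=
  BForm m (∅ : Set M) m →ₗ[SmoothFun m M] SmoothFun m M

/-- The singular locus of `w`: the set of points at which `w` vanishes. -/
def TopMultivector.singularLocus (w : TopMultivector m M) : Set M :=
  {p | ∀ ν, w ν p = 0}

/-- A generic Nambu structure of top degree: a section `w` of the line bundle `⋀^m TM` that is
transverse to the zero section, i.e. at every zero of `w` the coefficient of `w` with respect to some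
top-form has non-zero differential. -/
def TopMultivector.IsGenericNambu (w : TopMultivector m M) : Prop :=
  ∀ p ∈ w.singularLocus, ∃ ν, mvfderiv (𝓡 m) (w ν) p ≠ 0

/-- `μ = w⁻¹`: the b-top-form `μ` and the multi-vector field `w` are inverse (dual) to each other,
i.e. `ν = ⟨ν, w⟩ μ` as b-top-forms, for every top-form `ν` on `M`. -/
def TopMultivector.IsInverse (w : TopMultivector m M) (μ : BForm m Z m) : Prop :=
  ∀ ν (V : Fin m → bFields m Z), restrictForm ν V = w ν * μ V

/-- `φ_* w = w'`, i.e. `⟨ν, w'⟩ ∘ φ = ⟨φ^* ν, w⟩` for every top-form `ν` on `M`. -/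
def BDiffeo.PushesTo (φ : BDiffeo m Z) (w w' : TopMultivector m M) : Prop :=
  ∀ ν, (w' ν).comp ⟨φ.toDiffeo, φ.toDiffeo.contMDiff⟩ =
    w (BForm.pull φ.toDiffeo Set.preimage_empty ν)

end
end BGeom
end

noncomputable section
set_option linter.unusedSectionVars false
open MeasureTheory

namespace BGeom

/-! ### Smooth dependence of integrals on parameters. -/

section ParametricIntegral

/-! Moser's argument, with explicit flows in charts in place of a time-dependent vector field on
`M`. Write `μ' = f μ`, so that `(f - 1) μ = dη`. In a chart adapted to `Z` the bundle `T_Z M` has a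
commuting frame: the coordinate fields, with `x_k ∂_k` for the normal coordinate. A partition of
unity splits `dη` into finitely many elementary pieces `d(g ι_V μ₀)`, with `V` in such a frame, `μ₀`
the dual volume form and `g` supported in the chart (`exists_sum_isElementary`).

The flow `θ` of `V` is a translation or a dilation. An elementary piece changes a density `a` into
`a + V g`, and this is realized by `x ↦ θ_u x`, where the time `u` solves `∫₀ᵘ a(θ_v x) dv + g(θ_u
x) = 0`. The derivative of the left side in `u` is `a + V g > 0` along the orbit, so `u` is unique
and smooth (`exists_contDiff_time`). The map preserves `Z` and is the identity where `g = 0`, hence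
extends to `M` (`IsElementary.exists_bDiffeo`). If `f > 0`, the segment from `1` to `f` is cut into
steps so small that the pieces can be added one by one without losing positivity (`isotopic_add`).

It remains to exclude `f < 0` (`pos_of_sub_one_smul_eq_bDiff`). On the clopen set `C = {f < 0}`, the
forms `ν = (1 - f) μ` and `2ν` differ by an exact form and are both positive multiples of `μ`; so
the construction yields a b-diffeomorphism `φ` that preserves `C`, with `2 φ^*ν = ν` there. The
integral of `|ν|` may diverge at `Z`, but that of `|ν|^r` is finite for `r < 1`, since the pole is
simple. If `D` bounds the Jacobians of `φ`, substitution shows that this integral over `C` is at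
most `D^(1-r) 2^(-r)` times itself. The factor is below `1` for `r` near `1`, so the integral is
zero and `C` is empty (`eq_empty_of_two_mul_pull_eq`).

For Nambu structures, transversality says that `w` has a simple zero along `Z`. A top-form evaluated
on b-fields vanishes there too, so the quotient defining `w⁻¹` is smooth, and it has no zeros. Then
`φ^* w'⁻¹ = w⁻¹` dualizes to `φ_* w = w'`. -/

theorem hasFDerivAt_integral_unitInterval {E F : Type*} [NormedAddCommGroup E] [NormedSpace ℝ E]
    [FiniteDimensional ℝ E] [NormedAddCommGroup F] [NormedSpace ℝ F]
    {f : E × ℝ → F} (hf : ContDiff ℝ 1 f) (x : E) :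
    HasFDerivAt (fun x ↦ ∫ t in (0 : ℝ)..1, f (x, t))
      (∫ t in (0 : ℝ)..1, (fderiv ℝ f (x, t)).comp (ContinuousLinearMap.inl ℝ E ℝ)) x := by
  have hc : Continuous fun p : E × ℝ ↦ (fderiv ℝ f p).comp (ContinuousLinearMap.inl ℝ E ℝ) :=
    (hf.continuous_fderiv one_ne_zero).clm_comp continuous_const
  obtain ⟨C, hC⟩ := ((isCompact_closedBall x 1).prod
    (isCompact_Icc (a := (0 : ℝ)) (b := 1))).exists_bound_of_continuousOn
    hc.continuousOn
  refine intervalIntegral.hasFDerivAt_integral_of_dominated_of_fderiv_le (𝕜 := ℝ)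
    (bound := fun _ ↦ C)
    (F := fun x t ↦ f (x, t))
    (F' := fun x t ↦ (fderiv ℝ f (x, t)).comp (ContinuousLinearMap.inl ℝ E ℝ))
    (s := Metric.closedBall x 1) (Metric.closedBall_mem_nhds x one_pos) ?_ ?_ ?_ ?_ ?_ ?_
  · refine Eventually.of_forall fun y ↦ Continuous.aestronglyMeasurable ?_
    exact hf.continuous.comp (by fun_prop)
  · exact (hf.continuous.comp (by fun_prop : Continuous fun t : ℝ ↦ (x, t))).intervalIntegrable _ _
  · exact (hc.comp (by fun_prop : Continuous fun t : ℝ ↦ (x, t))).aestronglyMeasurable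
  · refine Eventually.of_forall fun t ht y hy ↦ hC (y, t) ⟨hy, ?_⟩
    rw [uIoc_of_le zero_le_one] at ht
    exact ⟨ht.1.le, ht.2⟩
  · exact intervalIntegrable_const
  · refine Eventually.of_forall fun t _ y _ ↦ ?_
    have h1 : HasFDerivAt (fun y : E ↦ (y, t)) (ContinuousLinearMap.inl ℝ E ℝ) y :=
      (hasFDerivAt_id y).prodMk (hasFDerivAt_const t y)
    exact ((hf.differentiable one_ne_zero (y, t)).hasFDerivAt).comp y h1

/-- The derivative in `x` is again an integral of this kind, with values in `E →L[ℝ] F`. Hence the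
induction quantifies over `F`, and the common universe lets the induction hypothesis apply to that
space. -/
theorem contDiff_integral_unitInterval_nat.{u} {E : Type u} [NormedAddCommGroup E]
    [NormedSpace ℝ E] [FiniteDimensional ℝ E] (n : ℕ) :
    ∀ {F : Type u} [NormedAddCommGroup F] [NormedSpace ℝ F]
    {f : E × ℝ → F}, ContDiff ℝ ∞ f → ContDiff ℝ n fun x ↦ ∫ t in (0 : ℝ)..1, f (x, t) := by
  induction n with
  | zero =>
    intro F _ _ f hf
    refine contDiff_zero.2 ?_
    exact intervalIntegral.continuous_parametric_intervalIntegral_of_continuous'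
      (f := fun x t ↦ f (x, t)) hf.continuous 0 1
  | succ n ih =>
    intro F _ _ f hf
    have h := fun x ↦ hasFDerivAt_integral_unitInterval (hf.of_le (by simp)) x
    push_cast
    refine contDiff_succ_iff_fderiv.2 ⟨fun x ↦ (h x).differentiableAt, by simp, ?_⟩
    have : fderiv ℝ (fun x ↦ ∫ t in (0 : ℝ)..1, f (x, t)) =
        fun x ↦ ∫ t in (0 : ℝ)..1, (fderiv ℝ f (x, t)).comp (ContinuousLinearMap.inl ℝ E ℝ) :=
      funext fun x ↦ (h x).fderiv
    rw [this]
    exact ih (f := fun p ↦ (fderiv ℝ f p).comp (ContinuousLinearMap.inl ℝ E ℝ))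
      ((hf.fderiv_right (by simp)).clm_comp contDiff_const)

theorem contDiff_integral_unitInterval.{u} {E F : Type u} [NormedAddCommGroup E]
    [NormedSpace ℝ E] [FiniteDimensional ℝ E] [NormedAddCommGroup F] [NormedSpace ℝ F]
    {f : E × ℝ → F} (hf : ContDiff ℝ ∞ f) : ContDiff ℝ ∞ fun x ↦ ∫ t in (0 : ℝ)..1, f (x, t) :=
  contDiff_infty.2 fun n ↦ contDiff_integral_unitInterval_nat n hf

end ParametricIntegral

/-! ### Hadamard's lemma. -/

section Hadamard
variable {E : Type} [NormedAddCommGroup E] [NormedSpace ℝ E] [FiniteDimensional ℝ E]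

/-- Hadamard's lemma: a smooth function that vanishes on the hyperplane `ℓ = 0` is divisible
by `ℓ`. -/
theorem exists_contDiff_eq_mul_of_forall_eq_zero {H : E → ℝ} (hH : ContDiff ℝ ∞ H) (ℓ : E →L[ℝ] ℝ)
    {b : E}
    (hb : ℓ b = 1) (h0 : ∀ x, ℓ x = 0 → H x = 0) :
    ∃ H' : E → ℝ, ContDiff ℝ ∞ H' ∧ ∀ x, H x = ℓ x * H' x := by
  -- The segment along `b` from a point of the hyperplane (`t = 0`) to `x` (`t = 1`). Its velocity
  -- `ℓ x • b` produces the factor `ℓ x`.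
  let c : E × ℝ → E := fun p ↦ p.1 + ((p.2 - 1) * ℓ p.1) • b
  have hc : ContDiff ℝ ∞ c := by fun_prop
  refine ⟨fun x ↦ ∫ t in (0 : ℝ)..1, fderiv ℝ H (c (x, t)) b, ?_, fun x ↦ ?_⟩
  · exact contDiff_integral_unitInterval (f := fun p ↦ fderiv ℝ H (c p) b)
      (((hH.fderiv_right (m := ∞) (by simp)).comp hc).clm_apply contDiff_const)
  · have hd : ∀ t : ℝ, HasDerivAt (fun t ↦ H (c (x, t))) (ℓ x * fderiv ℝ H (c (x, t)) b) t := by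
      intro t
      have h1 : HasDerivAt (fun t : ℝ ↦ c (x, t)) (ℓ x • b) t := by
        have := (((hasDerivAt_id t).sub_const 1).mul_const (ℓ x)).smul_const b
        simpa [c] using this.const_add x
      have := (hH.differentiable (by simp) (c (x, t))).hasFDerivAt.comp_hasDerivAt t h1
      rw [map_smul, smul_eq_mul] at this
      exact this
    have := intervalIntegral.integral_eq_sub_of_hasDerivAt (a := 0) (b := 1) (fun t _ ↦ hd t) (by
      refine Continuous.intervalIntegrable ?_ _ _
      have h2 : Continuous fun t : ℝ ↦ c (x, t) := hc.continuous.comp (by fun_prop)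
      exact continuous_const.mul (((hH.continuous_fderiv
        (by simp)).comp h2).clm_apply continuous_const))
    rw [intervalIntegral.integral_const_mul] at this
    rw [this]
    have h3 : H (c (x, 0)) = 0 := h0 _ (by simp [c, hb])
    have h4 : c (x, 1) = x := by simp [c]
    rw [h3, h4, sub_zero]

end Hadamard

/-! ### The transport time along a flow. -/

section Flow
variable {E : Type} [NormedAddCommGroup E]

/-- Along a smooth flow `θ` with generator `V`, the flow time `u` that transports the density
`a` to the density `a + V g` is a smooth function. -/
theorem exists_contDiff_time [NormedSpace ℝ E] [FiniteDimensional ℝ E] {θ : ℝ → E → E}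
    (hθ : ContDiff ℝ ∞ fun p : ℝ × E ↦ θ p.1 p.2)
    (h0 : ∀ x, θ 0 x = x) (hadd : ∀ s t x, θ (s + t) x = θ s (θ t x))
    {a g Vg : E → ℝ} (ha : ContDiff ℝ ∞ a) (hg : ContDiff ℝ ∞ g)
    (hVg : ∀ x, HasDerivAt (fun t ↦ g (θ t x)) (Vg x) 0) {c : ℝ} (hc : 0 < c)
    (hac' : ∀ x, c ≤ a x + Vg x) :
    ∃ u : E → ℝ, ContDiff ℝ ∞ u ∧
      (∀ x w, (∫ v in (0 : ℝ)..w, a (θ v x)) + g (θ w x) = 0 ↔ w = u x) ∧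
      ∀ x, HasDerivAt (fun t ↦ u (θ t x)) (a x / (a (θ (u x) x) + Vg (θ (u x) x)) - 1) 0 := by
  -- The left side of the equation for the time, with the integral rescaled to the unit interval so
  -- that it is smooth in both variables.
  let Φ : E × ℝ → ℝ := fun p ↦ p.2 * (∫ t in (0 : ℝ)..1, a (θ (p.2 * t) p.1)) + g (θ p.2 p.1)
  have hθc : ∀ x, Continuous fun t ↦ θ t x := fun x ↦
    hθ.continuous.comp (by fun_prop : Continuous fun t : ℝ ↦ (t, x))
  have hΦe : ∀ x w, Φ (x, w) = (∫ v in (0 : ℝ)..w, a (θ v x)) + g (θ w x) := by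
    intro x w
    have := intervalIntegral.smul_integral_comp_mul_left (a := 0) (b := 1) (fun v ↦ a (θ v x)) w
    simp only [mul_zero, mul_one, smul_eq_mul] at this
    rw [← this]
  have hΦ : ContDiff ℝ ∞ Φ := by
    have h1 : ContDiff ℝ ∞ fun p : E × ℝ ↦ ∫ t in (0 : ℝ)..1, a (θ (p.2 * t) p.1) :=
      contDiff_integral_unitInterval (f := fun q : (E × ℝ) × ℝ ↦ a (θ (q.1.2 * q.2) q.1.1))
        (ha.comp (hθ.comp (by fun_prop : ContDiff ℝ ∞ fun q : (E × ℝ) × ℝ ↦ (q.1.2 * q.2, q.1.1))))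
    exact (contDiff_snd.mul h1).add (hg.comp
      (hθ.comp (by fun_prop : ContDiff ℝ ∞ fun q : E × ℝ ↦ (q.2, q.1))))
  have hgd : ∀ x w, HasDerivAt (fun w ↦ g (θ w x)) (Vg (θ w x)) w := by
    intro x w
    have h1 := hVg (θ w x)
    have h2 : (fun t ↦ g (θ t (θ w x))) = fun t ↦ g (θ (t + w) x) :=
      funext fun t ↦ by rw [hadd]
    rw [h2] at h1
    have h3 := HasDerivAt.comp_sub_const w w (f := fun t ↦ g (θ (t + w) x)) (by simpa using h1)
    simpa using h3
  have hac0 : ∀ x, Continuous fun v ↦ a (θ v x) := fun x ↦ ha.continuous.comp (hθc x)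
  have hΦd : ∀ x w, HasDerivAt (fun w ↦ Φ (x, w)) (a (θ w x) + Vg (θ w x)) w := by
    intro x w
    simp only [hΦe]
    exact ((hac0 x).integral_hasStrictDerivAt 0 w).hasDerivAt.add (hgd x w)
  have hmono : ∀ x, StrictMono fun w ↦ Φ (x, w) := fun x ↦
    strictMono_of_hasDerivAt_pos (hΦd x) fun w ↦ hc.trans_le (hac' _)
  have hcont : ∀ x, Continuous fun w ↦ Φ (x, w) := fun x ↦
    hΦ.continuous.comp (by fun_prop : Continuous fun t : ℝ ↦ (x, t))
  -- Growth at rate at least `c` in both directions forces a zero at distance at most `|Φ (x, 0)| /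
  -- c` from `0`.
  have hgrow : ∀ x s t, s ≤ t → c * (t - s) ≤ Φ (x, t) - Φ (x, s) := by
    intro x s t hst
    have := (convex_univ (𝕜 := ℝ) (E := ℝ)).mul_sub_le_image_sub_of_le_deriv
      (f := fun w ↦ Φ (x, w)) (C := c)
      (hcont x).continuousOn (fun w _ ↦ (hΦd x w).differentiableAt.differentiableWithinAt)
      (fun w _ ↦ by rw [(hΦd x w).deriv]; exact hac' _) s (mem_univ _) t (mem_univ _) hst
    exact this
  have hsurj : ∀ x, ∃ w, Φ (x, w) = 0 := by
    intro x
    set A := |Φ (x, 0)| / c with hA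
    have hA0 : 0 ≤ A := by positivity
    have hcA : c * A = |Φ (x, 0)| := by rw [hA]; field_simp
    have h1 := hgrow x 0 A hA0
    have h2 := hgrow x (-A) 0 (by linarith)
    have h3 := neg_abs_le (Φ (x, 0))
    have h4 := le_abs_self (Φ (x, 0))
    have := intermediate_value_Icc (by linarith : -A ≤ A) (hcont x).continuousOn
    obtain ⟨w, -, hw⟩ := this (show (0 : ℝ) ∈ Icc (Φ (x, -A)) (Φ (x, A)) from
      ⟨by nlinarith, by nlinarith⟩)
    exact ⟨w, hw⟩
  choose u hu using hsurj
  have huniq : ∀ x w, Φ (x, w) = 0 ↔ w = u x := fun x w ↦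
    ⟨fun h ↦ (hmono x).injective (h.trans (hu x).symm), fun h ↦ h ▸ hu x⟩
  -- The local implicit functions solve the same equation as `u`, so they agree with `u` by
  -- uniqueness of the zero.
  have hus : ContDiff ℝ ∞ u := by
    refine contDiff_iff_contDiffAt.2 fun x ↦ ?_
    have hinv : (fderiv ℝ Φ (x, u x) ∘L ContinuousLinearMap.inr ℝ E ℝ).IsInvertible := by
      have h1 : HasFDerivAt (fun w : ℝ ↦ (x, w)) (ContinuousLinearMap.inr ℝ E ℝ) (u x) :=
        (hasFDerivAt_const x (u x)).prodMk (hasFDerivAt_id (u x))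
      have h2 := ((hΦ.differentiable (by simp) (x, u x)).hasFDerivAt.comp (u x) h1)
      have h3 := h2.unique (hΦd x (u x)).hasFDerivAt
      have hne : a (θ (u x) x) + Vg (θ (u x) x) ≠ 0 := (hc.trans_le (hac' _)).ne'
      rw [h3]
      refine ⟨ContinuousLinearEquiv.unitsEquivAut ℝ (Units.mk0 _ hne), ?_⟩
      ext
      simp
    have h1 := hΦ.contDiffAt.contDiffAt_implicitFunction (u := (x, u x)) (by simp) hinv
    refine h1.congr_of_eventuallyEq ?_
    filter_upwards [(hΦ.contDiffAt (x := (x, u x))).eventually_apply_implicitFunction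
      (by simp) hinv]
      with y hy
    exact ((huniq y _).1 (hy.trans (hu x))).symm
  refine ⟨u, hus, fun x w ↦ by rw [← hΦe, huniq], fun x ↦ ?_⟩
  have hud : DifferentiableAt ℝ (fun t ↦ u (θ t x)) 0 :=
    ((hus.comp (hθ.comp (by fun_prop : ContDiff ℝ ∞ fun t : ℝ ↦ (t, x)))).differentiable
      (by simp)) 0
  -- The equation at `θ t x`, rewritten along the orbit of `x`, where the end time is `u (θ t x) +
  -- t`. Differentiating at `t = 0` gives `(a + V g)(θ_u x) * (V u + 1) = a x`.
  have hid : ∀ t, (∫ v in t..(u (θ t x) + t), a (θ v x)) + g (θ (u (θ t x) + t) x) = 0 := by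
    intro t
    have h1 := (hΦe _ _).symm.trans (hu (θ t x))
    simp only [← hadd] at h1
    rw [intervalIntegral.integral_comp_add_right (fun v ↦ a (θ v x)) t] at h1
    simpa using h1
  let J : ℝ → ℝ := fun w ↦ ∫ v in (0 : ℝ)..w, a (θ v x)
  have hJ : ∀ w, HasDerivAt J (a (θ w x)) w := fun w ↦
    ((hac0 x).integral_hasStrictDerivAt 0 w).hasDerivAt
  have hid' : (fun t ↦ (J (u (θ t x) + t) - J t) + g (θ (u (θ t x) + t) x)) = fun _ ↦ 0 := by
    funext t
    rw [← hid t]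
    congr 1
    exact intervalIntegral.integral_interval_sub_left ((hac0 x).intervalIntegrable _ _)
      ((hac0 x).intervalIntegrable _ _)
  have hU := hud.hasDerivAt.add (hasDerivAt_id (0 : ℝ))
  have hU0 : u (θ 0 x) + 0 = u x := by rw [h0, add_zero]
  have e1 := HasDerivAt.comp (h₂ := J) 0 (hJ _) hU
  have e2 := HasDerivAt.comp (h₂ := fun w ↦ g (θ w x)) 0 (hgd x _) hU
  have e3 := (e1.sub (hJ 0)).add e2
  have e4 := e3.unique (by
    convert! hasDerivAt_const (0 : ℝ) (0 : ℝ) using 1)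
  simp only [Pi.add_apply, id, add_zero, h0] at e4
  have hne : a (θ (u x) x) + Vg (θ (u x) x) ≠ 0 := (hc.trans_le (hac' _)).ne'
  convert! hud.hasDerivAt using 1
  rw [sub_eq_iff_eq_add, div_eq_iff hne]
  linarith

/-- The inverse change has the data `(a + V g, -g)`. Integrating `V g` along the orbit gives a
difference of values of `g`, so the equation for the time `-u x` at the image point is the negative
of the equation for `u x` at `x`. -/
theorem time_inverse {θ : ℝ → E → E} (hθ : Continuous fun p : ℝ × E ↦ θ p.1 p.2)
    (h0 : ∀ x, θ 0 x = x) (hadd : ∀ s t x, θ (s + t) x = θ s (θ t x))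
    {a g Vg a' g' u u' : E → ℝ} (ha : Continuous a) (hVgc : Continuous Vg)
    (hVg : ∀ x, HasDerivAt (fun t ↦ g (θ t x)) (Vg x) 0)
    (ha' : ∀ x, a' x = a x + Vg x) (hg' : ∀ x, g' x = -g x)
    (hu : ∀ x w, (∫ v in (0 : ℝ)..w, a (θ v x)) + g (θ w x) = 0 ↔ w = u x)
    (hu' : ∀ x w, (∫ v in (0 : ℝ)..w, a' (θ v x)) + g' (θ w x) = 0 ↔ w = u' x) (x : E) :
    u' (θ (u x) x) = -u x := by
  symm
  rw [← hu']
  have hθc : ∀ x, Continuous fun t ↦ θ t x := fun x ↦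
    hθ.comp (by fun_prop : Continuous fun t : ℝ ↦ (t, x))
  have hgd : ∀ x w, HasDerivAt (fun w ↦ g (θ w x)) (Vg (θ w x)) w := by
    intro x w
    have h1 := hVg (θ w x)
    have h2 : (fun t ↦ g (θ t (θ w x))) = fun t ↦ g (θ (t + w) x) :=
      funext fun t ↦ by rw [hadd]
    rw [h2] at h1
    have h3 := HasDerivAt.comp_sub_const w w (f := fun t ↦ g (θ (t + w) x)) (by simpa using h1)
    simpa using h3
  have i1 : IntervalIntegrable (fun v ↦ a (θ v (θ (u x) x))) volume 0 (-u x) :=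
    (ha.comp (hθc _)).intervalIntegrable _ _
  have i2 : IntervalIntegrable (fun v ↦ Vg (θ v (θ (u x) x))) volume 0 (-u x) :=
    (hVgc.comp (hθc _)).intervalIntegrable _ _
  have e1 := intervalIntegral.integral_eq_sub_of_hasDerivAt (fun t _ ↦ hgd (θ (u x) x) t) i2
  have e2 : (∫ v in (0 : ℝ)..(-u x), a (θ v (θ (u x) x))) = -∫ v in (0 : ℝ)..u x, a (θ v x) := by
    simp only [← hadd]
    rw [intervalIntegral.integral_comp_add_right (fun v ↦ a (θ v x)) (u x),
      intervalIntegral.integral_symm]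
    simp
  have e3 := (hu x (u x)).2 rfl
  have e4 : θ (-u x) (θ (u x) x) = x := by rw [← hadd, neg_add_cancel, h0]
  simp only [ha', hg', intervalIntegral.integral_add i1 i2, e1, e2, e4, h0]
  linarith

end Flow

/-! ### The frame of `T_Z ℝ^m`, its flows and transport of densities. -/

section Elementary
variable {m : ℕ}

/-- The coefficient of the `j`-th coordinate vector field in the `j`-th member of the frame of
`T_Z ℝ^m`, where `Z` is the hyperplane given by `o`. -/
def scaleCoeff (o : Option (Fin m)) (j : Fin m) (x : EuclideanSpace ℝ (Fin m)) : ℝ :=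
  if o = some j then x j else 1

/-- The product of the coefficients of the frame. -/
def scaleProd (o : Option (Fin m)) (x : EuclideanSpace ℝ (Fin m)) : ℝ := ∏ j, scaleCoeff o j x

/-- The flow of the `j`-th member of the frame. -/
def frameFlow (o : Option (Fin m)) (j : Fin m) (t : ℝ) (x : EuclideanSpace ℝ (Fin m)) :
    EuclideanSpace ℝ (Fin m) :=
  x + (if o = some j then (Real.exp t - 1) * x j else t) • EuclideanSpace.single j (1 : ℝ)

theorem contDiff_scaleCoeff (o : Option (Fin m)) (j : Fin m) : ContDiff ℝ ∞ (scaleCoeff o j) := by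
  unfold scaleCoeff
  split_ifs <;> fun_prop

theorem scaleProd_eq_zero_iff {o : Option (Fin m)} {x : EuclideanSpace ℝ (Fin m)} :
    scaleProd o x = 0 ↔ ∃ k, o = some k ∧ x k = 0 := by
  unfold scaleProd scaleCoeff
  rw [Finset.prod_eq_zero_iff]
  constructor
  · rintro ⟨k, -, hk⟩
    split_ifs at hk with h
    exacts [⟨k, h, hk⟩, (one_ne_zero hk).elim]
  · rintro ⟨k, h, hk⟩
    exact ⟨k, Finset.mem_univ _, by rw [if_pos h, hk]⟩

theorem scaleProd_some (k : Fin m) (x : EuclideanSpace ℝ (Fin m)) :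
    scaleProd (some k) x = x k := by
  unfold scaleProd scaleCoeff
  rw [Finset.prod_eq_single k] <;> simp +contextual [eq_comm]

theorem scaleProd_none (x : EuclideanSpace ℝ (Fin m)) : scaleProd none x = 1 := by
  simp [scaleProd, scaleCoeff]

theorem contDiff_scaleProd (o : Option (Fin m)) : ContDiff ℝ ∞ (scaleProd o) := by
  cases o with
  | none => simpa [funext scaleProd_none] using contDiff_const
  | some k => simpa [funext (scaleProd_some k)] using (by fun_prop)

theorem contDiff_frameFlow (o : Option (Fin m)) (j : Fin m) :
    ContDiff ℝ ∞ fun p : ℝ × EuclideanSpace ℝ (Fin m) ↦ frameFlow o j p.1 p.2 := by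
  unfold frameFlow
  split_ifs <;> fun_prop

theorem frameFlow_zero (o : Option (Fin m)) (j : Fin m) (x : EuclideanSpace ℝ (Fin m)) :
    frameFlow o j 0 x = x := by
  simp [frameFlow]

theorem frameFlow_add (o : Option (Fin m)) (j : Fin m) (s t : ℝ) (x : EuclideanSpace ℝ (Fin m)) :
    frameFlow o j (s + t) x = frameFlow o j s (frameFlow o j t x) := by
  unfold frameFlow
  split_ifs
  · rw [add_assoc, ← add_smul]
    congr 2
    simp [Real.exp_add]
    ring
  · rw [add_assoc, ← add_smul, add_comm s]

theorem hasDerivAt_frameFlow (o : Option (Fin m)) (j : Fin m) (x : EuclideanSpace ℝ (Fin m)) :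
    HasDerivAt (fun t ↦ frameFlow o j t x)
      (scaleCoeff o j x • EuclideanSpace.single j (1 : ℝ)) 0 := by
  unfold frameFlow scaleCoeff
  refine HasDerivAt.const_add x (HasDerivAt.smul_const ?_ _)
  split_ifs
  · simpa using ((Real.hasDerivAt_exp 0).sub_const 1).mul_const (x j)
  · exact hasDerivAt_id 0

theorem frameFlow_apply_of_ne {o : Option (Fin m)} {j k : Fin m} (h : k ≠ j) (t : ℝ)
    (x : EuclideanSpace ℝ (Fin m)) : frameFlow o j t x k = x k := by
  unfold frameFlow
  split_ifs <;> simp [h]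

theorem scaleProd_frameFlow (o : Option (Fin m)) (j : Fin m) (t : ℝ)
    (x : EuclideanSpace ℝ (Fin m)) :
    scaleProd o (frameFlow o j t x) = (if o = some j then Real.exp t else 1) * scaleProd o x := by
  cases o with
  | none => simp [scaleProd_none]
  | some k =>
    simp only [scaleProd_some, Option.some.injEq]
    split_ifs with h
    · subst h
      simp [frameFlow]
      ring
    · rw [frameFlow_apply_of_ne h, one_mul]

/-- The change of density `a ↦ a + V g`, with `V` a member of the frame of `T_Z ℝ^m`, is realized by
a diffeomorphism that moves points along `V`. -/
theorem exists_transport_density (o : Option (Fin m)) (j : Fin m)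
    {a g : EuclideanSpace ℝ (Fin m) → ℝ} (ha : ContDiff ℝ ∞ a) (hg : ContDiff ℝ ∞ g) {c : ℝ}
    (hc : 0 < c) (hac : ∀ x, c ≤ a x)
    (hac' : ∀ x, c ≤ a x + scaleCoeff o j x * fderiv ℝ g x (EuclideanSpace.single j 1)) :
    ∃ φ ψ : EuclideanSpace ℝ (Fin m) → EuclideanSpace ℝ (Fin m), ContDiff ℝ ∞ φ ∧ ContDiff ℝ ∞ ψ ∧
      (∀ x, ψ (φ x) = x) ∧ (∀ x, φ (ψ x) = x) ∧ (∀ x, g x = 0 → φ x = x) ∧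
      (∀ x, scaleProd o (φ x) = 0 ↔ scaleProd o x = 0) ∧
      ∀ x, (fderiv ℝ φ x).det * (a (φ x) +
        scaleCoeff o j (φ x) * fderiv ℝ g (φ x) (EuclideanSpace.single j 1)) * scaleProd o x =
        a x * scaleProd o (φ x) := by
  set b : EuclideanSpace ℝ (Fin m) := EuclideanSpace.single j 1 with hb
  let θ := frameFlow o j
  let Vg := fun x ↦ scaleCoeff o j x * fderiv ℝ g x b
  have hθ : ContDiff ℝ ∞ fun p : ℝ × EuclideanSpace ℝ (Fin m) ↦ θ p.1 p.2 := contDiff_frameFlow o j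
  have hVs : ContDiff ℝ ∞ Vg :=
    (contDiff_scaleCoeff o j).mul ((hg.fderiv_right (m := ∞) (by simp)).clm_apply contDiff_const)
  have hd : ∀ {h : EuclideanSpace ℝ (Fin m) → ℝ}, Differentiable ℝ h → ∀ x,
      HasDerivAt (fun t ↦ h (θ t x)) (scaleCoeff o j x * fderiv ℝ h x b) 0 := by
    intro h hh x
    have h1 := (hh (θ 0 x)).hasFDerivAt.comp_hasDerivAt 0 (hasDerivAt_frameFlow o j x)
    rw [map_smul, smul_eq_mul, show θ 0 x = x from frameFlow_zero o j x] at h1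
    exact h1
  have hVg : ∀ x, HasDerivAt (fun t ↦ g (θ t x)) (Vg x) 0 := hd (hg.differentiable (by simp))
  obtain ⟨u, hus, hu, hud⟩ := exists_contDiff_time hθ (frameFlow_zero o j) (frameFlow_add o j)
    ha hg hVg hc hac'
  have hVg' : ∀ x, HasDerivAt (fun t ↦ (fun y ↦ -g y) (θ t x)) (-Vg x) 0 := fun x ↦ (hVg x).neg
  -- The inverse diffeomorphism uses the time of the reversed data `(a + V g, -g)`. The density
  -- reached is `a`, so `hac` supplies its lower bound.
  obtain ⟨u', hus', hu', -⟩ := exists_contDiff_time hθ (frameFlow_zero o j) (frameFlow_add o j)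
    (ha.add hVs) hg.neg hVg' hc (by simpa using hac)
  have hcancel : ∀ s x, θ (-s) (θ s x) = x := fun s x ↦ by
    simp only [θ, ← frameFlow_add, neg_add_cancel, frameFlow_zero]
  have hφs : ContDiff ℝ ∞ fun x ↦ θ (u x) x := hθ.comp (hus.prodMk contDiff_id)
  refine ⟨fun x ↦ θ (u x) x, fun x ↦ θ (u' x) x, hφs, hθ.comp (hus'.prodMk contDiff_id),
    fun x ↦ ?_, fun x ↦ ?_, fun x hx ↦ ?_, fun x ↦ ?_, fun x ↦ ?_⟩
  · have := time_inverse (a' := a + Vg) (g' := -g) hθ.continuous (frameFlow_zero o j)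
      (frameFlow_add o j) ha.continuous hVs.continuous hVg (fun _ ↦ rfl) (fun _ ↦ rfl) hu hu' x
    simp only [this, hcancel]
  · have := time_inverse (g := fun y ↦ -g y) (a' := a) (g' := g) hθ.continuous (frameFlow_zero o j)
      (frameFlow_add o j) (ha.add hVs).continuous hVs.neg.continuous hVg' (fun _ ↦ by simp)
      (fun _ ↦ by simp) hu' hu x
    simp only [this, hcancel]
  · have : u x = 0 := ((hu x 0).1 (by simp [θ, frameFlow_zero, hx])).symm
    simp only [this, θ, frameFlow_zero]
  · simp only [θ, scaleProd_frameFlow]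
    split_ifs <;> simp [Real.exp_ne_zero]
  · have h1 := (hud x).unique (hd (hus.differentiable (by simp)) x)
    have hne : a (θ (u x) x) + Vg (θ (u x) x) ≠ 0 := (hc.trans_le (hac' _)).ne'
    rw [sub_eq_iff_eq_add, div_eq_iff hne] at h1
    have hu1 := (hus.differentiable (by simp) x).hasFDerivAt
    -- The map is the identity plus a function times `b`, so its derivative is a rank one
    -- perturbation of the identity, with determinant `1` plus the value of the functional at `b`.
    -- The factor `exp (u x)` is matched by the same factor in `scaleProd o (φ x)`.
    have hdet : (fderiv ℝ (fun x ↦ θ (u x) x) x).det =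
        (if o = some j then Real.exp (u x) else 1) * (scaleCoeff o j x * fderiv ℝ u x b + 1) := by
      by_cases ho : o = some j
      · have h2 : HasFDerivAt (fun x : EuclideanSpace ℝ (Fin m) ↦ x +
        ((Real.exp (u x) - 1) * x j) • b)
            (ContinuousLinearMap.id ℝ _ + (((Real.exp (u x) - 1) • EuclideanSpace.proj j +
              x j • (Real.exp (u x) • fderiv ℝ u x))).smulRight b) x :=
          (hasFDerivAt_id x).add (((hu1.exp.sub_const 1).mul
            (EuclideanSpace.proj j : EuclideanSpace ℝ (Fin m) →L[ℝ] ℝ).hasFDerivAt).smul_const b)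
        have h3 : (fun x ↦ θ (u x) x) = fun x ↦ x + ((Real.exp (u x) - 1) * x j) • b := by
          funext x
          simp [θ, frameFlow, ho, b]
        rw [h3, h2.fderiv]
        refine (LinearMap.transvection.det (((Real.exp (u x) - 1) • EuclideanSpace.proj j +
              x j • (Real.exp (u x) • fderiv ℝ u x) : EuclideanSpace ℝ (Fin m) →L[ℝ] ℝ) :
              Module.Dual ℝ (EuclideanSpace ℝ (Fin m))) b).trans ?_
        simp [ho, scaleCoeff, b]
        ring
      · have h2 : HasFDerivAt (fun x : EuclideanSpace ℝ (Fin m) ↦ x + u x • b)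
            (ContinuousLinearMap.id ℝ _ + (fderiv ℝ u x).smulRight b) x :=
          (hasFDerivAt_id x).add (hu1.smul_const b)
        have h3 : (fun x ↦ θ (u x) x) = fun x ↦ x + u x • b := by
          funext x
          simp [θ, frameFlow, ho, b]
        rw [h3, h2.fderiv]
        refine (LinearMap.transvection.det ((fderiv ℝ u x :  EuclideanSpace ℝ (Fin m) →L[ℝ] ℝ) :
              Module.Dual ℝ (EuclideanSpace ℝ (Fin m))) b).trans ?_
        simp [ho, scaleCoeff, b]
        ring
    rw [hdet, h1]
    simp only [θ, scaleProd_frameFlow, Vg]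
    ring

end Elementary

/-! ### Extending a map from a chart by the identity. -/

section Transplant
variable {M H : Type*} [TopologicalSpace M] [TopologicalSpace H]

open Classical in
/-- A self-map of the model space, transplanted to `M` by a chart and extended by the identity. -/
def transplant (e : OpenPartialHomeomorph M H) (φ : H → H) (q : M) : M :=
  if q ∈ e.source then e.symm (φ (e q)) else q

theorem transplant_of_mem (e : OpenPartialHomeomorph M H) (φ : H → H) {q : M} (hq : q ∈ e.source) :
    transplant e φ q = e.symm (φ (e q)) := if_pos hq

theorem transplant_of_notMem (e : OpenPartialHomeomorph M H) (φ : H → H) {q : M}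
    (hq : q ∉ e.source) : transplant e φ q = q := if_neg hq

variable {e : OpenPartialHomeomorph M H} {φ ψ : H → H} {K : Set M}

theorem transplant_eq_self (hK : K ⊆ e.source) (hφ : ∀ x ∉ e '' K, φ x = x) {q : M} (hq : q ∉ K) :
    transplant e φ q = q := by
  by_cases hqs : q ∈ e.source
  · rw [transplant_of_mem e φ hqs, hφ, e.left_inv hqs]
    rintro ⟨p, hp, hpq⟩
    exact hq (e.injOn (hK hp) hqs hpq ▸ hp)
  · exact transplant_of_notMem e φ hqs

/-- The map is injective and the points outside `e '' K` are their own images, so no point of `e ''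
K` can be sent outside. -/
theorem mapsTo_image_of_fixed (hψφ : ∀ x, ψ (φ x) = x) (hφ : ∀ x ∉ e '' K, φ x = x) {x : H}
    (hx : x ∈ e '' K) : φ x ∈ e '' K := by
  by_contra h
  have h1 := hφ _ h
  have h2 : φ x = x := by rw [← hψφ (φ x), h1, hψφ]
  exact h (h2.symm ▸ hx)

theorem mem_target_of_fixed (hK : K ⊆ e.source) (hψφ : ∀ x, ψ (φ x) = x)
    (hφ : ∀ x ∉ e '' K, φ x = x) {x : H} (hx : x ∈ e.target) : φ x ∈ e.target := by
  by_cases h : x ∈ e '' K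
  · obtain ⟨p, hp, hpx⟩ := mapsTo_image_of_fixed hψφ hφ h
    exact hpx ▸ e.map_source (hK hp)
  · rwa [hφ x h]

theorem transplant_transplant (hK : K ⊆ e.source) (hψφ : ∀ x, ψ (φ x) = x)
    (hφ : ∀ x ∉ e '' K, φ x = x) (q : M) : transplant e ψ (transplant e φ q) = q := by
  by_cases hq : q ∈ e.source
  · have h := mem_target_of_fixed hK hψφ hφ (e.map_source hq)
    rw [transplant_of_mem e φ hq, transplant_of_mem e ψ (e.map_target h), e.right_inv h, hψφ,
      e.left_inv hq]
  · rw [transplant_of_notMem e φ hq, transplant_of_notMem e ψ hq]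

end Transplant

/-! ### Adapted charts and the local frame of `T_Z M`. -/

variable {m : ℕ} {M : Type*} [TopologicalSpace M] [ChartedSpace (EuclideanSpace ℝ (Fin m)) M]
  [IsManifold (𝓡 m) ∞ M] {Z : Set M}

local notation "𝔼" => EuclideanSpace ℝ (Fin m)

theorem mvfderiv_eq_fderiv_chart {e : OpenPartialHomeomorph M 𝔼}
    (he : e ∈ IsManifold.maximalAtlas (𝓡 m) ∞ M) {q : M} (hq : q ∈ e.source) {h : M → ℝ}
    (hh : MDifferentiableAt (𝓡 m) 𝓘(ℝ, ℝ) h q) (v : TangentSpace (𝓡 m) q) :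
    mvfderiv (𝓡 m) h q v = fderiv ℝ (h ∘ e.symm) (e q) (mfderiv (𝓡 m) (𝓡 m) e q v) := by
  have he1 : MDifferentiableAt (𝓡 m) (𝓡 m) e q :=
    (contMDiffAt_of_mem_maximalAtlas he hq).mdifferentiableAt (by simp)
  have he2 : MDifferentiableAt (𝓡 m) (𝓡 m) e.symm (e q) :=
    (contMDiffAt_symm_of_mem_maximalAtlas he (e.map_source hq)).mdifferentiableAt (by simp)
  have hh' : MDifferentiableAt (𝓡 m) 𝓘(ℝ, ℝ) h (e.symm (e q)) := by rwa [e.left_inv hq]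
  have hc : MDifferentiableAt (𝓡 m) 𝓘(ℝ, ℝ) (h ∘ e.symm) (e q) := hh'.comp (e q) he2
  have hev : h =ᶠ[𝓝 q] (h ∘ e.symm) ∘ e := by
    filter_upwards [e.open_source.mem_nhds hq] with x hx
    simp [e.left_inv hx]
  have h1 : mfderiv (𝓡 m) 𝓘(ℝ, ℝ) h q = mfderiv (𝓡 m) 𝓘(ℝ, ℝ) ((h ∘ e.symm) ∘ e) q :=
    hev.mfderiv_eq
  have h2 := mfderiv_comp q hc he1
  rw [← mfderiv_eq_fderiv]
  change mfderiv (𝓡 m) 𝓘(ℝ, ℝ) h q v = _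
  rw [h1, h2]
  rfl

theorem isInvertible_mfderiv_chart {e : OpenPartialHomeomorph M 𝔼}
    (he : e ∈ IsManifold.maximalAtlas (𝓡 m) ∞ M) {q : M} (hq : q ∈ e.source) :
    (mfderiv (𝓡 m) (𝓡 m) e q).IsInvertible := by
  have hd : e.MDifferentiable (𝓡 m) (𝓡 m) :=
    ⟨fun x hx ↦ ((contMDiffAt_of_mem_maximalAtlas he hx).mdifferentiableAt
      (by simp)).mdifferentiableWithinAt,
     fun x hx ↦ ((contMDiffAt_symm_of_mem_maximalAtlas he hx).mdifferentiableAt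
      (by simp)).mdifferentiableWithinAt⟩
  exact ⟨hd.mfderiv hq, rfl⟩

/-- The expression in the chart `e` of a function on `M`, extended by zero. -/
def descend (e : OpenPartialHomeomorph M 𝔼) (h : M → ℝ) : 𝔼 → ℝ :=
  e.target.indicator (h ∘ e.symm)

theorem descend_apply (e : OpenPartialHomeomorph M 𝔼) (h : M → ℝ) {q : M} (hq : q ∈ e.source) :
    descend e h (e q) = h q := by
  rw [descend, indicator_of_mem (e.map_source hq), Function.comp_apply, e.left_inv hq]

theorem descend_eq_of_mem (e : OpenPartialHomeomorph M 𝔼) (h : M → ℝ) {x : 𝔼} (hx : x ∈ e.target) :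
    descend e h x = h (e.symm x) := by
  rw [descend, indicator_of_mem hx, Function.comp_apply]

/-- The support is compact, so its image is closed in the model space and the extension by zero is
smooth across the boundary of the target. -/
theorem contDiff_descend [T2Space M] [CompactSpace M] {e : OpenPartialHomeomorph M 𝔼}
    (he : e ∈ IsManifold.maximalAtlas (𝓡 m) ∞ M) {h : M → ℝ}
    (hh : ContMDiff (𝓡 m) 𝓘(ℝ, ℝ) ∞ h) (hs : tsupport h ⊆ e.source) :
    ContDiff ℝ ∞ (descend e h) := by
  refine contDiff_iff_contDiffAt.2 fun x ↦ ?_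
  by_cases hx : x ∈ e.target
  · have h1 : ContMDiffAt (𝓡 m) 𝓘(ℝ, ℝ) ∞ (h ∘ e.symm) x :=
      (hh _).comp x (contMDiffAt_symm_of_mem_maximalAtlas he hx)
    refine h1.contDiffAt.congr_of_eventuallyEq ?_
    filter_upwards [e.open_target.mem_nhds hx] with y hy
    rw [descend, indicator_of_mem hy]
  · have hK : IsCompact (e '' tsupport h) :=
      (isClosed_tsupport h).isCompact.image_of_continuousOn (e.continuousOn.mono hs)
    have hxK : x ∈ (e '' tsupport h)ᶜ := by
      rintro ⟨q, hq, rfl⟩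
      exact hx (e.map_source (hs hq))
    refine (contDiffAt_const (c := (0 : ℝ))).congr_of_eventuallyEq ?_
    filter_upwards [hK.isClosed.isOpen_compl.mem_nhds hxK] with y hy
    by_cases hy' : y ∈ e.target
    · rw [descend, indicator_of_mem hy', Function.comp_apply]
      refine image_eq_zero_of_notMem_tsupport fun h' ↦ hy ⟨_, h', e.right_inv hy'⟩
    · rw [descend, indicator_of_notMem hy']

/-- A chart of `M` adapted to `Z`, with a cut-off function `χ` that is `1` on the open set `U`. -/
structure BChart (m : ℕ) {M : Type*} [TopologicalSpace M]
    [ChartedSpace (EuclideanSpace ℝ (Fin m)) M] (Z : Set M) where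
  e : OpenPartialHomeomorph M (EuclideanSpace ℝ (Fin m))
  mem : e ∈ IsManifold.maximalAtlas (𝓡 m) ∞ M
  o : Option (Fin m)
  mem_iff : ∀ q ∈ e.source, q ∈ Z ↔ scaleProd o (e q) = 0
  χ : SmoothFun m M
  tsupport_subset : tsupport χ ⊆ e.source
  U : Set M
  isOpen : IsOpen U
  eq_one : ∀ q ∈ U, χ q = 1

theorem exists_smoothFun_one_nhds [T2Space M] [CompactSpace M] {K O : Set M} (hK : IsClosed K)
    (hO : IsOpen O) (h : K ⊆ O) :
    ∃ χ : SmoothFun m M, tsupport χ ⊆ O ∧ (∃ U, IsOpen U ∧ K ⊆ U ∧ ∀ q ∈ U, χ q = 1) ∧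
      ∀ q, χ q ∈ Icc (0 : ℝ) 1 := by
  have : LocallyCompactSpace M := ChartedSpace.locallyCompactSpace 𝔼 M
  obtain ⟨f, h0, h1, hf⟩ := exists_contMDiffMap_zero_one_nhds_of_isClosed (𝓡 m) (n := ⊤)
    hO.isClosed_compl hK (disjoint_compl_left_iff_subset.2 h)
  obtain ⟨U, hU, hKU, hU1⟩ := mem_nhdsSet_iff_exists.1 h1
  obtain ⟨V, hV, hOV, hV0⟩ := mem_nhdsSet_iff_exists.1 h0
  refine ⟨f, ?_, ⟨U, hU, hKU, fun q hq ↦ hU1 hq⟩, hf⟩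
  have : tsupport f ⊆ Vᶜ := closure_minimal (fun q hq hqV ↦ hq (hV0 hqV)) hV.isClosed_compl
  exact fun q hq ↦ by_contra fun hqO ↦ this hq (hOV hqO)

theorem exists_bChart [T2Space M] [CompactSpace M] (hZ : IsBManifold m Z) (p : M) :
    ∃ c : BChart m Z, p ∈ c.U := by
  obtain ⟨e, he, hp, o, ho⟩ : ∃ e ∈ IsManifold.maximalAtlas (𝓡 m) ∞ M, p ∈ e.source ∧
      ∃ o : Option (Fin m), ∀ q ∈ e.source, q ∈ Z ↔ scaleProd o (e q) = 0 := by
    by_cases hpZ : p ∈ Z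
    · obtain ⟨e, he, hp, i, hi⟩ := hZ.slice p hpZ
      exact ⟨e, he, hp, some i, by simpa [scaleProd_some] using hi⟩
    -- Off `Z`, the chart is cut down to miss `Z`; `none` records this, as `scaleProd none` is the
    -- constant `1`.
    · refine ⟨(chartAt 𝔼 p).restr Zᶜ, restr_mem_maximalAtlas _
        (IsManifold.chart_mem_maximalAtlas p) hZ.isClosed.isOpen_compl, ?_, none, fun q hq ↦ ?_⟩
      · rw [OpenPartialHomeomorph.restr_source' _ _ hZ.isClosed.isOpen_compl]
        exact ⟨mem_chart_source _ p, hpZ⟩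
      · rw [OpenPartialHomeomorph.restr_source' _ _ hZ.isClosed.isOpen_compl] at hq
        simpa [scaleProd_none] using hq.2
  obtain ⟨χ, hχ, ⟨U, hU, hpU, hU1⟩, -⟩ := exists_smoothFun_one_nhds (m := m)
    (isClosed_singleton (x := p)) e.open_source (singleton_subset_iff.2 hp)
  exact ⟨⟨e, he, o, ho, χ, hχ, U, hU, hU1⟩, hpU rfl⟩

namespace BChart
variable (c : BChart m Z)

theorem U_subset_tsupport : c.U ⊆ tsupport c.χ := fun q hq ↦
  subset_tsupport _ (by rw [Function.mem_support, c.eq_one q hq]; exact one_ne_zero)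

theorem U_subset : c.U ⊆ c.e.source := c.U_subset_tsupport.trans c.tsupport_subset

/-- The function on `M` that is given by `H` in the chart, cut off. -/
def lift (H : 𝔼 → ℝ) (hH : ContDiff ℝ ∞ H) : SmoothFun m M :=
  ⟨fun q ↦ c.χ q * H (c.e q), by
    refine contMDiff_of_tsupport fun q hq ↦ ?_
    have hq' : q ∈ c.e.source := c.tsupport_subset (tsupport_mul_subset_left hq)
    exact (c.χ.contMDiff q).mul (hH.contMDiff.contMDiffAt.comp q
      (contMDiffAt_of_mem_maximalAtlas c.mem hq'))⟩

theorem lift_apply {H : 𝔼 → ℝ} (hH : ContDiff ℝ ∞ H) {q : M} (hq : q ∈ c.U) :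
    c.lift H hH q = H (c.e q) := by
  change c.χ q * _ = _
  rw [c.eq_one q hq, one_mul]

/-- The cut-off coordinate functions of a chart. -/
def coord (j : Fin m) : SmoothFun m M := c.lift (fun x ↦ x j) (by fun_prop)

theorem coord_apply (j : Fin m) {q : M} (hq : q ∈ c.U) : c.coord j q = c.e q j :=
  c.lift_apply _ hq

/-- The coordinate vector fields of a chart, before the cut-off. -/
def rawField (j : Fin m) (q : M) : TangentSpace (𝓡 m) q :=
  VectorField.mpullback (𝓡 m) (𝓡 m) c.e
    (fun x ↦ scaleCoeff c.o j x • (EuclideanSpace.single j (1 : ℝ) : 𝔼)) q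

theorem mfderiv_rawField (j : Fin m) {q : M} (hq : q ∈ c.e.source) :
    mfderiv (𝓡 m) (𝓡 m) c.e q (c.rawField j q) =
      scaleCoeff c.o j (c.e q) • (EuclideanSpace.single j (1 : ℝ) : 𝔼) :=
  (isInvertible_mfderiv_chart c.mem hq).self_apply_inverse _

theorem contMDiffOn_rawField (j : Fin m) : ContMDiffOn (𝓡 m) (𝓡 m).tangent ∞
    (fun q ↦ (⟨q, c.rawField j q⟩ : TangentBundle (𝓡 m) M)) c.e.source := by
  intro q hq
  have : IsManifold (𝓡 m) (∞ + 1) M := by simpa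
  have h1 : ContDiff ℝ ∞ fun x : 𝔼 ↦ scaleCoeff c.o j x • (EuclideanSpace.single j (1 : ℝ) : 𝔼) :=
    (contDiff_scaleCoeff c.o j).smul contDiff_const
  have h2 : ContMDiff (𝓡 m) (𝓡 m).tangent ∞ (fun x : 𝔼 ↦ (⟨x, scaleCoeff c.o j x •
      (EuclideanSpace.single j (1 : ℝ) : 𝔼)⟩ : TangentBundle (𝓡 m) 𝔼)) := by
    intro x
    exact contMDiffAt_vectorSpace_iff_contDiffAt.2 h1.contDiffAt
  exact (ContMDiffAt.mpullback_vectorField_preimage (n := ∞) (h2 _)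
    (contMDiffAt_of_mem_maximalAtlas c.mem hq) (isInvertible_mfderiv_chart c.mem hq)
    (by simp)).contMDiffWithinAt

/-- The `j`-th vector field of the local frame of `T_Z M`, cut off. -/
def frameField (j : Fin m) : VField m M :=
  ⟨fun q ↦ c.χ q • c.rawField j q,
    ContMDiffOn.smul_section_of_tsupport c.χ.contMDiff.contMDiffOn c.e.open_source
      c.tsupport_subset (c.contMDiffOn_rawField j)⟩

theorem mfderiv_frameField (j : Fin m) {q : M} (hq : q ∈ c.e.source) :
    mfderiv (𝓡 m) (𝓡 m) c.e q (c.frameField j q) =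
      (c.χ q * scaleCoeff c.o j (c.e q)) • (EuclideanSpace.single j (1 : ℝ) : 𝔼) := by
  change mfderiv (𝓡 m) (𝓡 m) c.e q (c.χ q • c.rawField j q) = _
  rw [map_smul, c.mfderiv_rawField j hq, mul_smul]
  rfl

theorem deriv_frameField (j : Fin m) (f : SmoothFun m M) {q : M} (hq : q ∈ c.e.source) :
    (c.frameField j).deriv f q = c.χ q * (scaleCoeff c.o j (c.e q) *
      fderiv ℝ (f ∘ c.e.symm) (c.e q) (EuclideanSpace.single j 1)) := by
  change mvfderiv (𝓡 m) f q (c.frameField j q) = _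
  rw [mvfderiv_eq_fderiv_chart c.mem hq (f.contMDiff.mdifferentiable (by simp) q),
    c.mfderiv_frameField j hq, map_smul, smul_eq_mul, mul_assoc]

/-- The direction `j` is not normal, so the line through `c.e q` in this direction stays in the
hyperplane and `f` vanishes along it. This is the tangency of `∂_j` to `Z`. -/
theorem fderiv_comp_symm_single_eq_zero {q : M} (hq : q ∈ c.e.source) (hqZ : q ∈ Z) {j : Fin m}
    (hj : c.o ≠ some j) {f : SmoothFun m M} (hf : ∀ p ∈ Z, f p = 0) :
    fderiv ℝ (f ∘ c.e.symm) (c.e q) (EuclideanSpace.single j 1) = 0 := by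
  obtain ⟨k, hk, hk0⟩ := scaleProd_eq_zero_iff.1 ((c.mem_iff q hq).1 hqZ)
  have hjk : k ≠ j := fun h ↦ hj (h ▸ hk)
  have hcd : ContMDiffAt (𝓡 m) 𝓘(ℝ, ℝ) ∞ (f ∘ c.e.symm) (c.e q) :=
    (f.contMDiff _).comp _ (contMDiffAt_symm_of_mem_maximalAtlas c.mem (c.e.map_source hq))
  let γ : ℝ → 𝔼 := fun t ↦ c.e q + t • EuclideanSpace.single j 1
  have hγ : HasDerivAt γ (EuclideanSpace.single j 1) 0 := by
    have := ((hasDerivAt_id (0 : ℝ)).smul_const (EuclideanSpace.single j (1 : ℝ))).const_add (c.e q)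
    rwa [one_smul] at this
  have hγ0 : γ 0 = c.e q := by simp [γ]
  have h1 := (HasFDerivAt.comp_hasDerivAt (l := f ∘ c.e.symm) 0 (by
    rw [hγ0]; exact (hcd.contDiffAt.differentiableAt (by simp)).hasFDerivAt) hγ)
  refine h1.unique ((hasDerivAt_const (0 : ℝ) (0 : ℝ)).congr_of_eventuallyEq ?_)
  have : ∀ᶠ t in 𝓝 (0 : ℝ), γ t ∈ c.e.target :=
    hγ.continuousAt.eventually (by rw [hγ0]; exact c.e.open_target.mem_nhds (c.e.map_source hq))
  filter_upwards [this] with t ht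
  refine hf _ ((c.mem_iff _ (c.e.map_target ht)).2 ?_)
  rw [c.e.right_inv ht, scaleProd_eq_zero_iff]
  exact ⟨k, hk, by simp [γ, hk0, hjk]⟩

/-- The local frame of `T_Z M` that belongs to an adapted chart, cut off. -/
def frame (j : Fin m) : bFields m Z :=
  ⟨c.frameField j, fun q hqZ f hf ↦ by
    change (c.frameField j).deriv f q = 0
    by_cases hq : q ∈ tsupport c.χ
    · have hq := c.tsupport_subset hq
      rw [c.deriv_frameField j f hq]
      by_cases hj : c.o = some j
      · have := (c.mem_iff q hq).1 hqZ
        rw [hj, scaleProd_some] at this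
        simp [scaleCoeff, hj, this]
      · rw [c.fderiv_comp_symm_single_eq_zero hq hqZ hj hf, mul_zero, mul_zero]
    · change mvfderiv (𝓡 m) f q (c.χ q • c.rawField j q) = 0
      rw [image_eq_zero_of_notMem_tsupport hq, zero_smul, map_zero]⟩

theorem deriv_frame (j : Fin m) (f : SmoothFun m M) {q : M} (hq : q ∈ c.U) :
    (c.frame j).1.deriv f q = scaleCoeff c.o j (c.e q) *
      fderiv ℝ (f ∘ c.e.symm) (c.e q) (EuclideanSpace.single j 1) := by
  change (c.frameField j).deriv f q = _
  rw [c.deriv_frameField j f (c.U_subset hq), c.eq_one q hq, one_mul]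

theorem mfderiv_apply_eq_deriv_coord (W : VField m M) (j : Fin m) {q : M} (hq : q ∈ c.U) :
    (show 𝔼 from mfderiv (𝓡 m) (𝓡 m) c.e q (W q)) j = W.deriv (c.coord j) q := by
  change _ = mvfderiv (𝓡 m) (c.coord j) q (W q)
  rw [mvfderiv_eq_fderiv_chart c.mem (c.U_subset hq)
    ((c.coord j).contMDiff.mdifferentiable (by simp) q)]
  have : (c.coord j ∘ c.e.symm) =ᶠ[𝓝 (c.e q)] (EuclideanSpace.proj j : 𝔼 →L[ℝ] ℝ) := by
    have h1 := (c.e.continuousAt_symm (c.e.map_source (c.U_subset hq))).eventually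
      (by rw [c.e.left_inv (c.U_subset hq)]; exact c.isOpen.mem_nhds hq)
    filter_upwards [h1, c.e.open_target.mem_nhds (c.e.map_source (c.U_subset hq))] with x hx hx'
    rw [Function.comp_apply, c.coord_apply j hx, c.e.right_inv hx']
    rfl
  rw [this.fderiv_eq, ContinuousLinearMap.fderiv]
  rfl

theorem deriv_frame_coord (i j : Fin m) {q : M} (hq : q ∈ c.U) :
    (c.frame i).1.deriv (c.coord j) q = if i = j then scaleCoeff c.o i (c.e q) else 0 := by
  rw [← c.mfderiv_apply_eq_deriv_coord _ j hq]
  change (show 𝔼 from mfderiv (𝓡 m) (𝓡 m) c.e q (c.frameField i q)) j = _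
  rw [c.mfderiv_frameField i (c.U_subset hq), c.eq_one q hq]
  simp [eq_comm]

theorem eq_of_deriv_coord_eq {v w : VField m M} {q : M} (hq : q ∈ c.U)
    (h : ∀ j, v.deriv (c.coord j) q = w.deriv (c.coord j) q) : v q = w q := by
  apply (isInvertible_mfderiv_chart c.mem (c.U_subset hq)).injective
  have : (show 𝔼 from mfderiv (𝓡 m) (𝓡 m) c.e q (v q)) =
      (show 𝔼 from mfderiv (𝓡 m) (𝓡 m) c.e q (w q)) := by
    ext j
    rw [c.mfderiv_apply_eq_deriv_coord _ j hq, c.mfderiv_apply_eq_deriv_coord _ j hq, h]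
  exact this

theorem coord_eq_zero {k : Fin m} (hk : c.o = some k) {q : M} (hq : q ∈ Z) : c.coord k q = 0 := by
  change c.χ q * c.e q k = 0
  by_cases hq' : q ∈ tsupport c.χ
  · have := (c.mem_iff q (c.tsupport_subset hq')).1 hq
    rw [hk, scaleProd_some] at this
    rw [this, mul_zero]
  · rw [image_eq_zero_of_notMem_tsupport hq', zero_mul]

/-- A function that vanishes on `Z` is divisible by the normal coordinate. -/
theorem exists_eq_coord_mul [T2Space M] [CompactSpace M] {k : Fin m} (hk : c.o = some k)
    {h : SmoothFun m M} (hh : ∀ q ∈ Z, h q = 0) :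
    ∃ h' : SmoothFun m M, ∀ q ∈ c.U, h q = c.e q k * h' q := by
  have hs : tsupport (c.χ * h : SmoothFun m M) ⊆ c.e.source := by
    rw [ContMDiffMap.coe_mul]
    exact tsupport_mul_subset_left.trans c.tsupport_subset
  obtain ⟨H, hH, hH'⟩ := exists_contDiff_eq_mul_of_forall_eq_zero
    (contDiff_descend c.mem (c.χ * h : SmoothFun m M).contMDiff hs)
    (EuclideanSpace.proj k : 𝔼 →L[ℝ] ℝ) (b := EuclideanSpace.single k 1) (by simp) fun x hx ↦ by
      by_cases hxt : x ∈ c.e.target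
      · rw [descend_eq_of_mem _ _ hxt]
        have : h (c.e.symm x) = 0 := hh _ <| (c.mem_iff _ (c.e.map_target hxt)).2 <| by
          rw [hk, scaleProd_some, c.e.right_inv hxt]
          exact hx
        change c.χ _ * h _ = 0
        rw [this, mul_zero]
      · rw [descend, indicator_of_notMem hxt]
  refine ⟨c.lift H hH, fun q hq ↦ ?_⟩
  have h1 := hH' (c.e q)
  rw [descend_apply _ _ (c.U_subset hq)] at h1
  rw [c.lift_apply hH hq]
  have h2 : (c.χ * h : SmoothFun m M) q = h q := by
    change c.χ q * h q = h q
    rw [c.eq_one q hq, one_mul]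
  rw [← h2, h1]
  rfl

/-- `T_Z M` is free over `U`. The derivative of the normal coordinate along `W` vanishes on `Z` by
tangency, so Hadamard's lemma divides it by that coordinate. The other coefficients are the
derivatives of the coordinates themselves. -/
theorem exists_frame_coeff [T2Space M] [CompactSpace M] (W : bFields m Z) :
    ∃ f : Fin m → SmoothFun m M,
      (∀ q ∈ c.U, ∀ j, W.1.deriv (c.coord j) q = f j q * scaleCoeff c.o j (c.e q)) ∧
      ∀ q ∈ c.U, W.1 q = (∑ j, f j • c.frame j).1 q := by
  have h1 : ∀ j, ∃ f : SmoothFun m M, ∀ q ∈ c.U, W.1.deriv (c.coord j) q =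
      f q * scaleCoeff c.o j (c.e q) := by
    intro j
    by_cases hj : c.o = some j
    · obtain ⟨f, hf⟩ := c.exists_eq_coord_mul hj (h := W.1.deriv (c.coord j))
        fun q hq ↦ W.2 q hq _ fun p hp ↦ c.coord_eq_zero hj hp
      exact ⟨f, fun q hq ↦ by rw [hf q hq, scaleCoeff, if_pos hj, mul_comm]⟩
    · exact ⟨W.1.deriv (c.coord j), fun q _ ↦ by rw [scaleCoeff, if_neg hj, mul_one]⟩
  choose f hf using h1
  refine ⟨f, fun q hq j ↦ hf j q hq, fun q hq ↦ c.eq_of_deriv_coord_eq hq fun i ↦ ?_⟩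
  rw [hf i q hq]
  have h2 : ((∑ j, f j • c.frame j : bFields m Z).1).deriv (c.coord i) q =
      ∑ j, f j q * (c.frame j).1.deriv (c.coord i) q := by
    have e1 : (∑ j, f j • c.frame j : bFields m Z).1 q = ∑ j, f j q • (c.frame j).1 q := by
      rw [AddSubmonoidClass.coe_finsetSum]
      have : ∀ s : Finset (Fin m), (∑ j ∈ s, ((f j • c.frame j : bFields m Z) : VField m M)) q =
          ∑ j ∈ s, f j q • (c.frame j).1 q := by
        intro s
        induction s using Finset.cons_induction with
        | empty => rfl
        | cons a s ha ih =>
          rw [Finset.sum_cons, Finset.sum_cons, ← ih]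
          rfl
      exact this _
    change mvfderiv (𝓡 m) (c.coord i) q ((∑ j, f j • c.frame j : bFields m Z).1 q) = _
    rw [e1, map_sum]
    simp only [map_smul, smul_eq_mul]
    rfl
  rw [h2, Finset.sum_eq_single i]
  · rw [c.deriv_frame_coord i i hq, if_pos rfl]
  · intro j _ hj
    rw [c.deriv_frame_coord j i hq, if_neg hj, mul_zero]
  · simp

end BChart

/-! ### Top-degree b-forms in a local frame. -/

section

theorem map_eq_det_of_eq_linearCombination {R A : Type*} [CommRing R] [AddCommGroup A] [Module R A]
    (α : A [⋀^Fin m]→ₗ[R] R) (f : Fin m → Fin m → R) (V : Fin m → A) :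
    α (fun i ↦ ∑ j, f i j • V j) = (Matrix.of f).det * α V := by
  have h := congrArg (fun β ↦ β f)
    ((α.compLinearMap (Fintype.linearCombination R V)).eq_smul_basis_det
    (Pi.basisFun R (Fin m)))
  simp only [AlternatingMap.compLinearMap_apply, AlternatingMap.smul_apply, Pi.basisFun_det_apply,
    Fintype.linearCombination_apply] at h
  have h2 : (fun i ↦ ∑ j, Pi.basisFun R (Fin m) i j • V j) = V := by
    funext i
    simp [Pi.single_apply]
  have h3 : (α fun i ↦ ∑ j, (Pi.basisFun R (Fin m)) i j • V j) = α V := congrArg α h2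
  rw [h, h3, smul_eq_mul, mul_comm]

variable [T2Space M] [CompactSpace M]

/-- The value of a b-form at a point depends only on the germs of its arguments. -/
theorem BForm.congr_of_eventuallyEq {k : ℕ} (α : BForm m Z k) {V W : Fin k → bFields m Z} {q : M}
    (h : ∀ i, ∀ᶠ p in 𝓝 q, (V i).1 p = (W i).1 p) : α V q = α W q := by
  obtain ⟨O, hO, hOo, hqO⟩ := eventually_nhds_iff.1 (eventually_all.2 h)
  obtain ⟨χ, hχ, ⟨U, -, hqU, hU1⟩, -⟩ := exists_smoothFun_one_nhds (m := m)
    (isClosed_singleton (x := q)) hOo (singleton_subset_iff.2 hqO)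
  -- After the cut-off the arguments agree on all of `M`. Multilinearity then extracts `χ ^ k`,
  -- which is `1` at `q`.
  have h1 : (fun i ↦ χ • V i) = fun i ↦ χ • W i := by
    funext i
    ext p
    change χ p • (V i).1 p = χ p • (W i).1 p
    by_cases hp : p ∈ tsupport χ
    · rw [hO p (hχ hp)]
    · rw [image_eq_zero_of_notMem_tsupport hp, zero_smul, zero_smul]
  have h2 : ∀ V : Fin k → bFields m Z, α (fun i ↦ χ • V i) q = α V q := by
    intro V
    have := congrArg (fun f : SmoothFun m M ↦ f q)
      (α.toMultilinearMap.map_smul_univ (fun _ ↦ χ) V)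
    refine this.trans ?_
    rw [Finset.prod_const, Finset.card_univ, Fintype.card_fin]
    change (χ ^ k) q * α V q = _
    rw [ContMDiffMap.coe_pow, Pi.pow_apply, hU1 q (hqU rfl), one_pow, one_mul]
  rw [← h2 V, h1, h2]

namespace BChart
variable (c : BChart m Z)

/-- The same matrix serves all `α`. So it compares top-forms with one another, and with the
determinant of the coordinate derivatives. -/
theorem exists_matrix (W : Fin m → bFields m Z) {q : M} (hq : q ∈ c.U) :
    ∃ A : Matrix (Fin m) (Fin m) ℝ,
      (∀ i j, (W i).1.deriv (c.coord j) q = A i j * scaleCoeff c.o j (c.e q)) ∧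
      ∀ α : BForm m Z m, α W q = A.det * α c.frame q := by
  choose f hf hW using fun i ↦ c.exists_frame_coeff (W i)
  refine ⟨Matrix.of fun i j ↦ f i j q, fun i j ↦ hf i q hq j, fun α ↦ ?_⟩
  have h1 : α W q = α (fun i ↦ ∑ j, f i j • c.frame j) q :=
    α.congr_of_eventuallyEq fun i ↦ eventually_of_mem (c.isOpen.mem_nhds hq) fun p hp ↦ hW i p hp
  rw [h1, map_eq_det_of_eq_linearCombination]
  change (Matrix.of f).det q * _ = _
  congr 1
  let ev : SmoothFun m M →+* ℝ :=
    { toFun := fun f ↦ f q, map_one' := rfl, map_mul' := fun _ _ ↦ rfl, map_zero' := rfl,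
      map_add' := fun _ _ ↦ rfl }
  exact ev.map_det (Matrix.of f)

/-- The matrix of the derivatives of the coordinates of `c` along the vector fields `W`. -/
def derivMatrix (W : Fin m → VField m M) (q : M) : Matrix (Fin m) (Fin m) ℝ :=
  Matrix.of fun i j ↦ (W i).deriv (c.coord j) q

/-- In the chart, `α` is its coefficient on the frame times `dx_1 ∧ ⋯ ∧ dx_m` divided by
`scaleProd`. Clearing the denominator makes the formula valid on `Z` as well. -/
theorem scaleProd_mul_apply (α : BForm m Z m) (W : Fin m → bFields m Z) {q : M} (hq : q ∈ c.U) :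
    scaleProd c.o (c.e q) * α W q = (c.derivMatrix (fun i ↦ (W i).1) q).det * α c.frame q := by
  obtain ⟨A, hA, hα⟩ := c.exists_matrix W hq
  have h1 : c.derivMatrix (fun i ↦ (W i).1) q =
      A * Matrix.diagonal (fun j ↦ scaleCoeff c.o j (c.e q)) := by
    ext i j
    rw [Matrix.mul_diagonal]
    exact hA i j
  rw [h1, Matrix.det_mul, Matrix.det_diagonal, hα, scaleProd]
  ring

theorem frame_ne_zero {α : BForm m Z m} (hα : α.NowhereVanishing) {q : M} (hq : q ∈ c.U) :
    α c.frame q ≠ 0 := by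
  obtain ⟨W, hW⟩ := hα q
  obtain ⟨A, -, h⟩ := c.exists_matrix W hq
  rw [h α] at hW
  exact right_ne_zero_of_mul hW

theorem apply_mul_apply_comm (α β : BForm m Z m) (W : Fin m → bFields m Z) {q : M}
    (hq : q ∈ c.U) : α W q * β c.frame q = α c.frame q * β W q := by
  obtain ⟨A, -, h⟩ := c.exists_matrix W hq
  rw [h α, h β]
  ring

theorem scaleProd_ne_zero {q : M} (hq : q ∈ c.e.source) (hqZ : q ∉ Z) : scaleProd c.o (c.e q) ≠ 0 :=
  fun h ↦ hqZ ((c.mem_iff q hq).2 h)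

end BChart

/-- Moving along the normal coordinate leaves `Z` at once. Identities between smooth functions
therefore need checking only off `Z`. -/
theorem IsBManifold.dense_compl (hZ : IsBManifold m Z) : Dense Zᶜ := by
  intro p
  by_contra hp
  have hpZ : p ∈ Z := by
    by_contra h
    exact hp (subset_closure h)
  obtain ⟨c, hpc⟩ := exists_bChart hZ p
  have hps := c.U_subset hpc
  obtain ⟨k, hk, hk0⟩ := scaleProd_eq_zero_iff.1 ((c.mem_iff p hps).1 hpZ)
  let γ : ℝ → M := fun t ↦ c.e.symm (c.e p + t • EuclideanSpace.single k 1)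
  have h0 : c.e p + (0 : ℝ) • EuclideanSpace.single k 1 = c.e p := by simp
  have hc : ContinuousAt (fun t : ℝ ↦ c.e p + t • (EuclideanSpace.single k 1 : 𝔼)) 0 := by fun_prop
  have hγ : Tendsto γ (𝓝 0) (𝓝 p) := by
    have := (c.e.continuousAt_symm (c.e.map_source hps)).tendsto
    rw [c.e.left_inv hps] at this
    refine this.comp ?_
    have := hc.tendsto
    rwa [h0] at this
  have h1 : ∀ᶠ t in 𝓝 (0 : ℝ), γ t ∈ (closure Zᶜ)ᶜ :=
    hγ.eventually (isClosed_closure.isOpen_compl.mem_nhds hp)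
  have h2 : ∀ᶠ t in 𝓝 (0 : ℝ), c.e p + t • EuclideanSpace.single k 1 ∈ c.e.target :=
    hc.eventually (by simp only [h0]; exact c.e.open_target.mem_nhds (c.e.map_source hps))
  obtain ⟨t, ⟨ht1, ht2⟩, ht⟩ := ((h1.and h2).filter_mono nhdsWithin_le_nhds |>.and
    (self_mem_nhdsWithin (a := (0 : ℝ)) (s := {0}ᶜ))).exists
  refine ht1 (subset_closure fun hZt ↦ ht ?_)
  have := (c.mem_iff _ (c.e.map_target ht2)).1 hZt
  rw [c.e.right_inv ht2, hk, scaleProd_some] at this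
  simpa [hk0] using this

theorem SmoothFun.ext_compl (hZ : IsBManifold m Z) {f g : SmoothFun m M}
    (h : ∀ q ∉ Z, f q = g q) : f = g := by
  ext q
  exact congrFun (Continuous.ext_on hZ.dense_compl f.contMDiff.continuous g.contMDiff.continuous
    fun q hq ↦ h q hq) q

/-- Every b-top-form is a multiple of a given nowhere vanishing one. -/
theorem exists_eq_smul (hZ : IsBManifold m Z) {μ : BForm m Z m} (hμ : μ.NowhereVanishing)
    (α : BForm m Z m) : ∃ F : SmoothFun m M, α = F • μ := by
  choose c hc using exists_bChart (m := m) hZ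
  -- The quotient does not depend on the chart, by `hF`; near `p` it can be computed in the single
  -- chart `c p`, where it is smooth.
  let F : M → ℝ := fun q ↦ α (c q).frame q / μ (c q).frame q
  have hF : ∀ W q, α W q = F q * μ W q := by
    intro W q
    have := (c q).apply_mul_apply_comm α μ W (hc q)
    have hne := (c q).frame_ne_zero hμ (hc q)
    simp only [F]
    field_simp
    linarith
  have hFs : ContMDiff (𝓡 m) 𝓘(ℝ, ℝ) ∞ F := by
    intro p
    have h1 : ContMDiffAt (𝓡 m) 𝓘(ℝ, ℝ) ∞ (fun q ↦ α (c p).frame q / μ (c p).frame q) p :=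
      ((α (c p).frame).contMDiff p).div₀ ((μ (c p).frame).contMDiff p)
        ((c p).frame_ne_zero hμ (hc p))
    refine h1.congr_of_eventuallyEq ?_
    filter_upwards [(c p).isOpen.mem_nhds (hc p)] with q hq
    rw [hF (c p).frame q, mul_div_cancel_right₀ _ ((c p).frame_ne_zero hμ hq)]
  refine ⟨⟨F, hFs⟩, ?_⟩
  ext W q
  exact hF W q

end

/-! ### Splitting exact forms into elementary pieces. -/

section

theorem VField.deriv_congr (V : VField m M) {f g : SmoothFun m M} {q : M}
    (h : (f : M → ℝ) =ᶠ[𝓝 q] g) : V.deriv f q = V.deriv g q := by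
  have h1 : mfderiv (𝓡 m) 𝓘(ℝ, ℝ) f q = mfderiv (𝓡 m) 𝓘(ℝ, ℝ) g q := h.mfderiv_eq
  exact congrArg (fun L : TangentSpace (𝓡 m) q →L[ℝ] ℝ ↦ L (V q)) h1

theorem VField.deriv_const (V : VField m M) {f : SmoothFun m M} {r : ℝ} (h : ∀ q, f q = r) (q : M) :
    V.deriv f q = 0 := by
  have : (f : M → ℝ) = fun _ ↦ r := funext h
  change mvfderiv (𝓡 m) f q (V q) = 0
  rw [this, mvfderiv_const]
  rfl

theorem VField.deriv_eq_zero_of_notMem_tsupport (V : VField m M) {f : SmoothFun m M} {q : M}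
    (h : q ∉ tsupport f) : V.deriv f q = 0 := by
  rw [V.deriv_congr (g := 0) (notMem_tsupport_iff_eventuallyEq.1 h),
    V.deriv_const (r := 0) fun _ ↦ rfl]

theorem VField.deriv_mul (V : VField m M) (f g : SmoothFun m M) :
    V.deriv (f * g) = f * V.deriv g + g * V.deriv f := by
  ext q
  have := mvfderiv_mul (f.contMDiff.mdifferentiable (by simp) q)
    (g.contMDiff.mdifferentiable (by simp) q)
  exact congrArg (fun L ↦ L (V q)) this

theorem VField.deriv_sum (V : VField m M) {ι : Type*} (s : Finset ι) (f : ι → SmoothFun m M) :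
    V.deriv (∑ i ∈ s, f i) = ∑ i ∈ s, V.deriv (f i) := by
  induction s using Finset.cons_induction with
  | empty =>
    ext q
    simpa using V.deriv_const (f := 0) (r := 0) (fun _ ↦ rfl) q
  | cons a s ha ih => rw [Finset.sum_cons, Finset.sum_cons, V.deriv_add, ih]

theorem VField.add_deriv (V W : VField m M) (f : SmoothFun m M) :
    (V + W).deriv f = V.deriv f + W.deriv f := by
  ext q
  exact map_add (mvfderiv (𝓡 m) f q) (V q) (W q)

theorem VField.smul_deriv (h : SmoothFun m M) (V : VField m M) (f : SmoothFun m M) :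
    (h • V).deriv f = h * V.deriv f := by
  ext q
  exact map_smul (mvfderiv (𝓡 m) f q) (h q) (V q)

theorem SmoothFun.sum_apply {ι : Type*} (s : Finset ι) (f : ι → SmoothFun m M) (q : M) :
    (∑ i ∈ s, f i) q = ∑ i ∈ s, f i q := by
  induction s using Finset.cons_induction with
  | empty => rfl
  | cons a s ha ih =>
    rw [Finset.sum_cons, Finset.sum_cons, ← ih]
    rfl

namespace BChart
variable (c : BChart m Z)

/-- The second derivatives `V_i V_j x_l` are symmetric in `i` and `j`: they can be nonzero only for
`i = j = l` the normal index. -/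
theorem bBracket_frame (i j : Fin m) {q : M} (hq : q ∈ c.U) :
    (bBracket (c.frame i) (c.frame j)).1 q = (0 : VField m M) q := by
  refine c.eq_of_deriv_coord_eq hq fun l ↦ ?_
  have h0 : (0 : VField m M).deriv (c.coord l) q = 0 := map_zero (mvfderiv (𝓡 m) (c.coord l) q)
  have h1 := congrArg (fun f : SmoothFun m M ↦ f q)
    ((c.frame i).1.bracket_deriv (c.frame j).1 (c.coord l))
  rw [h0]
  refine h1.trans ?_
  have key : ∀ i j, (c.frame i).1.deriv ((c.frame j).1.deriv (c.coord l)) q =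
      if i = j ∧ j = l ∧ c.o = some j then scaleCoeff c.o i (c.e q) else 0 := by
    intro i j
    by_cases hjl : j = l
    · by_cases ho : c.o = some j
      · rw [VField.deriv_congr (g := c.coord j), c.deriv_frame_coord i j hq]
        · subst hjl
          simp [ho]
        · filter_upwards [c.isOpen.mem_nhds hq] with p hp
          rw [c.deriv_frame_coord j l hp, if_pos hjl, scaleCoeff, if_pos ho, c.coord_apply j hp]
      · rw [VField.deriv_congr (g := 1), VField.deriv_const (r := 1) _ fun _ ↦ rfl]
        · simp [ho]
        · filter_upwards [c.isOpen.mem_nhds hq] with p hp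
          rw [c.deriv_frame_coord j l hp, if_pos hjl, scaleCoeff, if_neg ho]
          rfl
    · rw [VField.deriv_congr (g := 0), VField.deriv_const (r := 0) _ fun _ ↦ rfl]
      · simp [hjl]
      · filter_upwards [c.isOpen.mem_nhds hq] with p hp
        rw [c.deriv_frame_coord j l hp, if_neg hjl]
        rfl
  change (c.frame i).1.deriv ((c.frame j).1.deriv (c.coord l)) q -
    (c.frame j).1.deriv ((c.frame i).1.deriv (c.coord l)) q = 0
  rw [key, key, sub_eq_zero]
  by_cases hij : i = j
  · rw [hij]
  · rw [if_neg (fun h ↦ hij h.1), if_neg (fun h ↦ hij h.1.symm)]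

end BChart

variable [T2Space M] [CompactSpace M]

/-- The frame fields commute on `U` and `η` depends only on germs, so the bracket terms of the
Koszul formula drop out. -/
theorem BChart.bDiff_frame {n : ℕ} {M : Type*} [TopologicalSpace M]
    [ChartedSpace (EuclideanSpace ℝ (Fin (n + 1))) M] [IsManifold (𝓡 (n + 1)) ∞ M] {Z : Set M}
    [T2Space M] [CompactSpace M] (c : BChart (n + 1) Z) (η : BForm (n + 1) Z n) {q : M}
    (hq : q ∈ c.U) :
    bDiff η c.frame q =
      ∑ i : Fin (n + 1), (-1 : ℝ) ^ (i : ℕ) * (c.frame i).1.deriv (η (i.removeNth c.frame)) q := by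
  cases n with
  | zero =>
    rw [Fin.sum_univ_one]
    simp only [Fin.coe_ofNat_eq_mod, Nat.zero_mod, pow_zero, one_mul]
    change (c.frame 0).1.deriv (η ![]) q = _
    congr 3
    exact Subsingleton.elim _ _
  | succ k =>
    have h0 : ∀ i j : Fin (k + 1 + 1), ∀ W : Fin k → bFields (k + 1 + 1) Z,
        η (Matrix.vecCons (bBracket (c.frame i) (c.frame j)) W) q = 0 := by
      intro i j W
      have h1 := η.congr_of_eventuallyEq (q := q)
        (V := Matrix.vecCons (bBracket (c.frame i) (c.frame j)) W) (W := Matrix.vecCons 0 W)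
        fun l ↦ by
          refine Fin.cases ?_ (fun l ↦ ?_) l
          · exact eventually_of_mem (c.isOpen.mem_nhds hq) fun p hp ↦ c.bBracket_frame i j hp
          · exact Eventually.of_forall fun _ ↦ rfl
      rw [h1, η.map_coord_zero 0 rfl]
      rfl
    have hz : ∀ (z : ℕ) (f : SmoothFun (k + 1 + 1) M), ((-1 : ℤ) ^ z • f) q =
      (-1 : ℝ) ^ z * f q := by
      intro z f
      have : (-1 : ℤ) ^ z • f = (-1 : ℝ) ^ z • f := by
        rcases neg_one_pow_eq_or ℤ z with h | h
        · rcases Nat.even_or_odd z with hz | hz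
          · simp [hz.neg_one_pow]
          · simp [hz.neg_one_pow] at h
        · rcases Nat.even_or_odd z with hz | hz
          · simp [hz.neg_one_pow] at h
          · simp [hz.neg_one_pow]
      rw [this]
      rfl
    change (∑ i : Fin (k + 2), (-1 : ℤ) ^ (i : ℕ) • (c.frame i).1.deriv
      (η (i.removeNth c.frame))) q -
      (∑ i : Fin (k + 1), ∑ j ∈ Finset.Ici i, (-1 : ℤ) ^ (i + j : ℕ) •
          η (Matrix.vecCons (bBracket (c.frame i.castSucc) (c.frame j.succ))
            (j.removeNth (i.castSucc.removeNth c.frame))) : SmoothFun (k + 1 + 1) M) q = _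
    simp only [SmoothFun.sum_apply, hz, h0, mul_zero, Finset.sum_const_zero, sub_zero]

theorem BForm.sum_apply {ι : Type*} {k : ℕ} (s : Finset ι) (α : ι → BForm m Z k)
    (V : Fin k → bFields m Z) : (∑ i ∈ s, α i) V = ∑ i ∈ s, α i V := by
  induction s using Finset.cons_induction with
  | empty => rfl
  | cons a s ha ih => rw [Finset.sum_cons, Finset.sum_cons, ← ih, AlternatingMap.add_apply]

/-- The b-form `dχ ∧ η`. -/
def dWedge {k : ℕ} (χ : SmoothFun m M) (η : BForm m Z k) : BForm m Z (k + 1) :=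
  AlternatingMap.alternatizeUncurryFin
    { toFun := fun W ↦ W.1.deriv χ • η
      map_add' := fun V W ↦ by
        rw [← add_smul, ← VField.add_deriv]
        rfl
      map_smul' := fun f W ↦ by
        rw [RingHom.id_apply, smul_smul, ← VField.smul_deriv]
        rfl }

theorem dWedge_apply {k : ℕ} (χ : SmoothFun m M) (η : BForm m Z k) (W : Fin (k + 1) → bFields m Z)
    (q : M) : dWedge χ η W q =
      ∑ i : Fin (k + 1), (-1 : ℝ) ^ (i : ℕ) * ((W i).1.deriv χ q * η (i.removeNth W) q) := by
  rw [dWedge, AlternatingMap.alternatizeUncurryFin_apply, SmoothFun.sum_apply]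
  refine Finset.sum_congr rfl fun i _ ↦ ?_
  rcases Nat.even_or_odd (i : ℕ) with hz | hz
  · simp only [hz.neg_one_pow, one_smul, one_mul]
    rfl
  · simp only [hz.neg_one_pow, neg_one_smul, neg_mul, one_mul]
    rfl

theorem eq_of_smul_eq_smul {μ : BForm m Z m} (hμ : μ.NowhereVanishing) {F G : SmoothFun m M}
    (h : F • μ = G • μ) : F = G := by
  ext q
  obtain ⟨V, hV⟩ := hμ q
  have := congrArg (fun α : BForm m Z m ↦ α V q) h
  exact mul_right_cancel₀ hV this

/-- `G μ = d(g ι_V μ₀)` for a member `V` of an adapted frame, with `μ₀` the dual volume form and `g`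
supported in the domain of the frame and vanishing on `S`. -/
def IsElementary (μ : BForm m Z m) (S : Set M) (G : SmoothFun m M) : Prop :=
  ∃ (c : BChart m Z) (j : Fin m) (g : SmoothFun m M),
    (∃ σ : ℝ, ∀ q ∈ c.U, 0 < σ * μ c.frame q) ∧ tsupport g ⊆ c.U ∧
    (∀ q ∈ c.U, G q * μ c.frame q = (c.frame j).1.deriv g q) ∧ (∀ q ∉ tsupport g, G q = 0) ∧
    ∀ q ∈ S, g q = 0

theorem BChart.exists_isElementary {μ : BForm m Z m} (hμ : μ.NowhereVanishing) (c : BChart m Z)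
    (j : Fin m) {g : SmoothFun m M} (hg : tsupport g ⊆ c.U) :
    ∃ G : SmoothFun m M, (∀ q ∈ c.U, G q * μ c.frame q = (c.frame j).1.deriv g q) ∧
      ∀ q ∉ tsupport g, G q = 0 := by
  let G : M → ℝ := fun q ↦ (c.frame j).1.deriv g q / μ c.frame q
  have h0 : ∀ q ∉ tsupport g, G q = 0 := fun q hq ↦ by
    simp only [G, VField.deriv_eq_zero_of_notMem_tsupport _ hq, zero_div]
  have hsupp : tsupport G ⊆ tsupport g :=
    closure_minimal (fun q hq ↦ by_contra fun h ↦ hq (h0 q h)) (isClosed_tsupport _)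
  refine ⟨⟨G, contMDiff_of_tsupport fun q hq ↦ ?_⟩, fun q hq ↦ ?_, h0⟩
  · exact (((c.frame j).1.deriv g).contMDiff q).div₀ ((μ c.frame).contMDiff q)
      (c.frame_ne_zero hμ (hg (hsupp hq)))
  · exact div_mul_cancel₀ _ (c.frame_ne_zero hμ hq)

/-- Around every point there is an adapted chart on which a given volume form has constant sign. -/
theorem exists_bChart_sign (hZ : IsBManifold m Z) {μ : BForm m Z m} (hμ : μ.NowhereVanishing)
    (p : M) :
    ∃ c : BChart m Z, p ∈ c.U ∧ ∃ σ : ℝ, ∀ q ∈ c.U, 0 < σ * μ c.frame q := by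
  obtain ⟨c, hc⟩ := exists_bChart hZ p
  let σ := μ c.frame p
  let c' : BChart m Z := { c with
    U := c.U ∩ {q | 0 < σ * μ c.frame q}
    isOpen := c.isOpen.inter (isOpen_lt continuous_const
      (continuous_const.mul (μ c.frame).contMDiff.continuous))
    eq_one := fun q hq ↦ c.eq_one q hq.1 }
  exact ⟨c', ⟨hc, mul_self_pos.2 (c.frame_ne_zero hμ hc)⟩, σ, fun q hq ↦ hq.2⟩

/-- An adapted finite partition of unity. -/
theorem exists_bChart_partition {P : BChart m Z → Prop}
    (hP : ∀ p, ∃ c : BChart m Z, p ∈ c.U ∧ P c) :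
    ∃ (N : ℕ) (c : Fin N → BChart m Z) (ρ : Fin N → SmoothFun m M), (∀ i, P (c i)) ∧
      (∀ i, tsupport (ρ i) ⊆ (c i).U) ∧ (∀ i q, 0 ≤ ρ i q) ∧ ∀ q, ∑ i, ρ i q = 1 := by
  choose c hc hcP using hP
  obtain ⟨t, ht⟩ := isCompact_univ.elim_finite_subcover (fun p ↦ (c p).U) (fun p ↦ (c p).isOpen)
    fun p _ ↦ mem_iUnion.2 ⟨p, hc p⟩
  obtain ⟨ρ, hρ⟩ := SmoothPartitionOfUnity.exists_isSubordinate (𝓡 m) (s := (univ : Set M))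
    isClosed_univ (fun p : t ↦ (c p).U) (fun p ↦ (c p).isOpen) fun q hq ↦ by
      obtain ⟨p, hp, hpq⟩ := mem_iUnion₂.1 (ht hq)
      exact mem_iUnion.2 ⟨⟨p, hp⟩, hpq⟩
  refine ⟨t.card, fun i ↦ c (t.equivFin.symm i), fun i ↦ ρ (t.equivFin.symm i),
    fun i ↦ hcP _, fun i ↦ hρ _,
    fun i q ↦ ρ.nonneg _ q, fun q ↦ ?_⟩
  have := ρ.sum_eq_one (mem_univ q)
  rw [finsum_eq_sum_of_fintype] at this
  rw [← this]
  exact Equiv.sum_comp t.equivFin.symm fun p ↦ ρ p q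

/-- On a frame, `d(χ ρ_i η)` is the alternating sum of the derivatives of the components of `χ ρ_i
η` along the frame fields, and each summand is elementary. By the Leibniz rule the sum for fixed `i`
is `χ (ρ_i dη + dρ_i ∧ η)`, and the second terms cancel in the sum over `i` because `∑ ρ_i = 1`. The
factor `χ` confines the change to a part of `M`; having zero derivative, it passes through `d`. -/
theorem exists_sum_isElementary {n : ℕ} {M : Type*} [TopologicalSpace M]
    [ChartedSpace (EuclideanSpace ℝ (Fin (n + 1))) M] [IsManifold (𝓡 (n + 1)) ∞ M] {Z : Set M}
    [T2Space M] [CompactSpace M] (hZ : IsBManifold (n + 1) Z) {μ : BForm (n + 1) Z (n + 1)}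
    (hμ : μ.NowhereVanishing) {F : SmoothFun (n + 1) M} {η : BForm (n + 1) Z n}
    (hF : ∀ V, (F • μ) V = bDiff η V) {χ : SmoothFun (n + 1) M}
      (hχ : ∀ (V : VField (n + 1) M), V.deriv χ = 0)
    {S : Set M} (hS : ∀ q ∈ S, χ q = 0) :
    ∃ (κ : Type) (_ : Fintype κ) (G : κ → SmoothFun (n + 1) M),
      (∀ i, IsElementary μ S (G i)) ∧ ∑ i, G i = χ * F := by
  obtain ⟨N, c, ρ, hσ, hρU, -, hρ1⟩ := exists_bChart_partition (exists_bChart_sign hZ hμ)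
  let g : Fin N × Fin (n + 1) → SmoothFun (n + 1) M := fun p ↦
    (-1 : ℝ) ^ (p.2 : ℕ) • (χ * (ρ p.1 * η (p.2.removeNth (c p.1).frame)))
  have hgsupp : ∀ p, tsupport (g p) ⊆ tsupport (ρ p.1) := fun p ↦
    closure_mono fun q hq hq' ↦ hq (by
      change (-1 : ℝ) ^ (p.2 : ℕ) * (χ q * (ρ p.1 q * η _ q)) = 0
      rw [hq']
      simp)
  have hgU : ∀ p, tsupport (g p) ⊆ (c p.1).U := fun p ↦ (hgsupp p).trans (hρU p.1)
  choose G hG hG0 using fun p ↦ (c p.1).exists_isElementary hμ p.2 (hgU p)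
  choose R hR using fun i ↦ exists_eq_smul hZ hμ (dWedge (ρ i) η)
  have hRsum : ∑ i, R i = 0 := by
    apply eq_of_smul_eq_smul hμ
    rw [Finset.sum_smul, zero_smul]
    simp only [← hR]
    ext W q
    rw [BForm.sum_apply, SmoothFun.sum_apply]
    simp only [dWedge_apply]
    rw [Finset.sum_comm]
    refine Finset.sum_eq_zero fun i _ ↦ ?_
    rw [← Finset.mul_sum, ← Finset.sum_mul, ← SmoothFun.sum_apply, ← VField.deriv_sum,
      VField.deriv_const (r := 1) _ (fun q ↦ by rw [SmoothFun.sum_apply, hρ1])]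
    simp
  have hkey : ∀ i q, ∑ j, G (i, j) q = χ q * (ρ i q * F q + R i q) := by
    intro i q
    by_cases hq : q ∈ tsupport (ρ i)
    · have hqU := hρU i hq
      refine mul_right_cancel₀ ((c i).frame_ne_zero hμ hqU) ?_
      have h1 : F q * μ (c i).frame q = bDiff η (c i).frame q :=
        congrArg (fun f : SmoothFun (n + 1) M ↦ f q) (hF (c i).frame)
      have h2 : R i q * μ (c i).frame q = dWedge (ρ i) η (c i).frame q :=
        (congrArg (fun α : BForm (n + 1) Z (n + 1) ↦ α (c i).frame q) (hR i)).symm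
      rw [Finset.sum_mul]
      have h3 : ∀ j, G (i, j) q * μ (c i).frame q = χ q * ((-1 : ℝ) ^ (j : ℕ) *
          (ρ i q * ((c i).frame j).1.deriv (η (j.removeNth (c i).frame)) q +
            ((c i).frame j).1.deriv (ρ i) q * η (j.removeNth (c i).frame) q)) := by
        intro j
        rw [hG (i, j) q hqU]
        simp only [g]
        rw [VField.deriv_smul, VField.deriv_mul, VField.deriv_mul, hχ]
        change (-1 : ℝ) ^ (j : ℕ) * (χ q * (ρ i q * _ + _ * _) + _ * (0 : ℝ)) = _
        ring
      simp only [h3]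
      rw [mul_assoc, add_mul, mul_assoc, h1, h2, (c i).bDiff_frame η hqU,
        dWedge_apply, ← Finset.mul_sum]
      congr 1
      rw [Finset.mul_sum, ← Finset.sum_add_distrib]
      refine Finset.sum_congr rfl fun j _ ↦ ?_
      ring
    · have h1 : R i q = 0 := by
        obtain ⟨V, hV⟩ := hμ q
        have h2 : dWedge (ρ i) η V q = R i q * μ V q :=
          congrArg (fun α : BForm (n + 1) Z (n + 1) ↦ α V q) (hR i)
        rw [dWedge_apply] at h2
        simp only [VField.deriv_eq_zero_of_notMem_tsupport _ hq, zero_mul, mul_zero,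
          Finset.sum_const_zero] at h2
        exact (mul_eq_zero.1 h2.symm).resolve_right hV
      rw [h1, image_eq_zero_of_notMem_tsupport hq, zero_mul, zero_add, mul_zero]
      exact Finset.sum_eq_zero fun j _ ↦ hG0 _ q fun h ↦ hq (hgsupp _ h)
  refine ⟨Fin N × Fin (n + 1), inferInstance, G,
    fun p ↦ ⟨c p.1, p.2, g p, hσ _, hgU p, hG p, hG0 p, fun q hq ↦ ?_⟩, ?_⟩
  · change (-1 : ℝ) ^ (p.2 : ℕ) * (χ q * _) = 0
    rw [hS q hq]
    simp
  · ext q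
    rw [SmoothFun.sum_apply, Fintype.sum_prod_type]
    simp only [hkey]
    rw [← Finset.mul_sum, Finset.sum_add_distrib, ← Finset.sum_mul, hρ1, ← SmoothFun.sum_apply,
      hRsum, one_mul]
    exact congrArg (χ q * ·) (add_zero (F q))

end

/-! ### Realizing an elementary change by a b-diffeomorphism. -/

section

section TransplantDiffeo
variable {e : OpenPartialHomeomorph M (EuclideanSpace ℝ (Fin m))}
  {φ ψ : EuclideanSpace ℝ (Fin m) → EuclideanSpace ℝ (Fin m)} {K : Set M}

theorem contMDiff_transplant (he : e ∈ IsManifold.maximalAtlas (𝓡 m) ∞ M) (hK : K ⊆ e.source)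
    (hKc : IsClosed K) (hψφ : ∀ x, ψ (φ x) = x) (hφ : ∀ x ∉ e '' K, φ x = x)
    (hφs : ContDiff ℝ ∞ φ) : ContMDiff (𝓡 m) (𝓡 m) ∞ (transplant e φ) := by
  intro q
  by_cases hq : q ∈ e.source
  · have h := mem_target_of_fixed hK hψφ hφ (e.map_source hq)
    have h1 : ContMDiffAt (𝓡 m) (𝓡 m) ∞ (fun q ↦ e.symm (φ (e q))) q :=
      (contMDiffAt_symm_of_mem_maximalAtlas he h).comp q
        (hφs.contMDiff.contMDiffAt.comp q (contMDiffAt_of_mem_maximalAtlas he hq))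
    refine h1.congr_of_eventuallyEq ?_
    filter_upwards [e.open_source.mem_nhds hq] with p hp
    exact transplant_of_mem e φ hp
  · refine contMDiffAt_id.congr_of_eventuallyEq ?_
    filter_upwards [hKc.isOpen_compl.mem_nhds fun h ↦ hq (hK h)] with p hp
    exact transplant_eq_self hK hφ hp

/-- The diffeomorphism of `M` that is given in a chart by a diffeomorphism of the model space with
support in the image of `K`. -/
def transplantDiffeo (he : e ∈ IsManifold.maximalAtlas (𝓡 m) ∞ M) (hK : K ⊆ e.source)
    (hKc : IsClosed K) (hψφ : ∀ x, ψ (φ x) = x) (hφψ : ∀ x, φ (ψ x) = x)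
    (hφ : ∀ x ∉ e '' K, φ x = x) (hφs : ContDiff ℝ ∞ φ) (hψs : ContDiff ℝ ∞ ψ) :
    M ≃ₘ⟮𝓡 m, 𝓡 m⟯ M :=
  have hψ : ∀ x ∉ e '' K, ψ x = x := fun x hx ↦ by
    have := hψφ x
    rwa [hφ x hx] at this
  { toFun := transplant e φ
    invFun := transplant e ψ
    left_inv := transplant_transplant hK hψφ hφ
    right_inv := transplant_transplant hK hφψ hψ
    contMDiff_toFun := contMDiff_transplant he hK hKc hψφ hφ hφs
    contMDiff_invFun := contMDiff_transplant he hK hKc hφψ hψ hψs }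

end TransplantDiffeo

namespace BChart
variable (c d : BChart m Z)

/-- The expression of a map in two charts. -/
def transition (φ : M → M) : 𝔼 → 𝔼 := fun x ↦ d.e (φ (c.e.symm x))

theorem contDiffAt_transition {φ : M → M} (hφ : ContMDiff (𝓡 m) (𝓡 m) ∞ φ) {q : M}
    (hq : q ∈ c.e.source) (hφq : φ q ∈ d.e.source) : ContDiffAt ℝ ∞ (c.transition d φ) (c.e q) := by
  have h1 : ContMDiffAt (𝓡 m) (𝓡 m) ∞ (c.transition d φ) (c.e q) := by
    refine ContMDiffAt.comp (c.e q) (f := fun x ↦ φ (c.e.symm x)) (I' := 𝓡 m)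
      (contMDiffAt_of_mem_maximalAtlas d.mem ?_) ?_
    · rwa [c.e.left_inv hq]
    · exact (hφ _).comp _ (contMDiffAt_symm_of_mem_maximalAtlas c.mem (c.e.map_source hq))
  exact h1.contDiffAt

/-- This is the chain rule. The rows of `derivMatrix` are the vectors, so the Jacobian matrix
multiplies from the right, transposed. -/
theorem det_derivMatrix_push (φ : M ≃ₘ⟮𝓡 m, 𝓡 m⟯ M) (W : Fin m → VField m M) {q : M}
    (hq : q ∈ c.U) (hφq : φ q ∈ d.U) :
    (d.derivMatrix (fun i ↦ (W i).push φ) (φ q)).det =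
      (c.derivMatrix W q).det * (fderiv ℝ (c.transition d φ) (c.e q)).det := by
  set T := c.transition d φ with hT
  set L := fderiv ℝ T (c.e q) with hL
  have hTd : DifferentiableAt ℝ T (c.e q) :=
    (c.contDiffAt_transition d φ.contMDiff (c.U_subset hq) (d.U_subset hφq)).differentiableAt
      (by simp)
  let b := (EuclideanSpace.basisFun (Fin m) ℝ).toBasis
  have hdet : L.det = (LinearMap.toMatrix b b (L : 𝔼 →ₗ[ℝ] 𝔼)).transpose.det := by
    rw [Matrix.det_transpose, LinearMap.det_toMatrix]
  rw [hdet, ← Matrix.det_mul]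
  congr 1
  ext i l
  rw [Matrix.mul_apply]
  change ((W i).push φ).deriv (d.coord l) (φ q) = ∑ a, (W i).deriv (c.coord a) q * _
  rw [VField.push_deriv, φ.symm_apply_apply]
  let h : SmoothFun m M := (d.coord l).comp ⟨φ, φ.contMDiff⟩
  change mvfderiv (𝓡 m) h q (W i q) = _
  rw [mvfderiv_eq_fderiv_chart c.mem (c.U_subset hq) (h.contMDiff.mdifferentiable (by simp) q)]
  have hev : (h ∘ c.e.symm) =ᶠ[𝓝 (c.e q)] fun x ↦ (EuclideanSpace.proj l : 𝔼 →L[ℝ] ℝ) (T x) := by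
    have h1 : ContinuousAt (fun x ↦ φ (c.e.symm x)) (c.e q) :=
      φ.contMDiff.continuous.continuousAt.comp
        (c.e.continuousAt_symm (c.e.map_source (c.U_subset hq)))
    have h2 := h1.eventually (by
      simp only [c.e.left_inv (c.U_subset hq)]; exact d.isOpen.mem_nhds hφq)
    filter_upwards [h2] with x hx
    exact d.coord_apply l hx
  have h3 := ((EuclideanSpace.proj l : 𝔼 →L[ℝ] ℝ).hasFDerivAt.comp (c.e q) hTd.hasFDerivAt).fderiv
  rw [hev.fderiv_eq]
  set w : 𝔼 := mfderiv (𝓡 m) (𝓡 m) c.e q (W i q) with hw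
  have hwa : ∀ a, (W i).deriv (c.coord a) q = w a := fun a ↦
    (c.mfderiv_apply_eq_deriv_coord (W i) a hq).symm
  have hwsum : w = ∑ a, w a • b a := by
    conv_lhs => rw [← b.sum_repr w]
    rfl
  have h4 : fderiv ℝ (fun x ↦ (EuclideanSpace.proj l : 𝔼 →L[ℝ] ℝ) (T x)) (c.e q) w = (L w) l := by
    have := congrArg (fun A : 𝔼 →L[ℝ] ℝ ↦ A w) h3
    exact this
  refine h4.trans ?_
  simp only [hwa, Matrix.transpose_apply, LinearMap.toMatrix_apply]
  conv_lhs => rw [hwsum, map_sum]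
  simp [b]

theorem scaleProd_mul_pull [T2Space M] [CompactSpace M] (φ : BDiffeo m Z) (α : BForm m Z m)
    (W : Fin m → bFields m Z) {q : M} (hq : q ∈ c.U) (hφq : φ.toDiffeo q ∈ d.U) :
    scaleProd d.o (d.e (φ.toDiffeo q)) * φ.pull α W q =
      (c.derivMatrix (fun i ↦ (W i).1) q).det *
        (fderiv ℝ (c.transition d φ.toDiffeo) (c.e q)).det * α d.frame (φ.toDiffeo q) := by
  rw [← c.det_derivMatrix_push d φ.toDiffeo _ hq hφq]
  exact d.scaleProd_mul_apply α (fun i ↦ bPush φ.toDiffeo φ.preimage_eq (W i)) hφq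

end BChart

variable [T2Space M] [CompactSpace M]

/-- Near `q` the pushed fields coincide with the original ones, and the value of `α` depends only on
germs. -/
theorem BDiffeo.pull_apply_of_eventuallyEq_id (hZ : IsBManifold m Z) (φ : BDiffeo m Z) {k : ℕ}
    (α : BForm m Z k)
    (W : Fin k → bFields m Z) {q : M} (h : ∀ᶠ p in 𝓝 q, φ.toDiffeo p = p) :
    φ.pull α W q = α W q := by
  have hq : φ.toDiffeo q = q := h.self_of_nhds
  change α (fun i ↦ bPush φ.toDiffeo φ.preimage_eq (W i)) (φ.toDiffeo q) = _
  rw [hq]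
  refine α.congr_of_eventuallyEq fun i ↦ ?_
  filter_upwards [h.eventually_nhds] with p hp
  obtain ⟨c, hc⟩ := exists_bChart hZ p
  refine c.eq_of_deriv_coord_eq hc fun j ↦ ?_
  have hp' : φ.toDiffeo p = p := hp.self_of_nhds
  have hps : φ.toDiffeo.symm p = p := by
    conv_lhs => rw [← hp']
    exact φ.toDiffeo.symm_apply_apply p
  change ((W i).1.push φ.toDiffeo).deriv (c.coord j) p = _
  rw [VField.push_deriv, hps]
  refine VField.deriv_congr _ ?_
  filter_upwards [hp] with x hx
  exact congrArg (c.coord j) hx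

theorem exists_pos_le_of_isCompact {K : Set M} (hK : IsCompact K) {f : M → ℝ}
    (hf : ContinuousOn f K)
    (h : ∀ q ∈ K, 0 < f q) : ∃ r : ℝ, 0 < r ∧ ∀ q ∈ K, r ≤ f q := by
  exact hK.exists_forall_le' hf h

/-- An elementary change of a volume form is realized by a b-diffeomorphism. -/
theorem IsElementary.exists_bDiffeo (hZ : IsBManifold m Z) {μ : BForm m Z m} {S : Set M}
    {G : SmoothFun m M} (hG : IsElementary μ S G)
    {f f' : SmoothFun m M} (hf : ∀ q, 0 < f q) (hf' : ∀ q, 0 < f' q) {t : ℝ}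
    (hff' : ∀ q, f' q = f q + t * G q) :
    ∃ φ : BDiffeo m Z, φ.pull (f' • μ) = f • μ ∧ ∀ q ∈ S, φ.toDiffeo q = q := by
  obtain ⟨c, j, g, ⟨σ, hσ⟩, hgU, hGg, hG0, hgS⟩ := hG
  set K := tsupport g with hK
  have hKc : IsClosed K := isClosed_tsupport g
  have hKs : K ⊆ c.e.source := hgU.trans c.U_subset
  obtain ⟨χ, hχU, ⟨O, hO, hKO, hO1⟩, hχ01⟩ := exists_smoothFun_one_nhds (m := m) hKc c.isOpen hgU
  -- The factor `σ` makes the coefficient of `μ` positive on `U`, whatever the orientation of the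
  -- chart.
  let v : SmoothFun m M := σ • μ c.frame
  have hv : ∀ q ∈ c.U, 0 < v q := hσ
  let h : SmoothFun m M := (σ * t) • g
  have hVh : ∀ q ∈ c.U, (c.frame j).1.deriv h q = (f' q - f q) * v q := by
    intro q hq
    have h1 : (c.frame j).1.deriv h q = σ * t * (c.frame j).1.deriv g q :=
      congrArg (fun F : SmoothFun m M ↦ F q) (VField.deriv_smul _ (σ * t) g)
    rw [h1, ← hGg q hq, hff']
    change _ = _ * (σ * _)
    ring
  have hsupp_h : tsupport h ⊆ K := closure_mono fun q hq hq' ↦ hq (by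
    change σ * t * g q = 0
    rw [hq', mul_zero])
  -- `1 + B` interpolates between `f v` near `K` and `1` outside the support of `χ`. It remains
  -- positive, and so gives a density on the whole model space.
  let B : SmoothFun m M := χ * (f * v - 1)
  have hsupp_B : tsupport B ⊆ c.e.source := by
    rw [ContMDiffMap.coe_mul]
    exact tsupport_mul_subset_left.trans (hχU.trans c.U_subset)
  have hBq : ∀ q, 1 + B q = χ q * (f q * v q) + (1 - χ q) := fun q ↦ by
    change 1 + χ q * (f q * v q - 1) = _
    ring
  have hBK : ∀ q ∈ K, 1 + B q = f q * v q := fun q hq ↦ by rw [hBq, hO1 q (hKO hq)]; ring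
  have hBpos : ∀ q, 0 < 1 + B q := by
    intro q
    rw [hBq]
    have h01 := hχ01 q
    by_cases hq : q ∈ c.U
    · have h2 := mul_pos (hf q) (hv q hq)
      rcases h01.1.eq_or_lt with h3 | h3
      · rw [← h3]; norm_num
      · have := mul_pos h3 h2
        linarith [h01.2]
    · rw [image_eq_zero_of_notMem_tsupport fun hq' ↦ hq (hχU hq')]
      norm_num
  let a : 𝔼 → ℝ := fun x ↦ 1 + descend c.e B x
  let gE : 𝔼 → ℝ := descend c.e h
  have ha : ContDiff ℝ ∞ a := contDiff_const.add (contDiff_descend c.mem B.contMDiff hsupp_B)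
  have hgE : ContDiff ℝ ∞ gE := contDiff_descend c.mem h.contMDiff (hsupp_h.trans hKs)
  obtain ⟨r1, hr1, hr1B⟩ := exists_pos_le_of_isCompact (isCompact_univ (X := M))
    (f := fun q ↦ 1 + B q) (by have := B.contMDiff.continuous; fun_prop) fun q _ ↦ hBpos q
  obtain ⟨r2, hr2, hr2B⟩ := exists_pos_le_of_isCompact hKc.isCompact
    (f := fun q ↦ f' q * v q)
    (f'.contMDiff.continuous.mul v.contMDiff.continuous).continuousOn
    fun q hq ↦ mul_pos (hf' q) (hv q (hgU hq))
  -- A common lower bound: `r1` for the old density in the chart, `1` for it outside the target,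
  -- `r2` for the new density on the image of `K`. Off that image the two densities agree.
  set r := min (min r1 1) r2 with hr
  have hr0 : 0 < r := lt_min (lt_min hr1 one_pos) hr2
  have hra : ∀ x, r ≤ a x := by
    intro x
    by_cases hx : x ∈ c.e.target
    · change r ≤ 1 + descend c.e B x
      rw [descend_eq_of_mem _ _ hx]
      exact ((min_le_left _ _).trans (min_le_left _ _)).trans (hr1B _ (mem_univ _))
    · change r ≤ 1 + descend c.e B x
      rw [descend, indicator_of_notMem hx, add_zero]
      exact (min_le_left _ _).trans (min_le_right _ _)
  have hgEdesc : ∀ q ∈ K, a (c.e q) + scaleCoeff c.o j (c.e q) * fderiv ℝ gE (c.e q)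
    (EuclideanSpace.single j 1) =
      f' q * v q := by
    intro q hq
    have hev : gE =ᶠ[𝓝 (c.e q)] h ∘ c.e.symm := by
      filter_upwards [c.e.open_target.mem_nhds (c.e.map_source (hKs hq))] with y hy
      exact descend_eq_of_mem _ _ hy
    rw [hev.fderiv_eq, ← c.deriv_frame j h (hgU hq), hVh q (hgU hq)]
    change 1 + descend c.e B (c.e q) + _ = _
    rw [descend_apply _ _ (hKs hq), hBK q hq]
    ring
  have hgE0 : ∀ x ∉ c.e '' K, gE x = 0 := by
    intro x hx
    by_cases hxt : x ∈ c.e.target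
    · change descend c.e h x = 0
      rw [descend_eq_of_mem _ _ hxt]
      exact image_eq_zero_of_notMem_tsupport fun h' ↦ hx ⟨_, hsupp_h h', c.e.right_inv hxt⟩
    · exact indicator_of_notMem hxt _
  have hra' : ∀ x, r ≤ a x + scaleCoeff c.o j x * fderiv ℝ gE x (EuclideanSpace.single j 1) := by
    intro x
    by_cases hx : x ∈ c.e '' K
    · obtain ⟨q, hq, rfl⟩ := hx
      rw [hgEdesc q hq]
      exact (min_le_right _ _).trans (hr2B q hq)
    · have hKE : IsClosed (c.e '' K) :=
        (hKc.isCompact.image_of_continuousOn (c.e.continuousOn.mono hKs)).isClosed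
      have hev : gE =ᶠ[𝓝 x] fun _ ↦ 0 := by
        filter_upwards [hKE.isOpen_compl.mem_nhds hx] with y hy
        exact hgE0 y hy
      rw [hev.fderiv_eq]
      simpa using hra x
  obtain ⟨φ, ψ, hφs, hψs, hψφ, hφψ, hφg, hφZ, hφdet⟩ :=
    exists_transport_density c.o j ha hgE hr0 hra hra'
  have hφK : ∀ x ∉ c.e '' K, φ x = x := fun x hx ↦ hφg x (hgE0 x hx)
  let Φ := transplantDiffeo c.mem hKs hKc hψφ hφψ hφK hφs hψs
  have hΦs : ∀ q ∈ c.e.source, Φ q = c.e.symm (φ (c.e q)) := fun q hq ↦ transplant_of_mem _ _ hq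
  have hΦn : ∀ q ∉ c.e.source, Φ q = q := fun q hq ↦ transplant_of_notMem _ _ hq
  have hΦK : ∀ q ∉ K, Φ q = q := fun q hq ↦ transplant_eq_self hKs hφK hq
  have hφt : ∀ q ∈ c.e.source, φ (c.e q) ∈ c.e.target := fun q hq ↦
    mem_target_of_fixed hKs hψφ hφK (c.e.map_source hq)
  have hΦZ : Φ ⁻¹' Z = Z := by
    ext q
    rw [mem_preimage]
    by_cases hq : q ∈ c.e.source
    · rw [hΦs q hq, c.mem_iff _ (c.e.map_target (hφt q hq)), c.e.right_inv (hφt q hq), hφZ,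
        c.mem_iff q hq]
    · rw [hΦn q hq]
  refine ⟨⟨Φ, hΦZ⟩, ?_, fun q hq ↦ ?_⟩
  · ext W : 1
    -- By density it suffices to argue off `Z`, where the factors `scaleProd` can be cancelled.
    refine SmoothFun.ext_compl hZ fun q hqZ ↦ ?_
    by_cases hq : q ∈ K
    · have hqs := hKs hq
      obtain ⟨p, hp, hpq⟩ := mapsTo_image_of_fixed hψφ hφK (mem_image_of_mem c.e hq)
      have hΦq : Φ q = p := by rw [hΦs q hqs, ← hpq, c.e.left_inv (hKs hp)]
      have e1 := c.scaleProd_mul_pull c ⟨Φ, hΦZ⟩ (f' • μ) W (hgU hq) (by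
        change Φ q ∈ c.U
        rw [hΦq]
        exact hgU hp)
      change scaleProd c.o (c.e (Φ q)) * _ = _ * (fderiv ℝ (c.transition c Φ) (c.e q)).det *
        (f' (Φ q) * μ c.frame (Φ q)) at e1
      have hT : c.transition c Φ =ᶠ[𝓝 (c.e q)] φ := by
        filter_upwards [c.e.open_target.mem_nhds (c.e.map_source hqs)] with x hx
        have h1 := hφt _ (c.e.map_target hx)
        rw [BChart.transition, hΦs _ (c.e.map_target hx), c.e.right_inv h1, c.e.right_inv hx]
      rw [hΦq, hpq, hT.fderiv_eq] at e1
      have e2 := c.scaleProd_mul_apply μ W (hgU hq)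
      have e3 := hφdet (c.e q)
      rw [← hpq, hgEdesc p hp, hpq] at e3
      have e4 : a (c.e q) = f q * v q := by
        change 1 + descend c.e B (c.e q) = _
        rw [descend_apply _ _ hqs, hBK q hq]
      rw [e4] at e3
      have hσ0 : σ ≠ 0 := left_ne_zero_of_mul (hσ q (hgU hq)).ne'
      have hv' : ∀ q, v q = σ * μ c.frame q := fun q ↦ rfl
      rw [hv', hv'] at e3
      have n1 : scaleProd c.o (c.e q) ≠ 0 := c.scaleProd_ne_zero hqs hqZ
      have n2 : scaleProd c.o (φ (c.e q)) ≠ 0 := fun h ↦ n1 ((hφZ _).1 h)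
      change _ = f q * μ W q
      refine mul_left_cancel₀ n1 (mul_left_cancel₀ n2 (mul_left_cancel₀ hσ0 ?_))
      -- `e1` expresses the pull-back through the Jacobian, `e3` is the transport equation for the
      -- densities, and `e2` expresses `μ` in the chart.
      linear_combination (σ * scaleProd c.o (c.e q)) * e1 +
        (c.derivMatrix (fun i ↦ (W i).1) q).det * e3 -
        f q * σ * scaleProd c.o (φ (c.e q)) * e2
    · rw [BDiffeo.pull_apply_of_eventuallyEq_id hZ]
      · change f' q * _ = f q * _
        rw [hff', hG0 q hq, mul_zero, add_zero]
      · filter_upwards [hKc.isOpen_compl.mem_nhds hq] with p hp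
        exact hΦK p hp
  · change Φ q = q
    by_cases hqs : q ∈ c.e.source
    · rw [hΦs q hqs, hφg, c.e.left_inv hqs]
      change descend c.e h (c.e q) = 0
      rw [descend_apply _ _ hqs]
      change σ * t * g q = 0
      rw [hgS q hq, mul_zero]
    · exact hΦn q hqs

end

/-! ### Composing elementary changes along a segment. -/

section

variable [T2Space M] [CompactSpace M]

theorem VField.ext_deriv (hZ : IsBManifold m Z) {V W : VField m M}
    (h : ∀ f q, V.deriv f q = W.deriv f q) : V = W := by
  ext q
  obtain ⟨c, hc⟩ := exists_bChart hZ q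
  exact c.eq_of_deriv_coord_eq hc fun j ↦ h _ q

theorem exists_pos_le (f : SmoothFun m M) (hf : ∀ q, 0 < f q) : ∃ r : ℝ, 0 < r ∧ ∀ q, r ≤ f q := by
  obtain ⟨r, hr, h⟩ := exists_pos_le_of_isCompact (isCompact_univ (X := M))
    f.contMDiff.continuous.continuousOn fun q _ ↦ hf q
  exact ⟨r, hr, fun q ↦ h q (mem_univ q)⟩

theorem exists_abs_le (f : SmoothFun m M) : ∃ r : ℝ, 0 < r ∧ ∀ q, |f q| ≤ r := by
  obtain ⟨C, hC⟩ := (isCompact_univ (X := M)).exists_bound_of_continuousOn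
    f.contMDiff.continuous.continuousOn
  exact ⟨max C 1, lt_max_of_lt_right one_pos, fun q ↦ (hC q (mem_univ q)).trans (le_max_left _ _)⟩

/-- The composition of b-diffeomorphisms. -/
def BDiffeo.trans (φ ψ : BDiffeo m Z) : BDiffeo m Z :=
  ⟨φ.toDiffeo.trans ψ.toDiffeo, by
    change φ.toDiffeo ⁻¹' (ψ.toDiffeo ⁻¹' Z) = Z
    rw [ψ.preimage_eq, φ.preimage_eq]⟩

theorem BDiffeo.pull_trans (hZ : IsBManifold m Z) (φ ψ : BDiffeo m Z) {k : ℕ} (α : BForm m Z k) :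
    (φ.trans ψ).pull α = φ.pull (ψ.pull α) := by
  have h : ∀ V : bFields m Z, bPush (φ.trans ψ).toDiffeo (φ.trans ψ).preimage_eq V =
      bPush ψ.toDiffeo ψ.preimage_eq (bPush φ.toDiffeo φ.preimage_eq V) := by
    intro V
    refine Subtype.ext (VField.ext_deriv hZ fun f q ↦ ?_)
    change (V.1.push (φ.toDiffeo.trans ψ.toDiffeo)).deriv f q =
      ((V.1.push φ.toDiffeo).push ψ.toDiffeo).deriv f q
    rw [VField.push_deriv, VField.push_deriv, VField.push_deriv]
    rfl
  ext W q
  change α (fun i ↦ bPush (φ.trans ψ).toDiffeo (φ.trans ψ).preimage_eq (W i)) _ =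
    α (fun i ↦ bPush ψ.toDiffeo ψ.preimage_eq (bPush φ.toDiffeo φ.preimage_eq (W i))) _
  simp only [h]
  rfl

/-- The volume forms `f μ` and `f' μ` correspond to each other under a b-diffeomorphism that fixes
all points of `S`. -/
def Isotopic (μ : BForm m Z m) (S : Set M) (f f' : SmoothFun m M) : Prop :=
  ∃ φ : BDiffeo m Z, φ.pull (f' • μ) = f • μ ∧ ∀ q ∈ S, φ.toDiffeo q = q

theorem Isotopic.refl (hZ : IsBManifold m Z) (μ : BForm m Z m) (S : Set M)
    (f : SmoothFun m M) : Isotopic μ S f f := by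
  refine ⟨⟨Diffeomorph.refl (𝓡 m) M ∞, rfl⟩, ?_, fun q _ ↦ rfl⟩
  ext W q
  exact BDiffeo.pull_apply_of_eventuallyEq_id hZ _ _ _ (Eventually.of_forall fun _ ↦ rfl)

theorem Isotopic.trans (hZ : IsBManifold m Z) {μ : BForm m Z m} {S : Set M}
    {f f' f'' : SmoothFun m M} (h : Isotopic μ S f f') (h' : Isotopic μ S f' f'') :
    Isotopic μ S f f'' := by
  obtain ⟨φ, h1, h2⟩ := h
  obtain ⟨ψ, h3, h4⟩ := h'
  refine ⟨φ.trans ψ, by rw [BDiffeo.pull_trans hZ, h3, h1], fun q hq ↦ ?_⟩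
  change ψ.toDiffeo (φ.toDiffeo q) = q
  rw [h2 q hq, h4 q hq]

/-- One summand lowers the density by at most `r / 2`, and the others are treated with the bound `r
/ 2`. It is essential that `ε` depends on the lower bound only and not on `f`. -/
theorem isotopic_add_small (hZ : IsBManifold m Z) {μ : BForm m Z m} {S : Set M} {κ : Type*}
    (s : Finset κ) {G : κ → SmoothFun m M} (hG : ∀ i, IsElementary μ S (G i)) :
    ∀ r : ℝ, 0 < r → ∃ ε : ℝ, 0 < ε ∧ ∀ f : SmoothFun m M, (∀ q, r ≤ f q) → ∀ t : ℝ, |t| ≤ ε →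
      Isotopic μ S f (f + t • ∑ i ∈ s, G i) := by
  induction s using Finset.cons_induction with
  | empty =>
    refine fun r _ ↦ ⟨1, one_pos, fun f _ t _ ↦ ?_⟩
    rw [Finset.sum_empty, smul_zero, add_zero]
    exact Isotopic.refl hZ μ S f
  | cons a s ha ih =>
    intro r hr
    obtain ⟨ε, hε, h⟩ := ih (r / 2) (by positivity)
    obtain ⟨C, hC, hCG⟩ := exists_abs_le (G a)
    refine ⟨min ε (r / (2 * C)), lt_min hε (by positivity), fun f hf t ht ↦ ?_⟩
    have hb : ∀ q, r / 2 ≤ (f + t • G a) q := by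
      intro q
      change _ ≤ f q + t * G a q
      have h1 : |t * G a q| ≤ r / 2 := by
        rw [abs_mul]
        calc |t| * |G a q| ≤ r / (2 * C) * C :=
              mul_le_mul (ht.trans (min_le_right _ _)) (hCG q) (abs_nonneg _) (by positivity)
          _ = r / 2 := by field_simp
      linarith [neg_abs_le (t * G a q), hf q]
    rw [Finset.sum_cons, smul_add, ← add_assoc]
    refine Isotopic.trans hZ ?_ (h _ hb t (ht.trans (min_le_left _ _)))
    exact (hG a).exists_bDiffeo hZ (fun q ↦ hr.trans_le (hf q))
      (fun q ↦ (half_pos hr).trans_le (hb q)) (t := t) fun q ↦ rfl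

theorem isotopic_add (hZ : IsBManifold m Z) {μ : BForm m Z m} {S : Set M} {κ : Type*} [Fintype κ]
    {G : κ → SmoothFun m M} (hG : ∀ i, IsElementary μ S (G i)) {f : SmoothFun m M}
    (hf : ∀ q, 0 < f q) (hf' : ∀ q, 0 < (f + ∑ i, G i) q) : Isotopic μ S f (f + ∑ i, G i) := by
  set F := ∑ i, G i
  obtain ⟨r₁, hr₁, h₁⟩ := exists_pos_le f hf
  obtain ⟨r₂, hr₂, h₂⟩ := exists_pos_le _ hf'
  -- Every function on the segment from `f` to `f + F` is a convex combination of the ends, so it is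
  -- at least `min r₁ r₂` and one `ε` serves for all steps.
  obtain ⟨ε, hε, h⟩ := isotopic_add_small hZ Finset.univ hG (min r₁ r₂) (lt_min hr₁ hr₂)
  obtain ⟨N, hN⟩ := exists_nat_one_div_lt hε
  have hN0 : (0 : ℝ) < N + 1 := by positivity
  have key : ∀ k : ℕ, k ≤ N + 1 → Isotopic μ S f (f + ((k : ℝ) / (N + 1)) • F) := by
    intro k
    induction k with
    | zero =>
      intro _
      simpa using Isotopic.refl hZ μ S f
    | succ k ih =>
      intro hk
      refine (ih (by omega)).trans hZ ?_
      have e1 : f + (((k + 1 : ℕ) : ℝ) / (N + 1)) • F =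
          (f + ((k : ℝ) / (N + 1)) • F) + (1 / ((N : ℝ) + 1)) • F := by
        rw [add_assoc, ← add_smul]
        congr 2
        push_cast
        ring
      rw [e1]
      refine h _ (fun q ↦ ?_) _ (by rw [abs_of_pos (by positivity)]; exact hN.le)
      change _ ≤ f q + (k : ℝ) / (N + 1) * F q
      have h3 : r₂ ≤ f q + F q := h₂ q
      have hs : (k : ℝ) / (N + 1) ≤ 1 := by
        rw [div_le_one hN0]
        exact_mod_cast (by omega : k ≤ N + 1)
      have hs0 : 0 ≤ (k : ℝ) / (N + 1) := by positivity
      have h4 := h₁ q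
      have h5 := min_le_left r₁ r₂
      have h6 := min_le_right r₁ r₂
      nlinarith
  have := key (N + 1) le_rfl
  push_cast at this
  rwa [div_self hN0.ne', one_smul] at this

end

/-! ### Integrals of powers of b-densities. -/

section

theorem lintegral_Icc_abs_rpow_neg_lt_top {r : ℝ} (hr : r < 1) (R : ℝ) :
    ∫⁻ t in Icc (-R) R, ENNReal.ofReal (|t| ^ (-r)) < ⊤ := by
  have h1 : ∀ R : ℝ, ∫⁻ t in Icc 0 R, ENNReal.ofReal (|t| ^ (-r)) < ⊤ := by
    intro R
    rcases lt_or_ge R 0 with hR | hR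
    · simp [Icc_eq_empty (not_le.2 hR)]
    have h := (intervalIntegrable_iff_integrableOn_Icc_of_le hR).1
      (intervalIntegral.intervalIntegrable_rpow' (a := 0) (b := R) (r := -r) (by linarith))
    rw [setLIntegral_congr_fun measurableSet_Icc (g := fun t ↦ ENNReal.ofReal (t ^ (-r)))
      fun t ht ↦ by simp only [abs_of_nonneg ht.1]]
    exact h.lintegral_lt_top
  have h2 : ∫⁻ t in Icc (-R) 0, ENNReal.ofReal (|t| ^ (-r)) < ⊤ := by
    have h3 := (Measure.measurePreserving_neg (volume : Measure ℝ)).setLIntegral_comp_preimage_emb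
      (MeasurableEquiv.neg ℝ).measurableEmbedding (fun t ↦ ENNReal.ofReal (|t| ^ (-r))) (Icc (-R) 0)
    rw [← h3]
    convert h1 R using 3 <;> simp
  refine lt_of_le_of_lt (lintegral_mono_set (t := Icc (-R) 0 ∪ Icc 0 R) fun t ht ↦ ?_)
    ((lintegral_union_le _ _ _).trans_lt (ENNReal.add_lt_top.2 ⟨h2, h1 R⟩))
  rcases le_total t 0 with h | h
  · exact Or.inl ⟨ht.1, h⟩
  · exact Or.inr ⟨h, ht.2⟩

/-- A simple pole to a power `r < 1` is integrable. On a box containing `K` the integrand depends on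
one coordinate, which reduces this to dimension one. -/
theorem lintegral_abs_scaleProd_rpow_neg_lt_top {r : ℝ} (hr : r < 1) (o : Option (Fin m))
    {K : Set 𝔼}
    (hK : IsCompact K) : ∫⁻ x in K, ENNReal.ofReal (|scaleProd o x| ^ (-r)) < ⊤ := by
  cases o with
  | none => simpa [scaleProd_none] using hK.measure_lt_top
  | some k =>
    obtain ⟨R, hR⟩ := hK.isBounded.exists_norm_le
    let B : Set (Fin m → ℝ) := univ.pi fun _ ↦ Icc (-R) R
    have hB : MeasurableSet B := MeasurableSet.univ_pi fun _ ↦ measurableSet_Icc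
    have hKB : K ⊆ (WithLp.ofLp : 𝔼 → (Fin m → ℝ)) ⁻¹' B := fun x hx i _ ↦
      abs_le.1 ((PiLp.norm_apply_le x i).trans (hR x hx))
    refine lt_of_le_of_lt (lintegral_mono_set hKB) ?_
    let f : (Fin m → ℝ) → ENNReal := fun y ↦ ENNReal.ofReal (|y k| ^ (-r))
    have h1 := (EuclideanSpace.volume_preserving_symm_measurableEquiv_toLp
      (Fin m)).setLIntegral_comp_preimage_emb
      (MeasurableEquiv.toLp 2 (Fin m → ℝ)).symm.measurableEmbedding f B
    have h2 : ∫⁻ x in (WithLp.ofLp : 𝔼 → (Fin m → ℝ)) ⁻¹' B,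
        ENNReal.ofReal (|scaleProd (some k) x| ^ (-r)) = ∫⁻ y in B, f y := by
      rw [← h1]
      simp only [scaleProd_some]
      rfl
    rw [h2, volume_pi, Measure.restrict_pi_pi]
    have hg : Measurable fun t : ℝ ↦ ENNReal.ofReal (|t| ^ (-r)) := by fun_prop
    have h3 := lintegral_map (μ := Measure.pi fun _ : Fin m ↦ (volume : Measure ℝ).restrict
      (Icc (-R) R))
      hg (measurable_pi_apply k)
    have h4 : ∫⁻ y, f y ∂(Measure.pi fun _ : Fin m ↦ (volume : Measure ℝ).restrict (Icc (-R) R)) =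
      ∫⁻ t, ENNReal.ofReal (|t| ^ (-r)) ∂((Measure.pi fun _ : Fin m ↦
        (volume : Measure ℝ).restrict (Icc (-R) R)).map (Function.eval k)) := h3.symm
    rw [h4, Measure.pi_map_eval, lintegral_smul_measure]
    refine ENNReal.mul_lt_top ?_ (lintegral_Icc_abs_rpow_neg_lt_top hr R)
    refine ENNReal.prod_lt_top fun i _ ↦ ?_
    simp

namespace BChart
variable (c d : BChart m Z)

/-- The coefficient of a b-top-form, as a density on `M \ Z`, in an adapted chart. -/
def density (ν : BForm m Z m) (q : M) : ℝ := |ν c.frame q / scaleProd c.o (c.e q)|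

theorem density_nonneg (ν : BForm m Z m) (q : M) : 0 ≤ c.density ν q := abs_nonneg _

/-- The integral of a function over the domain of a chart. -/
def lint (g : M → ENNReal) : ENNReal := ∫⁻ x in c.e '' c.U, g (c.e.symm x)

theorem isOpen_image : IsOpen (c.e '' c.U) := c.e.isOpen_image_of_subset_source c.isOpen c.U_subset

theorem continuousOn_comp_symm {h : M → ℝ} (hh : Continuous h) :
    ContinuousOn (h ∘ c.e.symm) (c.e '' c.U) :=
  hh.comp_continuousOn (c.e.continuousOn_symm.mono
    ((image_mono c.U_subset).trans c.e.image_source_eq_target.subset))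

theorem aemeasurable_comp_symm {h : M → ℝ} (hh : Continuous h) :
    AEMeasurable (h ∘ c.e.symm) (volume.restrict (c.e '' c.U)) :=
  (c.continuousOn_comp_symm hh).aemeasurable c.isOpen_image.measurableSet

theorem aemeasurable_density (ν : BForm m Z m) :
    AEMeasurable (c.density ν ∘ c.e.symm) (volume.restrict (c.e '' c.U)) := by
  have h1 : AEMeasurable (fun x ↦ |(ν c.frame ∘ c.e.symm) x / scaleProd c.o x|)
      (volume.restrict (c.e '' c.U)) :=
    (c.aemeasurable_comp_symm (ν c.frame).contMDiff.continuous |>.div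
      (contDiff_scaleProd c.o).continuous.measurable.aemeasurable).abs
  refine h1.congr ?_
  filter_upwards [ae_restrict_mem c.isOpen_image.measurableSet] with x hx
  obtain ⟨q, hq, rfl⟩ := hx
  simp [density, c.e.left_inv (c.U_subset hq)]

/-- The integral of the `r`-density `h ν ^ r`. -/
def powInt (ν : BForm m Z m) (r : ℝ) (h : M → ℝ) : ENNReal :=
  c.lint fun q ↦ ENNReal.ofReal (h q * c.density ν q ^ r)

theorem powInt_sum {ι : Type*} (s : Finset ι) (ν : BForm m Z m) (r : ℝ) {h : ι → M → ℝ}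
    (hc : ∀ i, Continuous (h i)) (h0 : ∀ i q, 0 ≤ h i q) :
    c.powInt ν r (fun q ↦ ∑ i ∈ s, h i q) = ∑ i ∈ s, c.powInt ν r (h i) := by
  unfold powInt lint
  rw [← lintegral_finsetSum']
  · refine lintegral_congr fun x ↦ ?_
    beta_reduce
    rw [Finset.sum_mul, ENNReal.ofReal_sum_of_nonneg fun i _ ↦
      mul_nonneg (h0 i _) (Real.rpow_nonneg (c.density_nonneg ν _) _)]
  · intro i _
    exact ((c.aemeasurable_comp_symm (hc i)).mul
      ((c.aemeasurable_density ν).pow_const r)).ennreal_ofReal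

/-- The `r`-th power of the density is `|ν(frame)|^r`, bounded on the compact `M`, times
`|scaleProd|^(-r)`, integrable as `r < 1`. -/
theorem powInt_lt_top (ν : BForm m Z m) {r : ℝ} (hr0 : 0 ≤ r) (hr : r < 1) {h : M → ℝ}
    [T2Space M] [CompactSpace M]
    (hc : Continuous h) (hh : tsupport h ⊆ c.U) : c.powInt ν r h < ⊤ := by
  have hK : IsCompact (c.e '' tsupport h) := (isClosed_tsupport h).isCompact.image_of_continuousOn
    (c.e.continuousOn.mono (hh.trans c.U_subset))
  obtain ⟨C, hC⟩ := (isCompact_univ (X := M)).exists_bound_of_continuousOn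
    (f := fun q ↦ h q * |ν c.frame q| ^ r)
    (hc.mul ((ν c.frame).contMDiff.continuous.abs.rpow_const fun _ ↦ Or.inr hr0)).continuousOn
  have h1 := lintegral_abs_scaleProd_rpow_neg_lt_top hr c.o hK
  have h2 : c.powInt ν r h ≤ ∫⁻ x in c.e '' tsupport h,
      ENNReal.ofReal C * ENNReal.ofReal (|scaleProd c.o x| ^ (-r)) := by
    unfold powInt lint
    rw [← lintegral_indicator c.isOpen_image.measurableSet, ← lintegral_indicator hK.measurableSet]
    refine lintegral_mono fun x ↦ ?_
    by_cases hx : x ∈ c.e '' c.U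
    · rw [indicator_of_mem hx]
      obtain ⟨q, hq, rfl⟩ := hx
      rw [c.e.left_inv (c.U_subset hq)]
      by_cases hqs : q ∈ tsupport h
      · rw [indicator_of_mem (mem_image_of_mem _ hqs), ← ENNReal.ofReal_mul' (by positivity)]
        refine ENNReal.ofReal_le_ofReal ?_
        rw [density, abs_div, Real.div_rpow (abs_nonneg _) (abs_nonneg _),
          Real.rpow_neg (abs_nonneg _), ← mul_div_assoc, div_eq_mul_inv]
        exact mul_le_mul_of_nonneg_right ((Real.le_norm_self _).trans (hC q (mem_univ q)))
          (by positivity)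
      · beta_reduce
        rw [image_eq_zero_of_notMem_tsupport hqs, zero_mul, ENNReal.ofReal_zero]
        exact zero_le
    · rw [indicator_of_notMem hx]
      exact zero_le
  refine h2.trans_lt ?_
  rw [lintegral_const_mul' _ _ ENNReal.ofReal_ne_top]
  exact ENNReal.mul_lt_top ENNReal.ofReal_lt_top h1

/-- If `h q > 0`, the integrand is positive on a nonempty open set, namely near `q` and off the
nowhere dense set `Z`. -/
theorem eq_zero_of_powInt_eq_zero [T2Space M] [CompactSpace M] (hZ : IsBManifold m Z)
    {ν : BForm m Z m} (hν : ν.NowhereVanishing) {r : ℝ} {h : M → ℝ} (hc : Continuous h)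
    (h0 : ∀ q, 0 ≤ h q) (hI : c.powInt ν r h = 0) {q : M} (hq : q ∈ c.U) : h q = 0 := by
  by_contra hne
  have hpos : 0 < h q := lt_of_le_of_ne (h0 q) (Ne.symm hne)
  let O : Set M := c.U ∩ {p | 0 < h p} ∩ Zᶜ
  have hO : IsOpen O :=
    (c.isOpen.inter (isOpen_lt continuous_const hc)).inter hZ.isClosed.isOpen_compl
  have hOn : O.Nonempty := hZ.dense_compl.inter_open_nonempty _
    (c.isOpen.inter (isOpen_lt continuous_const hc)) ⟨q, hq, hpos⟩
  have hOU : O ⊆ c.U := fun p hp ↦ hp.1.1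
  have hOi : IsOpen (c.e '' O) := c.e.isOpen_image_of_subset_source hO (hOU.trans c.U_subset)
  have hm : AEMeasurable (fun x ↦ ENNReal.ofReal (h (c.e.symm x) * c.density ν (c.e.symm x) ^ r))
      (volume.restrict (c.e '' c.U)) :=
    ((c.aemeasurable_comp_symm hc).mul ((c.aemeasurable_density ν).pow_const r)).ennreal_ofReal
  have h1 := (lintegral_eq_zero_iff' hm).1 hI
  have h2 := ae_restrict_of_ae_restrict_of_subset (image_mono hOU) h1
  have h3 : ∀ᵐ x ∂(volume.restrict (c.e '' O)), False := by
    filter_upwards [h2, ae_restrict_mem hOi.measurableSet] with x hx hxO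
    obtain ⟨p, hp, rfl⟩ := hxO
    simp only [c.e.left_inv (c.U_subset (hOU hp)), Pi.zero_apply, ENNReal.ofReal_eq_zero] at hx
    refine absurd hx (not_le.2 (mul_pos hp.1.2 (Real.rpow_pos_of_pos ?_ _)))
    exact abs_pos.2 (div_ne_zero (c.frame_ne_zero hν (hOU hp))
      (c.scaleProd_ne_zero (c.U_subset (hOU hp)) hp.2))
  have h4 : volume.restrict (c.e '' O) = 0 := by
    rw [← Measure.measure_univ_eq_zero]
    simpa [ae_iff] using h3
  rw [Measure.restrict_eq_zero] at h4
  exact (hOi.measure_pos volume (hOn.image _)).ne' h4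

end BChart

end

/-! ### No b-diffeomorphism halves a volume form. -/

section

variable [T2Space M] [CompactSpace M]

namespace BChart
variable (c d : BChart m Z)

/-- Division by zero puts the value `0` in place of the pole, which makes the comparison of
densities on `Z` trivial. -/
theorem density_eq_zero {ν : BForm m Z m} {q : M} (hq : q ∈ c.U) (hqZ : q ∈ Z) :
    c.density ν q = 0 := by
  rw [density, (c.mem_iff q (c.U_subset hq)).1 hqZ, div_zero, abs_zero]

theorem density_eq {ν : BForm m Z m} (hν : ν.NowhereVanishing) (φ : BDiffeo m Z) {q : M}
    (hq : q ∈ c.U) (hφq : φ.toDiffeo q ∈ d.U) (hqZ : q ∉ Z)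
    (h : 2 * φ.pull ν c.frame q = ν c.frame q) :
    c.density ν q = 2 * |(fderiv ℝ (c.transition d φ.toDiffeo) (c.e q)).det| *
      d.density ν (φ.toDiffeo q) := by
  have h1 := c.scaleProd_mul_pull d φ ν c.frame hq hφq
  have h2 := mul_right_cancel₀ (c.frame_ne_zero hν hq) (c.scaleProd_mul_apply ν c.frame hq)
  have hφZ : φ.toDiffeo q ∉ Z := fun h' ↦ hqZ (by rw [← φ.preimage_eq]; exact h')
  have n1 := c.scaleProd_ne_zero (c.U_subset hq) hqZ
  have n2 := d.scaleProd_ne_zero (d.U_subset hφq) hφZ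
  rw [← h2] at h1
  rw [density, density, ← h, ← abs_two, ← abs_mul, ← abs_mul, abs_two]
  congr 1
  field_simp
  linear_combination h1

/-- Substitution brings in the Jacobian `J` to the first power, whereas `|ν| = 2 J |ν ∘ φ|` as
densities. Hence `J |ν ∘ φ|^r = J^(1-r) 2^(-r) |ν|^r`, and `J ≤ D`. -/
theorem powInt_comp_symm_le {ν : BForm m Z m} (hν : ν.NowhereVanishing) (φ : BDiffeo m Z) {r : ℝ}
    (hr0 : 0 < r) (hr1 : r < 1) {h : M → ℝ} (h0 : ∀ q, 0 ≤ h q) {D : ℝ}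
    (hh : ∀ q, h q ≠ 0 → q ∈ c.U ∧ φ.toDiffeo q ∈ d.U ∧
      2 * φ.pull ν c.frame q = ν c.frame q ∧
      |(fderiv ℝ (c.transition d φ.toDiffeo) (c.e q)).det| ≤ D) :
    d.powInt ν r (h ∘ φ.toDiffeo.symm) ≤
      ENNReal.ofReal (D ^ (1 - r) * ((2 : ℝ) ^ r)⁻¹) * c.powInt ν r h := by
  set T := c.transition d φ.toDiffeo with hT
  set O : Set M := c.U ∩ φ.toDiffeo ⁻¹' d.U with hO
  have hOU : O ⊆ c.U := inter_subset_left
  have hOo : IsOpen O := c.isOpen.inter (d.isOpen.preimage φ.toDiffeo.contMDiff.continuous)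
  have hOs : O ⊆ c.e.source := hOU.trans c.U_subset
  have hs : IsOpen (c.e '' O) := c.e.isOpen_image_of_subset_source hOo hOs
  have hTq : ∀ q ∈ O, T (c.e q) = d.e (φ.toDiffeo q) := fun q hq ↦ by
    rw [hT, transition, c.e.left_inv (hOs hq)]
  have hTd : ∀ x ∈ c.e '' O, HasFDerivWithinAt T (fderiv ℝ T x) (c.e '' O) x := by
    rintro _ ⟨q, hq, rfl⟩
    exact ((c.contDiffAt_transition d φ.toDiffeo.contMDiff (hOs hq)
      (d.U_subset hq.2)).differentiableAt (by simp)).hasFDerivAt.hasFDerivWithinAt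
  have hTi : InjOn T (c.e '' O) := by
    rintro _ ⟨q, hq, rfl⟩ _ ⟨p, hp, rfl⟩ hqp
    rw [hTq q hq, hTq p hp] at hqp
    rw [φ.toDiffeo.injective (d.e.injOn (d.U_subset hq.2) (d.U_subset hp.2) hqp)]
  let f : 𝔼 → ENNReal := fun y ↦
    ENNReal.ofReal ((h ∘ φ.toDiffeo.symm) (d.e.symm y) * d.density ν (d.e.symm y) ^ r)
  have hfT : ∀ q ∈ O, f (T (c.e q)) =
      ENNReal.ofReal (h q * d.density ν (φ.toDiffeo q) ^ r) := fun q hq ↦ by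
    simp only [f]
    rw [hTq q hq, d.e.left_inv (d.U_subset hq.2), Function.comp_apply,
      φ.toDiffeo.symm_apply_apply]
  have hTs : MeasurableSet (T '' (c.e '' O)) := by
    have : T '' (c.e '' O) = d.e '' (φ.toDiffeo '' O) := by
      rw [image_image, image_image]
      exact image_congr hTq
    rw [this]
    refine (d.e.isOpen_image_of_subset_source ?_ ?_).measurableSet
    · exact φ.toDiffeo.toHomeomorph.isOpenMap _ hOo
    · rintro _ ⟨q, hq, rfl⟩
      exact d.U_subset hq.2
  have h1 : d.powInt ν r (h ∘ φ.toDiffeo.symm) ≤ ∫⁻ y in T '' (c.e '' O), f y := by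
    unfold powInt lint
    rw [← lintegral_indicator d.isOpen_image.measurableSet, ← lintegral_indicator hTs]
    refine lintegral_mono fun y ↦ ?_
    by_cases hy : y ∈ d.e '' d.U
    · rw [indicator_of_mem hy]
      by_cases hy' : h (φ.toDiffeo.symm (d.e.symm y)) = 0
      · beta_reduce
        rw [Function.comp_apply, hy', zero_mul, ENNReal.ofReal_zero]
        exact zero_le
      · obtain ⟨p, hp, rfl⟩ := hy
        rw [d.e.left_inv (d.U_subset hp)] at hy'
        have h2 := hh _ hy'
        rw [indicator_of_mem]
        refine ⟨_, ⟨_, ⟨h2.1, h2.2.1⟩, rfl⟩, ?_⟩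
        rw [hTq _ ⟨h2.1, h2.2.1⟩, φ.toDiffeo.apply_symm_apply]
    · rw [indicator_of_notMem hy]
      exact zero_le
  refine h1.trans ?_
  rw [lintegral_image_eq_lintegral_abs_det_fderiv_mul volume hs.measurableSet hTd hTi]
  have h2 : ∀ x ∈ c.e '' O, ENNReal.ofReal |(fderiv ℝ T x).det| * f (T x) ≤
      ENNReal.ofReal (D ^ (1 - r) * ((2 : ℝ) ^ r)⁻¹) *
        ENNReal.ofReal (h (c.e.symm x) * c.density ν (c.e.symm x) ^ r) := by
    rintro _ ⟨q, hq, rfl⟩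
    rw [hfT q hq, c.e.left_inv (hOs hq)]
    by_cases hq0 : h q = 0
    · simp [hq0]
    obtain ⟨-, -, hpull, hD⟩ := hh q hq0
    set J := |(fderiv ℝ T (c.e q)).det| with hJ
    have hJ0 : 0 ≤ J := abs_nonneg _
    have hD0 : 0 ≤ D := hJ0.trans hD
    rw [← ENNReal.ofReal_mul hJ0, ← ENNReal.ofReal_mul (by positivity)]
    refine ENNReal.ofReal_le_ofReal ?_
    by_cases hqZ : q ∈ Z
    · have hφZ : φ.toDiffeo q ∈ Z := by rw [← φ.preimage_eq] at hqZ; exact hqZ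
      rw [d.density_eq_zero hq.2 hφZ, Real.zero_rpow hr0.ne']
      have := c.density_nonneg ν q
      have := h0 q
      rw [mul_zero, mul_zero]
      positivity
    · have hd0 := d.density_nonneg ν (φ.toDiffeo q)
      rw [c.density_eq d hν φ hq.1 hq.2 hqZ hpull, ← hT, ← hJ,
        Real.mul_rpow (by positivity) hd0, Real.mul_rpow two_pos.le hJ0]
      have e1 : J = J ^ (1 - r) * J ^ r := by
        rw [← Real.rpow_add' hJ0 (by norm_num), sub_add_cancel, Real.rpow_one]
      have e2 : J ^ (1 - r) ≤ D ^ (1 - r) := Real.rpow_le_rpow hJ0 hD (by linarith)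
      have e3 : (0 : ℝ) < 2 ^ r := by positivity
      have := h0 q
      calc J * (h q * d.density ν (φ.toDiffeo q) ^ r)
          = J ^ (1 - r) * (J ^ r * (h q * d.density ν (φ.toDiffeo q) ^ r)) := by
            conv_lhs => rw [e1]
            ring
        _ ≤ D ^ (1 - r) * (J ^ r * (h q * d.density ν (φ.toDiffeo q) ^ r)) :=
            mul_le_mul_of_nonneg_right e2 (by positivity)
        _ = _ := by field_simp
  refine (setLIntegral_mono' hs.measurableSet h2).trans ?_
  rw [lintegral_const_mul' _ _ ENNReal.ofReal_ne_top]
  exact mul_le_mul_right (lintegral_mono_set (image_mono hOU)) _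

end BChart

/-- No b-diffeomorphism halves a volume form. -/
theorem eq_empty_of_two_mul_pull_eq (hZ : IsBManifold m Z) {ν : BForm m Z m}
    (hν : ν.NowhereVanishing) (φ : BDiffeo m Z) {C : Set M} (hC : IsClopen C)
    (hφC : ∀ q, φ.toDiffeo q ∈ C ↔ q ∈ C) (h : ∀ q ∈ C, ∀ W, 2 * φ.pull ν W q = ν W q) :
    C = ∅ := by
  obtain ⟨N, c, ρ, -, hρU, hρ0, hρ1⟩ := exists_bChart_partition (m := m) (Z := Z)
    (P := fun _ ↦ True)
    fun p ↦ (exists_bChart hZ p).imp fun c hc ↦ ⟨hc, trivial⟩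
  set χ : M → ℝ := C.indicator 1 with hχ
  have hχc : Continuous χ := continuous_const.indicator (by simp [hC.frontier_eq])
  have hχ0 : ∀ q, 0 ≤ χ q := indicator_nonneg fun _ _ ↦ zero_le_one
  have hχφ : ∀ q, χ (φ.toDiffeo.symm q) = χ q := fun q ↦ by
    have := hφC (φ.toDiffeo.symm q)
    rw [φ.toDiffeo.apply_symm_apply] at this
    by_cases hq : q ∈ C
    · rw [hχ, indicator_of_mem hq, indicator_of_mem (this.1 hq)]; rfl
    · rw [hχ, indicator_of_notMem hq, indicator_of_notMem fun h ↦ hq (this.2 h)]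
  have hφc : Continuous φ.toDiffeo := φ.toDiffeo.contMDiff.continuous
  have hφsc : Continuous φ.toDiffeo.symm := φ.toDiffeo.symm.contMDiff.continuous
  have hρc : ∀ i, Continuous (ρ i) := fun i ↦ (ρ i).contMDiff.continuous
  have hdet : ∃ D : ℝ, 1 ≤ D ∧ ∀ i j, ∀ q, ρ i q ≠ 0 → ρ j (φ.toDiffeo q) ≠ 0 →
      |(fderiv ℝ ((c i).transition (c j) φ.toDiffeo) ((c i).e q)).det| ≤ D := by
    have h1 : ∀ i j, ∃ D : ℝ, ∀ q ∈ tsupport (ρ i) ∩ φ.toDiffeo ⁻¹' tsupport (ρ j),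
        |(fderiv ℝ ((c i).transition (c j) φ.toDiffeo) ((c i).e q)).det| ≤ D := by
      intro i j
      refine (((isClosed_tsupport (ρ i)).inter
        ((isClosed_tsupport (ρ j)).preimage hφc)).isCompact).exists_bound_of_continuousOn
        (f := fun q ↦ (fderiv ℝ ((c i).transition (c j) φ.toDiffeo) ((c i).e q)).det) ?_
      intro q hq
      have hqs := (c i).U_subset (hρU i hq.1)
      have h2 := (c i).contDiffAt_transition (c j) φ.toDiffeo.contMDiff hqs
        ((c j).U_subset (hρU j hq.2))
      have h3 : ContinuousAt (fderiv ℝ ((c i).transition (c j) φ.toDiffeo)) ((c i).e q) :=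
        (h2.fderiv_right (m := 0) (by simp)).continuousAt
      have h4 : ContinuousAt (fun q ↦ fderiv ℝ ((c i).transition (c j) φ.toDiffeo) ((c i).e q)) q :=
        h3.comp ((c i).e.continuousAt hqs)
      exact (ContinuousLinearMap.continuous_det.continuousAt.comp h4).continuousWithinAt
    choose D hD using h1
    refine ⟨1 + ∑ i, ∑ j, |D i j|, le_add_of_nonneg_right (by positivity), fun i j q hi hj ↦ ?_⟩
    refine (hD i j q ⟨subset_tsupport _ hi, subset_tsupport _ hj⟩).trans ?_
    refine (le_abs_self _).trans ?_
    have e1 := Finset.single_le_sum (f := fun j ↦ |D i j|) (fun j _ ↦ abs_nonneg _)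
      (Finset.mem_univ j)
    have e2 := Finset.single_le_sum (f := fun i ↦ ∑ j, |D i j|) (fun j _ ↦ by positivity)
      (Finset.mem_univ i)
    beta_reduce at e1 e2
    linarith
  obtain ⟨D, hD1, hD⟩ := hdet
  -- At `r = 1` the expression equals `1 / 2`, so by continuity it is below `1` for some `r < 1`.
  obtain ⟨r, hr0, hr1, hr⟩ : ∃ r : ℝ, 0 < r ∧ r < 1 ∧ D ^ (1 - r) * ((2 : ℝ) ^ r)⁻¹ < 1 := by
    have h1 : ContinuousAt (fun r : ℝ ↦ D ^ (1 - r) * ((2 : ℝ) ^ r)⁻¹) 1 := by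
      refine ContinuousAt.mul ?_ (ContinuousAt.inv₀ ?_ (by norm_num))
      · exact (Real.continuousAt_const_rpow (by linarith)).comp (by fun_prop)
      · exact Real.continuousAt_const_rpow two_ne_zero
    have h2 : ∀ᶠ r in 𝓝 (1 : ℝ), D ^ (1 - r) * ((2 : ℝ) ^ r)⁻¹ < 1 :=
      h1.eventually_lt_const (by norm_num)
    have h3 : ∀ᶠ r in 𝓝 (1 : ℝ), 0 < r := lt_mem_nhds one_pos
    obtain ⟨r, ⟨hr, hr0⟩, hr1⟩ := (((h2.and h3).filter_mono nhdsWithin_le_nhds).and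
      (self_mem_nhdsWithin (a := (1 : ℝ)) (s := Iio 1))).exists
    exact ⟨r, hr0, hr1, hr⟩
  set θ := ENNReal.ofReal (D ^ (1 - r) * ((2 : ℝ) ^ r)⁻¹) with hθ
  have hθ1 : θ < 1 := by rw [hθ, ENNReal.ofReal_lt_one]; exact hr
  let H : Fin N → Fin N → M → ℝ := fun i j q ↦ χ q * ρ i q * ρ j (φ.toDiffeo q)
  have hHc : ∀ i j, Continuous (H i j) := fun i j ↦
    (hχc.mul (hρc i)).mul ((hρc j).comp hφc)
  have hH0 : ∀ i j q, 0 ≤ H i j q := fun i j q ↦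
    mul_nonneg (mul_nonneg (hχ0 q) (hρ0 i q)) (hρ0 j _)
  -- The integral of `|ν|^r` over `C`. The functions `H i j` cut off both at `q` and at `φ q`, so
  -- `V` can be computed before `φ` (`hV1`) and after it (`hV2`).
  let V := ∑ i, (c i).powInt ν r (fun q ↦ χ q * ρ i q)
  have hV1 : V = ∑ i, ∑ j, (c i).powInt ν r (H i j) := by
    refine Finset.sum_congr rfl fun i _ ↦ ?_
    rw [← (c i).powInt_sum Finset.univ ν r (hHc i) (hH0 i)]
    congr 1
    funext q
    simp only [H]
    rw [← Finset.mul_sum, hρ1, mul_one]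
  have hV2 : V = ∑ i, ∑ j, (c j).powInt ν r (H i j ∘ φ.toDiffeo.symm) := by
    rw [Finset.sum_comm]
    refine Finset.sum_congr rfl fun j _ ↦ ?_
    rw [← (c j).powInt_sum Finset.univ ν r (fun i ↦ (hHc i j).comp hφsc) fun i q ↦ hH0 i j _]
    congr 1
    funext q
    simp only [H, Function.comp_apply, φ.toDiffeo.apply_symm_apply, hχφ]
    rw [← Finset.sum_mul, ← Finset.mul_sum, hρ1, mul_one]
  have hVθ : V ≤ θ * V := by
    conv_lhs => rw [hV2]
    rw [hV1, Finset.mul_sum]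
    refine Finset.sum_le_sum fun i _ ↦ ?_
    rw [Finset.mul_sum]
    refine Finset.sum_le_sum fun j _ ↦ ?_
    refine (c i).powInt_comp_symm_le (c j) hν φ hr0 hr1 (hH0 i j) fun q hq ↦ ?_
    have hj : ρ j (φ.toDiffeo q) ≠ 0 := right_ne_zero_of_mul hq
    have hi : ρ i q ≠ 0 := right_ne_zero_of_mul (left_ne_zero_of_mul hq)
    have hqC : q ∈ C := by
      by_contra hqC
      exact left_ne_zero_of_mul (left_ne_zero_of_mul hq) (indicator_of_notMem hqC _)
    exact ⟨hρU i (subset_tsupport _ hi), hρU j (subset_tsupport _ hj), h q hqC _, hD i j q hi hj⟩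
  have hVtop : V ≠ ⊤ := by
    refine (ENNReal.sum_lt_top.2 fun i _ ↦ ?_).ne
    exact (c i).powInt_lt_top ν hr0.le hr1 (hχc.mul (hρc i))
      (tsupport_mul_subset_right.trans (hρU i))
  have hV0 : V = 0 := by
    by_contra hne
    have := ENNReal.mul_lt_mul_left hne hVtop hθ1
    rw [one_mul] at this
    exact absurd hVθ (not_le.2 this)
  refine eq_empty_of_forall_notMem fun q hq ↦ ?_
  have hρq : ∀ i, ρ i q = 0 := by
    intro i
    by_contra hi
    have h1 := (Finset.sum_eq_zero_iff.1 hV0) i (Finset.mem_univ i)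
    have h2 := (c i).eq_zero_of_powInt_eq_zero hZ hν (hχc.mul (hρc i))
      (fun p ↦ mul_nonneg (hχ0 p) (hρ0 i p)) h1 (hρU i (subset_tsupport _ hi))
    rw [Pi.mul_apply, hχ, indicator_of_mem hq, Pi.one_apply, one_mul] at h2
    exact hi h2
  have := hρ1 q
  simp [hρq] at this

end

/-! ### Orientation and Moser's theorem. -/

section

theorem VField.deriv_eq_zero_of_isLocallyConstant (V : VField m M) {f : SmoothFun m M}
    (hf : IsLocallyConstant f) : V.deriv f = 0 := by
  ext q
  let r : SmoothFun m M := ⟨fun _ ↦ f q, contMDiff_const⟩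
  rw [V.deriv_congr (g := r) (hf.eventually_eq q), V.deriv_const fun _ ↦ rfl]
  rfl

theorem contMDiff_of_isLocallyConstant {f : M → ℝ} (hf : IsLocallyConstant f) :
    ContMDiff (𝓡 m) 𝓘(ℝ, ℝ) ∞ f := fun q ↦
  (contMDiffAt_const (c := f q)).congr_of_eventuallyEq (hf.eventually_eq q)

section
variable {n : ℕ} {M : Type*} [TopologicalSpace M] [ChartedSpace (EuclideanSpace ℝ (Fin (n + 1))) M]
  [IsManifold (𝓡 (n + 1)) ∞ M] {Z : Set M} [T2Space M] [CompactSpace M]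

/-- Cohomologous volume forms define the same orientation. -/
theorem pos_of_sub_one_smul_eq_bDiff (hZ : IsBManifold (n + 1) Z) {μ : BForm (n + 1) Z (n + 1)}
    (hμ : μ.NowhereVanishing) {f : SmoothFun (n + 1) M} (hf : ∀ q, f q ≠ 0)
    {η : BForm (n + 1) Z n} (hη : ∀ V, ((f - 1) • μ) V = bDiff η V) (q : M) : 0 < f q := by
  set C : Set M := {q | f q < 0} with hCdef
  have hfc : Continuous f := f.contMDiff.continuous
  have hC : IsClopen C := by
    refine ⟨?_, isOpen_lt hfc continuous_const⟩
    have : C = {q | f q ≤ 0} := by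
      ext q
      exact ⟨fun h ↦ le_of_lt (show f q < 0 from h), fun h ↦ lt_of_le_of_ne h (hf q)⟩
    rw [this]
    exact isClosed_le hfc continuous_const
  suffices h : C = ∅ by
    refine lt_of_le_of_ne (not_lt.1 fun hq ↦ ?_) (hf q).symm
    have : q ∈ C := hq
    simp [h] at this
  have hloc : IsLocallyConstant (C.indicator (1 : M → ℝ)) := by
    refine (IsLocallyConstant.iff_eventually_eq _).2 fun q ↦ ?_
    by_cases hq : q ∈ C
    · filter_upwards [hC.isOpen.mem_nhds hq] with p hp
      rw [indicator_of_mem hp, indicator_of_mem hq]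
      rfl
    · filter_upwards [hC.compl.isOpen.mem_nhds hq] with p hp
      rw [indicator_of_notMem hp, indicator_of_notMem hq]
  let χ : SmoothFun (n + 1) M := ⟨C.indicator 1, contMDiff_of_isLocallyConstant hloc⟩
  have hχ1 : ∀ q ∈ C, χ q = 1 := fun q hq ↦ indicator_of_mem hq _
  have hχ0 : ∀ q ∈ Cᶜ, χ q = 0 := fun q hq ↦ indicator_of_notMem hq _
  have hη' : ∀ V, ((1 - f) • μ) V = bDiff ((-1 : ℝ) • η) V := by
    intro V
    rw [bDiff_smul, ← hη, AlternatingMap.smul_apply, AlternatingMap.smul_apply]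
    ext q
    change (1 - f q) * μ V q = -1 * ((f q - 1) * μ V q)
    ring
  obtain ⟨κ, _, G, hG, hGsum⟩ := exists_sum_isElementary hZ hμ hη'
    (χ := χ) (fun V ↦ V.deriv_eq_zero_of_isLocallyConstant hloc) hχ0
  -- On `C` this is `1 - f > 0`, and adding `χ (1 - f)` doubles it; off `C` it is `1` and nothing is
  -- added. The b-diffeomorphism obtained from this change thus halves `f₀ μ` on `C`.
  let f₀ : SmoothFun (n + 1) M := 1 - χ * f
  have hf₀ : ∀ q, f₀ q = 1 - χ q * f q := fun q ↦ rfl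
  have hfsum : ∀ q, (f₀ + ∑ i, G i) q = f₀ q + χ q * (1 - f q) := fun q ↦ by rw [hGsum]; rfl
  have hf₀pos : ∀ q, 0 < f₀ q := by
    intro q
    rw [hf₀]
    by_cases hq : q ∈ C
    · rw [hχ1 q hq, one_mul]
      have : f q < 0 := hq
      linarith
    · rw [hχ0 q hq]
      norm_num
  have hf₁pos : ∀ q, 0 < (f₀ + ∑ i, G i) q := by
    intro q
    rw [hfsum]
    by_cases hq : q ∈ C
    · rw [hχ1 q hq]
      have h1 := hf₀pos q
      have : f q < 0 := hq
      linarith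
    · rw [hχ0 q hq, zero_mul, add_zero]
      exact hf₀pos q
  obtain ⟨φ, hφ, hφS⟩ := isotopic_add hZ hG hf₀pos hf₁pos
  have hφC : ∀ q, φ.toDiffeo q ∈ C ↔ q ∈ C := by
    intro q
    refine ⟨fun h ↦ ?_, fun h ↦ ?_⟩
    · by_contra hq
      rw [hφS q hq] at h
      exact hq h
    · by_contra hq
      exact hq ((φ.toDiffeo.injective (hφS _ hq)).symm ▸ h)
  refine eq_empty_of_two_mul_pull_eq hZ (ν := f₀ • μ) ?_ φ hC hφC fun q hq W ↦ ?_
  · intro q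
    obtain ⟨V, hV⟩ := hμ q
    exact ⟨V, mul_ne_zero (hf₀pos q).ne' hV⟩
  · refine Eq.trans ?_ (congrArg (fun α : BForm (n + 1) Z (n + 1) ↦ α W q) hφ)
    change 2 * (f₀ (φ.toDiffeo q) * _) = (f₀ + ∑ i, G i) (φ.toDiffeo q) * _
    rw [hfsum, hf₀, hχ1 _ ((hφC q).2 hq)]
    ring

end

variable [T2Space M] [CompactSpace M]

/-- Moser's theorem for b-volume forms. -/
theorem exists_bDiffeo_pull_eq (hZ : IsBManifold m Z) {μ μ' : BForm m Z m}
    (hμ : μ.NowhereVanishing) (hμ' : μ'.NowhereVanishing) (h : topClass μ = topClass μ') :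
    ∃ φ : BDiffeo m Z, φ.pull μ' = μ := by
  have h1 : μ' - μ ∈ exactBForms m Z m := (Submodule.Quotient.eq _).1 h.symm
  cases m with
  | zero =>
    -- In degree `0` the space of exact forms is zero, so the two forms are equal and the identity
    -- suffices.
    have h2 : μ' - μ = 0 := h1
    rw [sub_eq_zero.1 h2]
    obtain ⟨φ, hφ, -⟩ := Isotopic.refl hZ μ ∅ 1
    exact ⟨φ, by simpa only [one_smul] using hφ⟩
  | succ n =>
    obtain ⟨η, hη⟩ := h1
    obtain ⟨f, rfl⟩ := exists_eq_smul hZ hμ μ'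
    have hη' : ∀ V, ((f - 1) • μ) V = bDiff η V := fun V ↦ by
      rw [← hη V]
      ext q
      change (f q - 1) * μ V q = f q * μ V q - μ V q
      ring
    have hf : ∀ q, f q ≠ 0 := fun q ↦ by
      obtain ⟨V, hV⟩ := hμ' q
      exact left_ne_zero_of_mul hV
    have hpos := pos_of_sub_one_smul_eq_bDiff hZ hμ hf hη'
    obtain ⟨κ, _, G, hG, hGsum⟩ := exists_sum_isElementary hZ hμ hη' (χ := 1) (S := ∅)
      (fun V ↦ V.deriv_eq_zero_of_isLocallyConstant (IsLocallyConstant.const 1)) (by simp)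
    have e1 : 1 + ∑ i, G i = f := by rw [hGsum, one_mul, add_sub_cancel]
    obtain ⟨φ, hφ, -⟩ := isotopic_add hZ hG (f := 1) (fun _ ↦ one_pos) (by rwa [e1])
    exact ⟨φ, by rw [← e1, hφ, one_smul]⟩

end

/-! ### Nambu structures and their inverse forms. -/

section

/-- A vector field on `M`, as a section of `TM = T_∅ M`. -/
def toField (V : bFields m Z) : bFields m (∅ : Set M) := ⟨V.1, fun _ h ↦ h.elim⟩

theorem restrictForm_eq {k : ℕ} (ν : BForm m (∅ : Set M) k) (V : Fin k → bFields m Z) :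
    restrictForm ν V = ν fun i ↦ toField (V i) := rfl

theorem isBManifold_empty : IsBManifold m (∅ : Set M) := ⟨isClosed_empty, fun _ h ↦ h.elim⟩

namespace BChart
variable (c : BChart m Z)

/-- An adapted chart, as a chart of `(M, ∅)`. -/
def toEmpty : BChart m (∅ : Set M) :=
  { c with
    o := none
    mem_iff := fun q _ ↦ by simp [scaleProd_none] }

/-- The form `dx_1 ∧ ⋯ ∧ dx_m` of a chart, cut off. -/
def coordForm : BForm m (∅ : Set M) m :=
  Matrix.detRowAlternating.compLinearMap
    { toFun := fun W j ↦ W.1.deriv (c.coord j)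
      map_add' := fun V W ↦ funext fun _ ↦ VField.add_deriv V.1 W.1 _
      map_smul' := fun f W ↦ funext fun _ ↦ VField.smul_deriv f W.1 _ }

variable [T2Space M] [CompactSpace M]

theorem coordForm_apply (W : Fin m → bFields m (∅ : Set M)) (q : M) :
    c.coordForm W q = (c.derivMatrix (fun i ↦ (W i).1) q).det := by
  let ev : SmoothFun m M →+* ℝ :=
    { toFun := fun f ↦ f q, map_one' := rfl, map_mul' := fun _ _ ↦ rfl, map_zero' := rfl,
      map_add' := fun _ _ ↦ rfl }
  exact ev.map_det (Matrix.of fun i j ↦ (W i).1.deriv (c.coord j))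

theorem apply_eq_coordForm_mul (ν : BForm m (∅ : Set M) m) (W : Fin m → bFields m (∅ : Set M))
    {q : M} (hq : q ∈ c.U) : ν W q = c.coordForm W q * ν c.toEmpty.frame q := by
  have h := c.toEmpty.scaleProd_mul_apply ν W (q := q) hq
  rw [c.coordForm_apply]
  rw [show c.toEmpty.o = none from rfl, scaleProd_none, one_mul] at h
  exact h

theorem det_derivMatrix_frame {q : M} (hq : q ∈ c.U) :
    (c.derivMatrix (fun i ↦ (c.frame i).1) q).det = scaleProd c.o (c.e q) := by
  have : c.derivMatrix (fun i ↦ (c.frame i).1) q =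
      Matrix.diagonal fun j ↦ scaleCoeff c.o j (c.e q) := by
    ext i j
    rw [Matrix.diagonal_apply]
    exact c.deriv_frame_coord i j hq
  rw [this, Matrix.det_diagonal, scaleProd]

theorem restrictForm_coordForm_frame {q : M} (hq : q ∈ c.U) :
    restrictForm c.coordForm c.frame q = scaleProd c.o (c.e q) := by
  rw [restrictForm_eq, c.coordForm_apply]
  exact c.det_derivMatrix_frame hq

/-- At a point of `Z` the b-fields take values in a hyperplane of the tangent space, so an ordinary
top-form vanishes on them. Here this appears as a determinant with the factor `scaleProd`. -/
theorem restrictForm_eq_zero (ν : BForm m (∅ : Set M) m) (V : Fin m → bFields m Z) {q : M}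
    (hq : q ∈ c.U) (hqZ : q ∈ Z) : restrictForm ν V q = 0 := by
  obtain ⟨A, hA, -⟩ := c.exists_matrix V hq
  have h1 : c.derivMatrix (fun i ↦ (V i).1) q =
      A * Matrix.diagonal (fun j ↦ scaleCoeff c.o j (c.e q)) := by
    ext i j
    rw [Matrix.mul_diagonal]
    exact hA i j
  have h2 : (c.derivMatrix (fun i ↦ (toField (V i)).1) q).det = 0 := by
    change (c.derivMatrix (fun i ↦ (V i).1) q).det = 0
    rw [h1, Matrix.det_mul, Matrix.det_diagonal, ← scaleProd, (c.mem_iff q (c.U_subset hq)).1 hqZ,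
      mul_zero]
  rw [restrictForm_eq, c.apply_eq_coordForm_mul ν _ hq, c.coordForm_apply, h2, zero_mul]

end BChart

variable [T2Space M] [CompactSpace M]

namespace TopMultivector
variable {w : TopMultivector m M}

/-- Linearity over smooth functions makes `w` local: `β` can be multiplied by a cut-off that is `1`
at `q`. -/
theorem apply_eq_zero (w : TopMultivector m M) {β : BForm m (∅ : Set M) m} {O : Set M}
    (hO : IsOpen O) (hβ : ∀ q ∈ O, ∀ W, β W q = 0) {q : M} (hq : q ∈ O) : w β q = 0 := by
  obtain ⟨χ, hχ, ⟨U, -, hqU, hU1⟩, -⟩ := exists_smoothFun_one_nhds (m := m)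
    (isClosed_singleton (x := q)) hO (singleton_subset_iff.2 hq)
  have h0 : χ • β = 0 := by
    ext W p
    change χ p * β W p = 0
    by_cases hp : p ∈ tsupport χ
    · rw [hβ p (hχ hp), mul_zero]
    · rw [image_eq_zero_of_notMem_tsupport hp, zero_mul]
  have h1 : (χ * w β) q = 0 := by
    rw [← smul_eq_mul, ← map_smul, h0, map_zero]
    rfl
  have h2 : χ q * w β q = 0 := h1
  rwa [hU1 q (hqU rfl), one_mul] at h2

/-- Top-forms and top-degree multi-vector fields are sections of line bundles. -/
theorem mul_apply_comm (w : TopMultivector m M) (ν ν' : BForm m (∅ : Set M) m)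
    (W : Fin m → bFields m (∅ : Set M)) (q : M) : w ν q * ν' W q = w ν' q * ν W q := by
  obtain ⟨c, hc⟩ := exists_bChart (isBManifold_empty (m := m) (M := M)) q
  let β := ν' c.toEmpty.frame • ν - ν c.toEmpty.frame • ν'
  have hβ : ∀ p ∈ c.U, ∀ W, β W p = 0 := by
    intro p hp W
    change ν' c.toEmpty.frame p * ν W p - ν c.toEmpty.frame p * ν' W p = 0
    rw [c.apply_eq_coordForm_mul ν W hp, c.apply_eq_coordForm_mul ν' W hp]
    ring
  have h1 := w.apply_eq_zero c.isOpen hβ hc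
  have h2 : ν' c.toEmpty.frame q * w ν q - ν c.toEmpty.frame q * w ν' q = 0 := by
    rw [← h1]
    simp only [β]
    rw [map_sub, map_smul, map_smul]
    rfl
  rw [c.apply_eq_coordForm_mul ν W hc, c.apply_eq_coordForm_mul ν' W hc]
  linear_combination c.coordForm W q * h2

/-- At a point of `Z`, both `w ν₀` and `ν₀(V)` are divisible by the normal coordinate.
Transversality makes the cofactor of `w ν₀` nonzero there, so the quotient of the cofactors is
smooth. The relation `mul_apply_comm` carries the formula from `ν₀` to every `ν`. -/
theorem exists_local_quotient (hZ : IsBManifold m Z) (hw : w.IsGenericNambu)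
    (hwZ : w.singularLocus = Z) (V : Fin m → bFields m Z) (p : M) :
    ∃ (O : Set M) (F : M → ℝ), IsOpen O ∧ p ∈ O ∧ ContMDiffOn (𝓡 m) 𝓘(ℝ, ℝ) ∞ F O ∧
      ∀ q ∈ O, q ∉ Z → ∀ ν, restrictForm ν V q = w ν q * F q := by
  have hw0 : ∀ ν, ∀ q ∈ Z, w ν q = 0 := fun ν q hq ↦ by
    rw [← hwZ] at hq
    exact hq ν
  have hcomm : ∀ ν ν' q, w ν q * restrictForm ν' V q = w ν' q * restrictForm ν V q :=
    fun ν ν' q ↦ w.mul_apply_comm ν ν' _ q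
  by_cases hpZ : p ∈ Z
  · obtain ⟨ν₀, hν₀⟩ := hw p (hwZ ▸ hpZ)
    obtain ⟨c, hc⟩ := exists_bChart hZ p
    obtain ⟨k, hk, hk0⟩ := scaleProd_eq_zero_iff.1 ((c.mem_iff p (c.U_subset hc)).1 hpZ)
    obtain ⟨w₁, hw₁⟩ := c.exists_eq_coord_mul hk (hw0 ν₀)
    obtain ⟨n₁, hn₁⟩ := c.exists_eq_coord_mul hk (h := c.χ * restrictForm ν₀ V) fun q hq ↦ by
      obtain ⟨d, hd⟩ := exists_bChart hZ q
      change c.χ q * restrictForm ν₀ V q = 0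
      rw [d.restrictForm_eq_zero ν₀ V hd hq, mul_zero]
    have hw₁p : w₁ p ≠ 0 := by
      intro h0
      apply hν₀
      have hev : (w ν₀ : M → ℝ) =ᶠ[𝓝 p] fun q ↦ c.coord k q * w₁ q := by
        filter_upwards [c.isOpen.mem_nhds hc] with q hq
        rw [hw₁ q hq, c.coord_apply k hq]
      have h1 : mvfderiv (𝓡 m) (w ν₀) p = mvfderiv (𝓡 m) (fun q ↦ c.coord k q * w₁ q) p :=
        hev.mfderiv_eq
      rw [h1]
      have h2 := mvfderiv_mul ((c.coord k).contMDiff.mdifferentiable (by simp) p)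
        (w₁.contMDiff.mdifferentiable (by simp) p)
      refine h2.trans ?_
      rw [h0, c.coord_eq_zero hk hpZ, zero_smul, zero_smul, add_zero]
    refine ⟨c.U ∩ {q | w₁ q ≠ 0}, fun q ↦ n₁ q / w₁ q,
      c.isOpen.inter (isOpen_ne_fun w₁.contMDiff.continuous continuous_const), ⟨hc, hw₁p⟩,
      fun q hq ↦ ((n₁.contMDiff q).div₀ (w₁.contMDiff q) hq.2).contMDiffWithinAt, ?_⟩
    intro q hq hqZ ν
    have h1 := hcomm ν₀ ν q
    have h2 : restrictForm ν₀ V q = c.e q k * n₁ q := by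
      rw [← hn₁ q hq.1]
      change _ = c.χ q * _
      rw [c.eq_one q hq.1, one_mul]
    have h3 : c.e q k ≠ 0 := by
      have := c.scaleProd_ne_zero (c.U_subset hq.1) hqZ
      rwa [hk, scaleProd_some] at this
    rw [h2, hw₁ q hq.1] at h1
    have h4 : w₁ q ≠ 0 := hq.2
    refine mul_left_cancel₀ (mul_ne_zero h3 h4) ?_
    rw [h1]
    field_simp
  · obtain ⟨ν₀, hν₀⟩ : ∃ ν₀, w ν₀ p ≠ 0 := by
      rw [← hwZ] at hpZ
      exact not_forall.1 hpZ
    refine ⟨{q | w ν₀ q ≠ 0}, fun q ↦ restrictForm ν₀ V q / w ν₀ q,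
      isOpen_ne_fun (w ν₀).contMDiff.continuous continuous_const, hν₀,
      fun q hq ↦ (((restrictForm ν₀ V).contMDiff q).div₀ ((w ν₀).contMDiff q)
        hq).contMDiffWithinAt, fun q hq _ ν ↦ ?_⟩
    have h1 := hcomm ν₀ ν q
    have h2 : w ν₀ q ≠ 0 := hq
    field_simp
    linarith

theorem eq_of_forall_eq_mul (hZ : IsBManifold m Z) (hwZ : w.singularLocus = Z)
    {F G : SmoothFun m M} (h : ∀ ν, w ν * F = w ν * G) : F = G := by
  refine SmoothFun.ext_compl hZ fun q hq ↦ ?_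
  rw [← hwZ] at hq
  obtain ⟨ν, hν⟩ := not_forall.1 hq
  exact mul_left_cancel₀ hν (congrArg (fun f : SmoothFun m M ↦ f q) (h ν))

theorem exists_quotient (hZ : IsBManifold m Z) (hw : w.IsGenericNambu)
    (hwZ : w.singularLocus = Z) (V : Fin m → bFields m Z) :
    ∃ F : SmoothFun m M, ∀ ν, restrictForm ν V = w ν * F := by
  choose O F hO hp hF hFν using exists_local_quotient hZ hw hwZ V
  have hEq : ∀ p q, q ∈ O p → F q q = F p q := by
    intro p q hq
    -- Off `Z` some `w ν` is nonzero and determines the quotient; density of the complement extends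
    -- the equality to the whole overlap.
    have h1 : EqOn (F q) (F p) ((O p ∩ O q) ∩ Zᶜ) := fun x hx ↦ by
      have hxZ := hx.2
      rw [mem_compl_iff, ← hwZ] at hxZ
      obtain ⟨ν, hν⟩ := not_forall.1 hxZ
      exact mul_left_cancel₀ hν ((hFν q x hx.1.2 hx.2 ν).symm.trans (hFν p x hx.1.1 hx.2 ν))
    have h2 := h1.of_subset_closure ((hF q).continuousOn.mono inter_subset_right)
      ((hF p).continuousOn.mono inter_subset_left) inter_subset_left
      (hZ.dense_compl.open_subset_closure_inter ((hO p).inter (hO q)))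
    exact h2 ⟨hq, hp q⟩
  refine ⟨⟨fun q ↦ F q q, fun p ↦ ?_⟩, fun ν ↦ SmoothFun.ext_compl hZ fun q hq ↦
    hFν q q (hp q) hq ν⟩
  refine ((hF p).contMDiffAt ((hO p).mem_nhds (hp p))).congr_of_eventuallyEq ?_
  filter_upwards [(hO p).mem_nhds (hp p)] with q hq
  exact hEq p q hq

/-- The quotient is unique, because `w` is nonzero on a dense set. So it inherits multilinearity and
alternation in `V` from the forms `ν`. -/
theorem existsUnique_isInverse (hZ : IsBManifold m Z) (hw : w.IsGenericNambu)
    (hwZ : w.singularLocus = Z) : ∃! μ : BForm m Z m, w.IsInverse μ := by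
  choose F hF using exists_quotient hZ hw hwZ
  have hup : ∀ (V : Fin m → bFields m Z) i X, (fun j ↦ toField (Function.update V i X j)) =
      Function.update (fun j ↦ toField (V j)) i (toField X) := by
    intro V i X
    ext1 j
    by_cases hj : j = i
    · subst hj; simp
    · simp [hj]
  let μ : BForm m Z m :=
    { toFun := F
      map_update_add' := fun {dec} V i X Y ↦ by
        -- The field quantifies over all instances of decidable equality, whereas `hup` uses the
        -- standard one.
        have : dec = instDecidableEqFin m := Subsingleton.elim _ _
        subst this
        refine eq_of_forall_eq_mul hZ hwZ fun ν ↦ ?_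
        rw [mul_add, ← hF, ← hF, ← hF, restrictForm_eq, restrictForm_eq, restrictForm_eq, hup, hup,
          hup]
        exact ν.map_update_add _ _ (toField X) (toField Y)
      map_update_smul' := fun {dec} V i f X ↦ by
        have : dec = instDecidableEqFin m := Subsingleton.elim _ _
        subst this
        refine eq_of_forall_eq_mul hZ hwZ fun ν ↦ ?_
        rw [smul_eq_mul, mul_left_comm, ← hF, ← hF, restrictForm_eq, restrictForm_eq, hup, hup]
        exact ν.map_update_smul _ _ f (toField X)
      map_eq_zero_of_eq' := fun V i j h hij ↦ by
        refine eq_of_forall_eq_mul hZ hwZ fun ν ↦ ?_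
        rw [mul_zero, ← hF, restrictForm_eq]
        exact ν.map_eq_zero_of_eq _ (congrArg toField h) hij }
  refine ⟨μ, fun ν V ↦ hF V ν, fun μ' h ↦ ?_⟩
  ext V : 1
  exact eq_of_forall_eq_mul hZ hwZ fun ν ↦ by rw [← h ν V, hF V ν]; rfl

/-- Testing on the coordinate form gives `scaleProd = w(dx) * μ(frame)`. Near `Z` the normal
coordinate divides `w(dx)`; cancelling it off `Z` and passing to the limit gives `1 = w₁ *
μ(frame)`, also on `Z`. -/
theorem IsInverse.nowhereVanishing (hZ : IsBManifold m Z) (hwZ : w.singularLocus = Z)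
    {μ : BForm m Z m} (h : w.IsInverse μ) : μ.NowhereVanishing := by
  intro p
  obtain ⟨c, hc⟩ := exists_bChart hZ p
  have h1 : ∀ q ∈ c.U, scaleProd c.o (c.e q) = w c.coordForm q * μ c.frame q := fun q hq ↦ by
    rw [← c.restrictForm_coordForm_frame hq, h c.coordForm c.frame]
    rfl
  refine ⟨c.frame, fun h0 ↦ ?_⟩
  by_cases hpZ : p ∈ Z
  · obtain ⟨k, hk, -⟩ := scaleProd_eq_zero_iff.1 ((c.mem_iff p (c.U_subset hc)).1 hpZ)
    obtain ⟨w₁, hw₁⟩ := c.exists_eq_coord_mul hk (h := w c.coordForm) fun q hq ↦ by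
      rw [← hwZ] at hq
      exact hq _
    have h2 : EqOn (fun _ ↦ (1 : ℝ)) (fun q ↦ w₁ q * μ c.frame q) (c.U ∩ Zᶜ) := by
      intro q hq
      have h3 := h1 q hq.1
      have h4 := c.scaleProd_ne_zero (c.U_subset hq.1) hq.2
      rw [hk, scaleProd_some] at h3 h4
      rw [hw₁ q hq.1, mul_assoc] at h3
      exact mul_left_cancel₀ h4 ((mul_one _).trans h3)
    have h5 := h2.of_subset_closure continuousOn_const
      (w₁.contMDiff.continuous.mul (μ c.frame).contMDiff.continuous).continuousOn inter_subset_left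
      (hZ.dense_compl.open_subset_closure_inter c.isOpen) hc
    simp only [h0, mul_zero] at h5
    exact one_ne_zero h5
  · apply c.scaleProd_ne_zero (c.U_subset hc) hpZ
    rw [h1 p hc, h0, mul_zero]

end TopMultivector

/-- The restriction of `φ^*ν` to b-fields can be computed in two ways: as `w(φ^*ν) μ`, and as the
pull-back of `w'(ν) μ'`. As `φ^*μ' = μ` has no zeros, the coefficients agree. -/
theorem BDiffeo.pushesTo_of_pull_eq {w w' : TopMultivector m M} {μ μ' : BForm m Z m}
    (hμ : μ.NowhereVanishing) (h : w.IsInverse μ) (h' : w'.IsInverse μ') {φ : BDiffeo m Z}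
    (hφ : φ.pull μ' = μ) : φ.PushesTo w w' := by
  intro ν
  ext p
  obtain ⟨V, hV⟩ := hμ p
  refine mul_right_cancel₀ hV ?_
  have h1 := congrArg (fun f : SmoothFun m M ↦ f p)
    (h (BForm.pull φ.toDiffeo Set.preimage_empty ν) V)
  have h2 := congrArg (fun f : SmoothFun m M ↦ f (φ.toDiffeo p))
    (h' ν fun i ↦ bPush φ.toDiffeo φ.preimage_eq (V i))
  have h3 : μ V p = μ' (fun i ↦ bPush φ.toDiffeo φ.preimage_eq (V i)) (φ.toDiffeo p) := by
    rw [← hφ]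
    rfl
  refine Eq.trans ?_ (h2.symm.trans h1)
  rw [h3]
  rfl

end

end BGeom
end

theorem mainTheorem6 (m : ℕ) (M : Type*) [TopologicalSpace M] [T2Space M] [CompactSpace M]
    [ChartedSpace (EuclideanSpace ℝ (Fin m)) M] [IsManifold (𝓡 m) ∞ M]
    (Z : Set M) (hZ : BGeom.IsBManifold m Z) :
    (∀ μ μ' : BGeom.BForm m Z m, μ.NowhereVanishing → μ'.NowhereVanishing →
      BGeom.topClass μ = BGeom.topClass μ' → ∃ φ : BGeom.BDiffeo m Z, φ.pull μ' = μ) ∧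
    (∀ w : BGeom.TopMultivector m M, w.IsGenericNambu → w.singularLocus = Z →
      ∃! μ : BGeom.BForm m Z m, w.IsInverse μ) ∧
    (∀ (w w' : BGeom.TopMultivector m M) (μ μ' : BGeom.BForm m Z m),
      w.IsGenericNambu → w.singularLocus = Z → w'.IsGenericNambu → w'.singularLocus = Z →
      w.IsInverse μ → w'.IsInverse μ' → BGeom.topClass μ = BGeom.topClass μ' →
      ∃ φ : BGeom.BDiffeo m Z, φ.PushesTo w w') := by
  refine ⟨fun μ μ' hμ hμ' h ↦ BGeom.exists_bDiffeo_pull_eq hZ hμ hμ' h,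
    fun w hw hwZ ↦ BGeom.TopMultivector.existsUnique_isInverse hZ hw hwZ, ?_⟩
  intro w w' μ μ' _ hwZ _ hwZ' h h' hc
  have hμ := BGeom.TopMultivector.IsInverse.nowhereVanishing hZ hwZ h
  have hμ' := BGeom.TopMultivector.IsInverse.nowhereVanishing hZ hwZ' h'
  obtain ⟨φ, hφ⟩ := BGeom.exists_bDiffeo_pull_eq hZ hμ hμ' hc
  exact ⟨φ, BGeom.BDiffeo.pushesTo_of_pull_eq hμ h h' hφ⟩
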